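/- Let $\Omega=(0,L)$, $L>0$, and let $p\ge 2$ be real. Assume (Hyp1) $\mu:\mathbb R^+\to\mathbb R^+$ is a non-increasing $C^1$ function with $\mu(0)>0$ and $l:=1-\int_0^\infty\mu(s)\,ds>0$, and there is an increasing, strictly convex $C^1$ function $H:\mathbb R^+\to\mathbb R^+$ with $H(0)=H'(0)=0$, $\lim_{t\to\infty}H'(t)=\infty$ and $$\int_0^\infty\frac{\mu(s)}{H^{-1}(-\mu'(s))}\,ds+\sup_{s\in\mathbb R^+}\frac{\mu(s)}{H^{-1}(-\mu'(s))}<\infty .$$ Consider the problem $$y''-(y_x+y'_x+y''_x)_x+\int_0^\infty\mu(s)\,y_{xx}(t-s)\,ds=|y|^{p-2}y+\big(|y_x|^{p-2}y_x\big)_x\quad\text{in }\Omega,\ t>0,$$ $$y(0,t)=y(L,t)=0,\qquad y(x,-t)=y_0(x,t)\ (t\ge0),\qquad y'(x,0)=y_1(x),$$ where $y_0(t)\in H^1_0\cap H^2$ for $t\ge 0$, $y_0$ is strongly measurable with $\int_0^\infty\mu(s)\|y_0(s)\|_{H^2}^2ds<\infty$, and $y_1\in H^1_0\cap H^2$. A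 weak solution on $[0,T]$ is a function $y$ with these data such that $y,y',y''\in L^\infty(0,T;H^1_0\cap H^2)$ and, for almost all $t\in(0,T)$ and all $w\in H^1_0$, $$\int_\Omega y''w\,dx+\int_\Omega(y_x+y'_x+y''_x)w_x\,dx-\int_\Omega\int_0^\infty\mu(s)y_x(t-s)\,ds\,w_x\,dx=\int_\Omega|y|^{p-2}y\,w\,dx-\int_\Omega|y_x|^{p-2}y_xw_x\,dx .$$ Put $$J(t)=\tfrac l2\int_\Omega|y_x|^2dx+\tfrac12\int_\Omega\int_0^\infty\mu(s)|y_x(t)-y_x(t-s)|^2ds\,dx+\tfrac1p\int_\Omega|y_x|^pdx-\tfrac1p\int_\Omega|y|^pdx,$$ $$I(t)=l\int_\Omega|y_x|^2dx+\int_\Omega\int_0^\infty\mu(s)|y_x(t)-y_x(t-s)|^2ds\,dx+\int_\Omega|y_x|^pdx-\int_\Omega|y|^pdx,$$ $$E(t)=\tfrac12\int_\Omega|y'|^2dx+\tfrac12\int_\Omega|y'_x|^2dx+J(t),\qquad d=\inf_{u\in H^1_0\cap H^2\setminus\{0\}}\ \sup_{\nu\ge0}J(\nu u)\in[0,\infty],$$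 where in the definition of $d$ the function $u$ is regarded as independent of time. Let $C$ be the best constant in $\|u\|_{L^p(\Omega)}\le C\|u_x\|_{L^2(\Omega)}$, $u\in H^1_0(\Omega)$. Suppose that $y_0(0)$ is in the stable set $W$, i.e. either $I(0)>0$ and $J(0)<d$, or $y_0(0)=0$, and that $$C^{p}\,l^{\,1-p/2}\Big(\frac{2p}{p-2}E(0)\Big)^{(p-2)/2}<l,$$ where for $p=2$ the factor $(\cdots)^{(p-2)/2}$ is read as $1$; here $I(0)$, $J(0)$, $E(0)$ are computed from the past $y_0$ and the velocity $y_1$. Then the local solution is global in time: there is a function $y$ on $[0,\infty)$ that is a weak solution on $[0,T]$ for every $T>0$; every weak solution on an interval $[0,T]$ with the same data coincides with $y$ on $[0,T]$; and $$y\in L^\infty(\mathbb R^+;H^1_0\cap H^2),\qquad y'\in L^\infty(\mathbb R^+;H^1_0).$$ -/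

import Mathlib

open MeasureTheory Set Filter Topology
open scoped ENNReal NNReal

noncomputable section

namespace Love

/-- The space `L²(0,L)`. -/
abbrev L2 (L : ℝ) : Type := Lp ℝ 2 (volume.restrict (Ioo (0 : ℝ) L))

/-- All pairs `(φ, φ')` with `φ ∈ C_c^∞(0,L)`, as elements of `L²(0,L) × L²(0,L)`. -/
def testPairs (L : ℝ) : Set (L2 L × L2 L) :=
  {r | ∃ φ : ℝ → ℝ, ContDiff ℝ (⊤ : ℕ∞) φ ∧ HasCompactSupport φ ∧ tsupport φ ⊆ Ioo 0 L ∧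
    (∀ᵐ x ∂volume.restrict (Ioo (0 : ℝ) L), r.1 x = φ x) ∧
    (∀ᵐ x ∂volume.restrict (Ioo (0 : ℝ) L), r.2 x = deriv φ x)}

/-- `H¹₀(0,L)`: the closure of `C_c^∞(0,L)` in the `H¹` norm. A function `u` is stored
as the pair `(u, u_x)`; the norm is (equivalent to) the `H¹` norm. -/
def H10 (L : ℝ) : Submodule ℝ (L2 L × L2 L) :=
  (Submodule.span ℝ (testPairs L)).topologicalClosure

/-- `H¹₀(0,L) ∩ H²(0,L)`. A function `u` is stored as the triple `(u, u_x, u_xx)`: the pair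
`(u, u_x)` is in `H¹₀`, and `u_xx ∈ L²` is the weak derivative of `u_x`, that is
`∫ u_x φ' = - ∫ u_xx φ` for all `φ ∈ C_c^∞(0,L)`. The norm is (equivalent to) the `H²` norm. -/
def H10H2 (L : ℝ) : Submodule ℝ (L2 L × L2 L × L2 L) where
  carrier := {q | (q.1, q.2.1) ∈ H10 L ∧
    ∀ r ∈ testPairs L, inner ℝ q.2.1 r.2 = - inner ℝ q.2.2 r.1}
  add_mem' := by
    rintro a b ⟨ha, ha'⟩ ⟨hb, hb'⟩
    refine ⟨(H10 L).add_mem ha hb, fun r hr => ?_⟩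
    simp only [Prod.fst_add, Prod.snd_add, inner_add_left, ha' r hr, hb' r hr]
    ring
  zero_mem' := ⟨(H10 L).zero_mem, fun r _ => by simp⟩
  smul_mem' := by
    rintro c a ⟨ha, ha'⟩
    refine ⟨(H10 L).smul_mem c ha, fun r hr => ?_⟩
    simp only [Prod.smul_fst, Prod.smul_snd, real_inner_smul_left, ha' r hr]
    ring

/-- `H¹₀ ∩ H²` is complete, so that the Bochner integrals below have their usual meaning. -/
instance (L : ℝ) : CompleteSpace (H10H2 L) := by
  have h1 : IsClosed {q : L2 L × L2 L × L2 L | (q.1, q.2.1) ∈ H10 L} :=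
    (Submodule.isClosed_topologicalClosure (Submodule.span ℝ (testPairs L))).preimage
      (by fun_prop : Continuous fun q : L2 L × L2 L × L2 L => (q.1, q.2.1))
  have h2 : IsClosed {q : L2 L × L2 L × L2 L |
      ∀ r ∈ testPairs L, inner ℝ q.2.1 r.2 = - inner ℝ q.2.2 r.1} := by
    simp only [ofPred_forall]
    exact isClosed_iInter fun r => isClosed_iInter fun _ =>
      isClosed_eq (by fun_prop) (by fun_prop)
  exact (h1.inter h2).completeSpace_coe

variable {L : ℝ}

/-- The function `u` itself, as an element of `L²`. -/
def fn (u : H10H2 L) : L2 L := u.1.1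

/-- The derivative `u_x`, as an element of `L²`. -/
def dx (u : H10H2 L) : L2 L := u.1.2.1

/-- The inclusion of `H¹₀ ∩ H²` in `H¹₀`. -/
def toH10 (u : H10H2 L) : H10 L := ⟨(u.1.1, u.1.2.1), u.2.1⟩

/-- `∫_Ω |u|^p dx`. -/
def powInt (p : ℝ) (u : L2 L) : ℝ := ∫ x in Ioo (0 : ℝ) L, |u x| ^ p

/-- The hypothesis on the memory kernel: `μ : ℝ⁺ → ℝ⁺` is a non-increasing `C¹` function with
`μ(0) > 0` and `1 - ∫₀^∞ μ > 0`, and there is an increasing strictly convex `C¹` function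
`H : ℝ⁺ → ℝ⁺` with `H(0) = H'(0) = 0`, `H'(t) → ∞`, such that `μ(s) / H⁻¹(-μ'(s))` is integrable
and bounded on `ℝ⁺` (the quotient takes values in `[0,∞]`, and is `∞` where `μ'(s) = 0 < μ(s)`). -/
structure Hyp1 (μ : ℝ → ℝ) : Prop where
  nonneg : ∀ s, 0 ≤ s → 0 ≤ μ s
  antitone : AntitoneOn μ (Ici 0)
  contDiff : ContDiffOn ℝ 1 μ (Ici 0)
  integrable : IntegrableOn μ (Ioi 0)
  one_sub_integral_pos : 0 < 1 - ∫ s in Ioi (0 : ℝ), μ s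
  pos_zero : 0 < μ 0
  convex : ∃ H : ℝ → ℝ, MapsTo H (Ici 0) (Ici 0) ∧ StrictMonoOn H (Ici 0) ∧
    StrictConvexOn ℝ (Ici 0) H ∧ ContDiffOn ℝ 1 H (Ici 0) ∧
    H 0 = 0 ∧ derivWithin H (Ici 0) 0 = 0 ∧
    Tendsto (derivWithin H (Ici 0)) atTop atTop ∧
    (∫⁻ s in Ioi (0 : ℝ), ENNReal.ofReal (μ s) /
      ENNReal.ofReal (Function.invFunOn H (Ici 0) (-derivWithin μ (Ici 0) s))) < ⊤ ∧
    (⨆ s ∈ Ici (0 : ℝ), ENNReal.ofReal (μ s) /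
      ENNReal.ofReal (Function.invFunOn H (Ici 0) (-derivWithin μ (Ici 0) s))) < ⊤

/-- `l = 1 - ∫₀^∞ μ(s) ds`. -/
def ell (μ : ℝ → ℝ) : ℝ := 1 - ∫ s in Ioi (0 : ℝ), μ s

/-- `∫_Ω ∫₀^∞ μ(s) |y_x(t) - y_x(t-s)|² ds dx` along a trajectory `y` defined on `(-∞, t]`. -/
def memory (μ : ℝ → ℝ) (y : ℝ → H10H2 L) (t : ℝ) : ℝ :=
  ∫ s in Ioi (0 : ℝ), μ s * ‖dx (y t) - dx (y (t - s))‖ ^ 2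

/-- The functional `J(t)` along a trajectory. -/
def J (μ : ℝ → ℝ) (p : ℝ) (y : ℝ → H10H2 L) (t : ℝ) : ℝ :=
  1 / 2 * (ell μ * ‖dx (y t)‖ ^ 2) + 1 / 2 * memory μ y t
    + 1 / p * powInt p (dx (y t)) - 1 / p * powInt p (fn (y t))

/-- The functional `I(t)` along a trajectory. -/
def I (μ : ℝ → ℝ) (p : ℝ) (y : ℝ → H10H2 L) (t : ℝ) : ℝ :=
  ell μ * ‖dx (y t)‖ ^ 2 + memory μ y t + powInt p (dx (y t)) - powInt p (fn (y t))

/-- The energy `E(t)` along a trajectory `y` whose velocity at time `t` is `v = y'(t)`. -/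
def energy (μ : ℝ → ℝ) (p : ℝ) (y : ℝ → H10H2 L) (v : H10H2 L) (t : ℝ) : ℝ :=
  1 / 2 * ‖fn v‖ ^ 2 + 1 / 2 * ‖dx v‖ ^ 2 + J μ p y t

/-- The mountain pass level `d = inf_{u ≠ 0} sup_{ν ≥ 0} J(ν u) ∈ [-∞, ∞]`, where
`u ∈ H¹₀ ∩ H²` is regarded as a trajectory that does not depend on time. -/
def mountainPass (L : ℝ) (μ : ℝ → ℝ) (p : ℝ) : EReal :=
  ⨅ (u : H10H2 L) (_ : u ≠ 0), ⨆ ν : ℝ≥0, ((J μ p (fun _ => (ν : ℝ) • u) 0 : ℝ) : EReal)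

/-- The trajectory `y` is in the stable set `W` at time `t`. -/
def InStableSet (μ : ℝ → ℝ) (p : ℝ) (y : ℝ → H10H2 L) (t : ℝ) : Prop :=
  (0 < I μ p y t ∧ (J μ p y t : EReal) < mountainPass L μ p) ∨ y t = 0

/-- The best constant `C` in `‖u‖_{L^p} ≤ C ‖u_x‖_{L²}`, `u ∈ H¹₀(0,L)`. -/
def poincareConst (L p : ℝ) : ℝ :=
  sInf {C : ℝ | 0 ≤ C ∧ ∀ u : H10 L, powInt p u.1.1 ^ (1 / p) ≤ C * ‖u.1.2‖}

/-- The trajectory on `ℝ` with prescribed past `y(-s) = y₀(s)`, `s ≥ 0`. -/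
def withPast (y₀ y : ℝ → H10H2 L) (t : ℝ) : H10H2 L := if t ≤ 0 then y₀ (-t) else y t

/-- `y`, with time derivatives `yt = y'` and `ytt = y''`, is a weak solution on `[0,T]` of
`y'' - (y_x + y'_x + y''_x)_x + ∫₀^∞ μ(s) y_xx(t-s) ds = |y|^{p-2} y + (|y_x|^{p-2} y_x)_x`
in `(0,L)` with homogeneous Dirichlet conditions and data `y(-s) = y₀(s)`, `y'(0) = y₁`.
The functions `y`, `y'` in `W^{1,∞}(0,T; H¹₀ ∩ H²)` are given by their continuous
representatives, i.e. by the integrals of their derivatives. -/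
structure IsWeakSolution (μ : ℝ → ℝ) (p : ℝ) (y₀ : ℝ → H10H2 L) (y₁ : H10H2 L) (T : ℝ)
    (y yt ytt : ℝ → H10H2 L) : Prop where
  memLp_y : MemLp y ∞ (volume.restrict (Ioo 0 T))
  memLp_yt : MemLp yt ∞ (volume.restrict (Ioo 0 T))
  memLp_ytt : MemLp ytt ∞ (volume.restrict (Ioo 0 T))
  y_eq : ∀ t ∈ Icc 0 T, y t = y₀ 0 + ∫ s in (0 : ℝ)..t, yt s
  yt_eq : ∀ t ∈ Icc 0 T, yt t = y₁ + ∫ s in (0 : ℝ)..t, ytt s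
  weak_eq : ∀ᵐ t ∂volume.restrict (Ioo 0 T), ∀ w : H10 L,
    inner ℝ (fn (ytt t)) w.1.1
      + inner ℝ (dx (y t) + dx (yt t) + dx (ytt t)) w.1.2
      - inner ℝ (∫ s in Ioi (0 : ℝ), μ s • dx (withPast y₀ y (t - s))) w.1.2
    = (∫ x in Ioo (0 : ℝ) L, |fn (y t) x| ^ (p - 2) * fn (y t) x * w.1.1 x)
      - ∫ x in Ioo (0 : ℝ) L, |dx (y t) x| ^ (p - 2) * dx (y t) x * w.1.2 x

end Love

end

/-! ### Memory kernels, paths with a past, and their convolutions -/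

noncomputable section

namespace Love

/-! The term `-y''_xx` makes the equation an ordinary differential equation with memory in `H¹₀`:
since `⟪y'', w⟫ + ⟪y''_x, w_x⟫` is the `H¹` inner product, Riesz representation (`PV`) solves for
`y''`. Once the power is continued linearly beyond a level `R` (`trunc`), the right-hand side is
Lipschitz and a contraction in an exponentially weighted norm gives a global solution
(`exists_truncSol`). It remains to find a level that the solution never reaches, to show that the
solution stays in `H²`, and to make the bounds uniform in time.

The energy is non-increasing. The smallness condition puts a barrier slightly above the energy
level, which the continuous quantity `√l ‖y_x‖` cannot cross (`potential_well`). So the energy is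
coercive and bounded, uniformly in `R` (`Data.exists_coercive`).

Long-time control rests on an abstract damped equation (`Damped`). Monotonicity of the kernel makes
the energy decrease up to forcing (`Damped.energy_le`). If the memory term is treated as a forcing,
the rest of the energy decays exponentially (`Damped.kinPot_decay`). Among many long time windows
one has little dissipation; there the solution hardly moves, so the memory is small, the rest of the
energy becomes small by the end of the window, and monotonicity carries this to later times
(`Damped.window`). This yields a bound uniform in time (`Damped.bounded`), and for the truncated
problem decay of the energy to zero (`Data.tendsto_en`).

The sup bound of `y_x` comes from the flux `y''_x + y_x + y'_x - ∫ μ(s) y_x(t-s) ds + g(y_x)`, with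
`g` the truncated power. Its space derivative is `y'' - g(y)`, so the flux is bounded by the energy
and the `L¹` norm of `g(y_x)`, and the energy controls the latter uniformly in `R`
(`Data.exists_flux_bound`). With the flux given, the equation for `y_x` is local in `x`. It can be
multiplied by the indicator of any measurable set `K`, and `Damped.bounded` gives energies at most a
constant times the measure of `K` (`Data.exists_enK_bound`), which is a pointwise bound. A level `R`
above that bound makes the truncation invisible. In the same way the decay of the energy gives `y_x
→ 0` uniformly in `x` (`Data.dx_small`).

For `y_xx`, space differences are taken in the equation for `y_x`. Once `y_x` is small the power is
nearly linear, and its error is a small linear perturbation that `Damped.bounded` absorbs; before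
that time a Gronwall estimate suffices. The differences are therefore of first order uniformly in
time (`Data.exists_diff_bound`), and weak compactness turns this into an `H²` bound. Uniqueness
holds because any weak solution on a bounded interval is bounded together with its derivative, hence
solves a problem truncated at a higher level, where Gronwall applies (`Data.weak_unique`). -/

/-- A non-increasing continuous integrable memory kernel on `[0,∞)`. -/
structure IsKernel (μ : ℝ → ℝ) : Prop where
  nonneg : ∀ s, 0 ≤ s → 0 ≤ μ s
  antitone : AntitoneOn μ (Ici 0)
  cont : ContinuousOn μ (Ici 0)
  integrable : IntegrableOn μ (Ioi 0)

theorem Hyp1.isKernel {μ : ℝ → ℝ} (h : Hyp1 μ) : IsKernel μ :=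
  ⟨h.nonneg, h.antitone, h.contDiff.continuousOn, h.integrable⟩

/-- A path on `ℝ` that is continuous for `t ≥ 0`, with a past that is integrable against `μ`. -/
structure IsPath {F : Type*} [NormedAddCommGroup F] (μ : ℝ → ℝ) (φ : ℝ → F) : Prop where
  cont : ContinuousOn φ (Ici 0)
  meas : AEStronglyMeasurable (fun s => φ (-s)) (volume.restrict (Ioi 0))
  int : IntegrableOn (fun s => μ s * ‖φ (-s)‖) (Ioi 0)

/-- As `IsPath`, with a past that is square integrable against `μ`. -/
structure IsPath2 {F : Type*} [NormedAddCommGroup F] (μ : ℝ → ℝ) (φ : ℝ → F) : Prop where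
  cont : ContinuousOn φ (Ici 0)
  meas : AEStronglyMeasurable (fun s => φ (-s)) (volume.restrict (Ioi 0))
  int : IntegrableOn (fun s => μ s * ‖φ (-s)‖ ^ 2) (Ioi 0)

/-- The convolution `∫₀^∞ μ(s) φ(t-s) ds`. -/
def conv {F : Type*} [NormedAddCommGroup F] [NormedSpace ℝ F] (μ : ℝ → ℝ) (φ : ℝ → F) (t : ℝ) : F :=
  ∫ s in Ioi (0 : ℝ), μ s • φ (t - s)

theorem integrableOn_Ioi_shift {F : Type*} [NormedAddCommGroup F] (f : ℝ → F) (t : ℝ) :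
    IntegrableOn f (Ioi t) ↔ IntegrableOn (fun s => f (t + s)) (Ioi 0) := by
  have := (measurePreserving_add_left volume t).integrableOn_comp_preimage
    (measurableEmbedding_addLeft t) (f := f) (s := Ioi t)
  rw [← this]
  have h : (fun x => t + x) ⁻¹' Ioi t = Ioi (0 : ℝ) := by ext; simp
  rw [h]; rfl

theorem setIntegral_Ioi_shift {F : Type*} [NormedAddCommGroup F] [NormedSpace ℝ F]
    (f : ℝ → F) (t : ℝ) :
    ∫ s in Ioi t, f s = ∫ s in Ioi (0 : ℝ), f (t + s) := by
  have := (measurePreserving_add_left volume t).setIntegral_preimage_emb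
    (measurableEmbedding_addLeft t) f (Ioi t)
  rw [← this]
  have h : (fun x => t + x) ⁻¹' Ioi t = Ioi (0 : ℝ) := by ext; simp
  rw [h]

section Conv

variable {F : Type*} [NormedAddCommGroup F] [NormedSpace ℝ F] {μ : ℝ → ℝ} {φ : ℝ → F}

theorem IsKernel.measurable_shift (hμ : IsKernel μ) {t : ℝ} (ht : 0 ≤ t) :
    AEStronglyMeasurable (fun s => μ (t + s)) (volume.restrict (Ioi 0)) := by
  refine ContinuousOn.aestronglyMeasurable ?_ measurableSet_Ioi
  refine hμ.cont.comp (by fun_prop) fun s hs => ?_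
  have : (0 : ℝ) < s := hs
  simp only [mem_Ici]; linarith

theorem IsKernel.shift_le (hμ : IsKernel μ) {t s : ℝ} (ht : 0 ≤ t) (hs : 0 ≤ s) : μ (t + s) ≤ μ s :=
  hμ.antitone hs (by simp only [mem_Ici]; linarith) (by linarith)

/-- By monotonicity `t μ(t) ≤ ∫₀ᵗ μ`, which is at most the total mass, so `μ` decays at least like
`1/t`. -/
theorem IsKernel.tendsto_zero (hμ : IsKernel μ) : Tendsto μ atTop (𝓝 0) := by
  refine squeeze_zero' (g := fun t => (∫ s in Ioi (0 : ℝ), μ s) / t) ?_ ?_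
    (tendsto_const_nhds.div_atTop tendsto_id)
  · filter_upwards [eventually_ge_atTop 0] with t ht using hμ.nonneg t ht
  · filter_upwards [eventually_gt_atTop 0] with t ht
    rw [le_div_iff₀ ht]
    have h1 : ∫ s in Ioc (0 : ℝ) t, μ t ≤ ∫ s in Ioc (0 : ℝ) t, μ s :=
      setIntegral_mono_on (by simp) (hμ.integrable.mono_set Ioc_subset_Ioi_self) measurableSet_Ioc
        fun s hs => hμ.antitone hs.1.le ht.le hs.2
    have h2 : ∫ s in Ioc (0 : ℝ) t, μ s ≤ ∫ s in Ioi (0 : ℝ), μ s := by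
      refine setIntegral_mono_set hμ.integrable ?_ Ioc_subset_Ioi_self.eventuallyLE
      filter_upwards [self_mem_ae_restrict measurableSet_Ioi] with s hs using hμ.nonneg s (le_of_lt hs)
    simp [ht.le] at h1
    linarith

theorem IsPath.shift_integrable (hμ : IsKernel μ) (hφ : IsPath μ φ) {t : ℝ} (ht : 0 ≤ t) :
    IntegrableOn (fun s => μ (t + s) • φ (-s)) (Ioi 0) := by
  refine Integrable.mono' hφ.int ((hμ.measurable_shift ht).smul hφ.meas) ?_
  filter_upwards [self_mem_ae_restrict measurableSet_Ioi] with s hs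
  have hs : (0 : ℝ) < s := hs
  rw [norm_smul, Real.norm_of_nonneg (hμ.nonneg _ (by linarith))]
  exact mul_le_mul_of_nonneg_right (hμ.shift_le ht hs.le) (norm_nonneg _)

theorem IsPath.shift_integrable' (hμ : IsKernel μ) (hφ : IsPath μ φ) {t : ℝ} (ht : 0 ≤ t) :
    IntegrableOn (fun s => μ s • φ (t - s)) (Ioi t) := by
  rw [integrableOn_Ioi_shift]
  simpa using hφ.shift_integrable hμ ht

theorem IsPath.integrable_Ioc (hμ : IsKernel μ) (hφ : IsPath μ φ) {t : ℝ} :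
    IntegrableOn (fun s => μ s • φ (t - s)) (Ioc 0 t) := by
  refine (ContinuousOn.integrableOn_Icc ?_).mono_set Ioc_subset_Icc_self
  refine (hμ.cont.mono fun s hs => hs.1).smul (hφ.cont.comp (by fun_prop) fun s hs => ?_)
  simp only [mem_Ici]; linarith [hs.2]

theorem IsPath.integrable (hμ : IsKernel μ) (hφ : IsPath μ φ) {t : ℝ} (ht : 0 ≤ t) :
    IntegrableOn (fun s => μ s • φ (t - s)) (Ioi 0) := by
  rw [← Ioc_union_Ioi_eq_Ioi ht]
  exact (hφ.integrable_Ioc hμ).union (hφ.shift_integrable' hμ ht)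

/-- Splitting the lags at `s = t` separates the path on `[0,t]`, where it is continuous, from the
past, which is only integrable and is seen through the shifted kernel. -/
theorem IsPath.conv_eq (hμ : IsKernel μ) (hφ : IsPath μ φ) {t : ℝ} (ht : 0 ≤ t) :
    conv μ φ t = (∫ s in (0 : ℝ)..t, μ s • φ (t - s)) + ∫ s in Ioi (0 : ℝ), μ (t + s) • φ (-s) := by
  have h : conv μ φ t = ∫ s in Ioc 0 t ∪ Ioi t, μ s • φ (t - s) := by
    rw [Ioc_union_Ioi_eq_Ioi ht, conv]
  rw [h, setIntegral_union (by simp) measurableSet_Ioi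
    (hφ.integrable_Ioc hμ) (hφ.shift_integrable' hμ ht), intervalIntegral.integral_of_le ht,
    setIntegral_Ioi_shift _ t]
  simp

theorem IsPath.continuousOn_conv (hμ : IsKernel μ) (hφ : IsPath μ φ) :
    ContinuousOn (conv μ φ) (Ici 0) := by
  -- Clamping both arguments to `[0,∞)` makes the integrand jointly continuous on the whole plane
  -- without changing it for `0 ≤ s ≤ t`.
  have h1 : Continuous fun t : ℝ => ∫ s in (0 : ℝ)..t, μ (max s 0) • φ (max (t - s) 0) := by
    refine intervalIntegral.continuous_parametric_intervalIntegral_of_continuous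
      (f := fun t s => μ (max s 0) • φ (max (t - s) 0)) ?_ continuous_id
    refine Continuous.smul ?_ ?_
    · exact hμ.cont.comp_continuous (by fun_prop) fun x => mem_Ici.2 (le_max_right _ _)
    · exact hφ.cont.comp_continuous (by fun_prop) fun x => mem_Ici.2 (le_max_right _ _)
  have h2 : ContinuousOn (fun t => ∫ s in Ioi (0 : ℝ), μ (t + s) • φ (-s)) (Ici 0) := by
    refine continuousOn_of_dominated (bound := fun s => μ s * ‖φ (-s)‖) ?_ ?_ hφ.int ?_
    · exact fun t ht => (hφ.shift_integrable hμ ht).aestronglyMeasurable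
    · intro t ht
      filter_upwards [self_mem_ae_restrict measurableSet_Ioi] with s hs
      have hs : (0 : ℝ) < s := hs
      have ht : (0 : ℝ) ≤ t := ht
      rw [norm_smul, Real.norm_of_nonneg (hμ.nonneg _ (by linarith))]
      exact mul_le_mul_of_nonneg_right (hμ.shift_le ht hs.le) (norm_nonneg _)
    · filter_upwards [self_mem_ae_restrict measurableSet_Ioi] with s hs
      have hs : (0 : ℝ) < s := hs
      refine ContinuousOn.smul (hμ.cont.comp (by fun_prop) fun t ht => ?_) continuousOn_const
      have ht : (0 : ℝ) ≤ t := ht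
      simp only [mem_Ici]; linarith
  refine (h1.continuousOn.add h2).congr fun t ht => ?_
  rw [hφ.conv_eq hμ ht]
  congr 1
  refine intervalIntegral.integral_congr fun s hs => ?_
  rw [uIcc_of_le ht] at hs
  simp only [max_eq_left hs.1, max_eq_left (sub_nonneg.2 hs.2)]

theorem IsPath.tendsto_past (hμ : IsKernel μ) (hφ : IsPath μ φ) :
    Tendsto (fun t => ∫ s in Ioi (0 : ℝ), μ (t + s) • φ (-s)) atTop (𝓝 0) := by
  have h0 : (0 : F) = ∫ s in Ioi (0 : ℝ), (0 : F) := by simp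
  rw [h0]
  refine tendsto_integral_filter_of_dominated_convergence (fun s => μ s * ‖φ (-s)‖) ?_ ?_ hφ.int ?_
  · filter_upwards [eventually_ge_atTop 0] with t ht
    exact (hφ.shift_integrable hμ ht).aestronglyMeasurable
  · filter_upwards [eventually_ge_atTop 0] with t ht
    filter_upwards [self_mem_ae_restrict measurableSet_Ioi] with s hs
    have hs : (0 : ℝ) < s := hs
    rw [norm_smul, Real.norm_of_nonneg (hμ.nonneg _ (by linarith))]
    exact mul_le_mul_of_nonneg_right (hμ.shift_le ht hs.le) (norm_nonneg _)
  · refine Eventually.of_forall fun s => ?_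
    have : Tendsto (fun t => μ (t + s)) atTop (𝓝 0) :=
      hμ.tendsto_zero.comp (tendsto_atTop_add_const_right _ _ tendsto_id)
    simpa using this.smul_const (φ (-s))

theorem IsKernel.tendsto_tail (hμ : IsKernel μ) :
    Tendsto (fun S => ∫ s in Ioi S, μ s) atTop (𝓝 0) := by
  have h := intervalIntegral_tendsto_integral_Ioi 0 hμ.integrable tendsto_id
  have h2 : Tendsto (fun S => (∫ s in Ioi (0 : ℝ), μ s) - ∫ s in (0 : ℝ)..S, μ s) atTop (𝓝 0) := by
    simpa using h.const_sub (∫ s in Ioi (0 : ℝ), μ s)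
  refine h2.congr' ?_
  filter_upwards [eventually_ge_atTop 0] with S hS
  rw [← Ioc_union_Ioi_eq_Ioi hS, setIntegral_union (by simp) measurableSet_Ioi
    (hμ.integrable.mono_set Ioc_subset_Ioi_self) (hμ.integrable.mono_set (Ioi_subset_Ioi hS)),
    intervalIntegral.integral_of_le hS]
  ring

end Conv

section Square

variable {F : Type*} [NormedAddCommGroup F] {μ : ℝ → ℝ} {φ : ℝ → F}

theorem IsPath2.isPath (hμ : IsKernel μ) (hφ : IsPath2 μ φ) : IsPath μ φ where
  cont := hφ.cont
  meas := hφ.meas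
  int := by
    refine Integrable.mono' (hμ.integrable.add hφ.int) ?_ ?_
    · exact hμ.integrable.aestronglyMeasurable.mul hφ.meas.norm
    · filter_upwards [self_mem_ae_restrict measurableSet_Ioi] with s hs
      have := hμ.nonneg s (le_of_lt hs)
      rw [norm_mul, norm_norm, Real.norm_of_nonneg this]
      simp only [Pi.add_apply]
      nlinarith [mul_nonneg this (sq_nonneg (‖φ (-s)‖ - 1)), mul_nonneg this (norm_nonneg (φ (-s)))]

theorem IsPath2.isPath_sq (hφ : IsPath2 μ φ) : IsPath μ (fun t => ‖φ t‖ ^ 2) where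
  cont := hφ.cont.norm.pow 2
  meas := hφ.meas.norm.pow 2
  int := by simpa using hφ.int

end Square

end Love

end

/-! ### The memory functional and its one-sided derivative -/

noncomputable section

namespace Love

theorem setIntegral_comb {f g h : ℝ → ℝ} {A : Set ℝ} (c : ℝ) (hf : IntegrableOn f A)
    (hg : IntegrableOn g A) (hh : IntegrableOn h A) :
    ∫ s in A, (f s + c * g s + h s) = (∫ s in A, f s) + c * (∫ s in A, g s) + ∫ s in A, h s := by
  have h1 : ∫ s in A, (f s + c * g s + h s) = (∫ s in A, (f s + c * g s)) + ∫ s in A, h s :=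
    integral_add (hf.add (hg.const_mul c)) hh
  rw [h1, integral_add hf (hg.const_mul c), integral_const_mul]

section Memory

variable {H : Type*} [NormedAddCommGroup H] [InnerProductSpace ℝ H]

set_option linter.unusedSectionVars false

local notation "⟪" x ", " y "⟫" => inner ℝ x y

/-- The memory functional `∫₀^∞ μ(s) ‖ζ(t) - ζ(t-s)‖² ds`. -/
def mem (μ : ℝ → ℝ) (ζ : ℝ → H) (t : ℝ) : ℝ :=
  ∫ s in Ioi (0 : ℝ), μ s * ‖ζ t - ζ (t - s)‖ ^ 2

/-- The memory force `∫₀^∞ μ(s) (ζ(t) - ζ(t-s)) ds`. -/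
def memVec (μ : ℝ → ℝ) (ζ : ℝ → H) (t : ℝ) : H :=
  ∫ s in Ioi (0 : ℝ), μ s • (ζ t - ζ (t - s))

/-- The contribution of the past before time `0`, seen from time `t`. -/
def hist (μ : ℝ → ℝ) (ζ : ℝ → H) (t : ℝ) : ℝ :=
  ∫ s in Ioi (0 : ℝ), μ (t + s) * ‖ζ (-s)‖ ^ 2

variable {μ : ℝ → ℝ} {ζ : ℝ → H}

theorem IsKernel.ae_nonneg (hμ : IsKernel μ) : ∀ᵐ s ∂volume.restrict (Ioi (0 : ℝ)), 0 ≤ μ s := by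
  filter_upwards [self_mem_ae_restrict measurableSet_Ioi] with s hs using hμ.nonneg s (le_of_lt hs)

theorem IsPath2.integrable_sq (hμ : IsKernel μ) (hζ : IsPath2 μ ζ) {t : ℝ} (ht : 0 ≤ t) :
    IntegrableOn (fun s => μ s * ‖ζ (t - s)‖ ^ 2) (Ioi 0) := by
  simpa using hζ.isPath_sq.integrable hμ ht

theorem IsPath2.integrable_sub_sq (hμ : IsKernel μ) (hζ : IsPath2 μ ζ) {t : ℝ} (ht : 0 ≤ t) (x : H) :
    IntegrableOn (fun s => μ s * ‖x - ζ (t - s)‖ ^ 2) (Ioi 0) := by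
  have h1 := (hζ.integrable_sq hμ ht)
  have h2 := ((hζ.isPath hμ).integrable hμ ht)
  have h3 : IntegrableOn (fun s => ⟪x, μ s • ζ (t - s)⟫) (Ioi 0) := h2.const_inner x
  refine (((hμ.integrable.mul_const (‖x‖ ^ 2)).sub (h3.const_mul 2)).add h1).congr ?_
  refine Eventually.of_forall fun s => ?_
  simp only [Pi.add_apply, Pi.sub_apply, real_inner_smul_right, norm_sub_sq_real]
  ring

theorem IsPath2.integrable_sub (hμ : IsKernel μ) (hζ : IsPath2 μ ζ) {t : ℝ} (ht : 0 ≤ t) (x : H) :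
    IntegrableOn (fun s => μ s • (x - ζ (t - s))) (Ioi 0) := by
  refine ((hμ.integrable.smul_const x).sub ((hζ.isPath hμ).integrable hμ ht)).congr ?_
  refine Eventually.of_forall fun s => ?_
  simp only [Pi.sub_apply, smul_sub]

theorem IsPath2.memVec_eq (hμ : IsKernel μ) (hζ : IsPath2 μ ζ) [CompleteSpace H] {t : ℝ} (ht : 0 ≤ t) :
    memVec μ ζ t = (∫ s in Ioi (0 : ℝ), μ s) • ζ t - conv μ ζ t := by
  rw [memVec, conv, ← integral_smul_const, ← integral_sub (hμ.integrable.smul_const _)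
    ((hζ.isPath hμ).integrable hμ ht)]
  simp only [smul_sub]

theorem IsPath2.mem_eq (hμ : IsKernel μ) (hζ : IsPath2 μ ζ) [CompleteSpace H] {t : ℝ} (ht : 0 ≤ t) :
    mem μ ζ t = (∫ s in Ioi (0 : ℝ), μ s) * ‖ζ t‖ ^ 2 - 2 * ⟪ζ t, conv μ ζ t⟫
      + conv μ (fun r => ‖ζ r‖ ^ 2) t := by
  have h2 := ((hζ.isPath hμ).integrable hμ ht)
  have h3 : IntegrableOn (fun s => ⟪ζ t, μ s • ζ (t - s)⟫) (Ioi 0) := h2.const_inner (ζ t)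
  rw [conv, ← integral_inner h2, ← integral_mul_const, sub_eq_add_neg, ← neg_mul, conv,
    ← setIntegral_comb (-2) (hμ.integrable.mul_const _) h3 (hζ.isPath_sq.integrable hμ ht), mem]
  refine integral_congr_ae (Eventually.of_forall fun s => ?_)
  simp only [real_inner_smul_right, norm_sub_sq_real, smul_eq_mul]
  ring

theorem IsPath2.continuousOn_mem (hμ : IsKernel μ) (hζ : IsPath2 μ ζ) [CompleteSpace H] :
    ContinuousOn (mem μ ζ) (Ici 0) :=
  (((continuousOn_const.mul (hζ.cont.norm.pow 2)).sub
    (continuousOn_const.mul (hζ.cont.inner ((hζ.isPath hμ).continuousOn_conv hμ)))).add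
    (hζ.isPath_sq.continuousOn_conv hμ)).congr fun _ ht => hζ.mem_eq hμ ht

theorem mem_nonneg (hμ : IsKernel μ) (t : ℝ) : 0 ≤ mem μ ζ t := by
  refine integral_nonneg_of_ae ?_
  filter_upwards [hμ.ae_nonneg] with s hs using mul_nonneg hs (sq_nonneg _)

theorem hist_nonneg (hμ : IsKernel μ) {t : ℝ} (ht : 0 ≤ t) : 0 ≤ hist μ ζ t := by
  refine integral_nonneg_of_ae ?_
  filter_upwards [self_mem_ae_restrict measurableSet_Ioi] with s hs
  have hs : (0 : ℝ) < s := hs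
  exact mul_nonneg (hμ.nonneg _ (by linarith)) (sq_nonneg _)

theorem IsPath2.hist_anti (hμ : IsKernel μ) (hζ : IsPath2 μ ζ) {a t : ℝ} (ha : 0 ≤ a) (hat : a ≤ t) :
    hist μ ζ t ≤ hist μ ζ a := by
  have h : ∀ {r : ℝ}, 0 ≤ r → IntegrableOn (fun s => μ (r + s) * ‖ζ (-s)‖ ^ 2) (Ioi 0) :=
    fun hr => by simpa using hζ.isPath_sq.shift_integrable hμ hr
  refine setIntegral_mono_on (h (ha.trans hat)) (h ha) measurableSet_Ioi fun s hs => ?_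
  have hs : (0 : ℝ) < s := hs
  refine mul_le_mul_of_nonneg_right (hμ.antitone ?_ ?_ (by linarith)) (sq_nonneg _) <;>
  · simp only [mem_Ici]; linarith

theorem IsPath2.tendsto_hist (hμ : IsKernel μ) (hζ : IsPath2 μ ζ) :
    Tendsto (hist μ ζ) atTop (𝓝 0) := by
  simpa [hist] using! hζ.isPath_sq.tendsto_past hμ

/-- Jensen's inequality in variance form: the integral of `μ(s) ‖(ζ(t) - ζ(t-s)) - m‖²`, with `m`
the memory force, is nonnegative, and the kernel has mass at most one. -/
theorem IsPath2.norm_memVec_sq_le (hμ : IsKernel μ) (hκ : ∫ s in Ioi (0 : ℝ), μ s ≤ 1)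
    (hζ : IsPath2 μ ζ) [CompleteSpace H] {t : ℝ} (ht : 0 ≤ t) :
    ‖memVec μ ζ t‖ ^ 2 ≤ mem μ ζ t := by
  set m := memVec μ ζ t with hm
  have h1 := hζ.integrable_sub_sq hμ ht (ζ t)
  have h2 := hζ.integrable_sub hμ ht (ζ t)
  have h3 : IntegrableOn (fun s => ⟪m, μ s • (ζ t - ζ (t - s))⟫) (Ioi 0) := h2.const_inner m
  have h4 : 0 ≤ ∫ s in Ioi (0 : ℝ), μ s * ‖(ζ t - ζ (t - s)) - m‖ ^ 2 := by
    refine integral_nonneg_of_ae ?_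
    filter_upwards [hμ.ae_nonneg] with s hs using mul_nonneg hs (sq_nonneg _)
  have h5 : ∫ s in Ioi (0 : ℝ), μ s * ‖(ζ t - ζ (t - s)) - m‖ ^ 2
      = mem μ ζ t + (-2) * ⟪m, m⟫ + (∫ s in Ioi (0 : ℝ), μ s) * ‖m‖ ^ 2 := by
    nth_rewrite 3 [hm]
    rw [memVec, ← integral_inner h2, ← integral_mul_const, mem,
      ← setIntegral_comb (-2) h1 h3 (hμ.integrable.mul_const _)]
    refine integral_congr_ae (Eventually.of_forall fun s => ?_)
    simp only [real_inner_smul_right, norm_sub_sq_real (ζ t - ζ (t - s)), real_inner_comm m]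
    ring
  rw [h5, real_inner_self_eq_norm_sq] at h4
  nlinarith [sq_nonneg ‖m‖]

/-- Lags shorter than `r - t` only see the path on `[t, r]`. For the longer lags the shift `s ↦ s +
(r - t)` moves the base time back to `t`, and monotonicity of `μ` allows the shifted kernel to be
replaced by `μ`; this discards the dissipation due to the decrease of `μ`. The square is then
expanded around `ζ t`. -/
theorem IsPath2.mem_step (hμ : IsKernel μ) (hζ : IsPath2 μ ζ) [CompleteSpace H] {t r A : ℝ}
    (ht : 0 ≤ t) (hr : t ≤ r) (hA : ∀ σ ∈ Icc t r, ‖ζ r - ζ σ‖ ^ 2 ≤ A) :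
    mem μ ζ r ≤ mem μ ζ t + 2 * ⟪ζ r - ζ t, memVec μ ζ t⟫
      + (∫ s in Ioi (0 : ℝ), μ s) * ‖ζ r - ζ t‖ ^ 2 + μ 0 * A * (r - t) := by
  have hint := hζ.integrable_sub_sq hμ (ht.trans hr) (ζ r)
  have hrt : 0 ≤ r - t := sub_nonneg.2 hr
  have e0 : mem μ ζ r = (∫ s in Ioc 0 (r - t), μ s * ‖ζ r - ζ (r - s)‖ ^ 2)
      + ∫ s in Ioi (r - t), μ s * ‖ζ r - ζ (r - s)‖ ^ 2 := by
    rw [mem, ← Ioc_union_Ioi_eq_Ioi hrt, setIntegral_union (by simp) measurableSet_Ioi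
      (hint.mono_set Ioc_subset_Ioi_self) (hint.mono_set (Ioi_subset_Ioi hrt))]
  have e1 : ∫ s in Ioc 0 (r - t), μ s * ‖ζ r - ζ (r - s)‖ ^ 2 ≤ μ 0 * A * (r - t) := by
    have : ∫ s in Ioc 0 (r - t), μ s * ‖ζ r - ζ (r - s)‖ ^ 2 ≤ ∫ s in Ioc 0 (r - t), μ 0 * A := by
      refine setIntegral_mono_on (hint.mono_set Ioc_subset_Ioi_self) (integrableOn_const (by simp)) measurableSet_Ioc
        fun s hs => ?_
      refine mul_le_mul (hμ.antitone (by simp) hs.1.le hs.1.le) (hA _ ⟨?_, ?_⟩) (sq_nonneg _)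
        (hμ.nonneg 0 le_rfl)
      · linarith [hs.2]
      · linarith [hs.1]
    simpa [hrt, mul_comm] using this
  have e2 : ∫ s in Ioi (r - t), μ s * ‖ζ r - ζ (r - s)‖ ^ 2
      ≤ ∫ s in Ioi (0 : ℝ), μ s * ‖ζ r - ζ (t - s)‖ ^ 2 := by
    rw [setIntegral_Ioi_shift]
    have h1 : IntegrableOn (fun s => μ (r - t + s) * ‖ζ r - ζ (r - (r - t + s))‖ ^ 2) (Ioi 0) := by
      rw [← integrableOn_Ioi_shift (fun s => μ s * ‖ζ r - ζ (r - s)‖ ^ 2)]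
      exact hint.mono_set (Ioi_subset_Ioi hrt)
    refine setIntegral_mono_on h1 (hζ.integrable_sub_sq hμ ht (ζ r)) measurableSet_Ioi
      fun s hs => ?_
    rw [show r - (r - t + s) = t - s by ring]
    exact mul_le_mul_of_nonneg_right (hμ.shift_le hrt (le_of_lt hs)) (sq_nonneg _)
  have h2 := hζ.integrable_sub hμ ht (ζ t)
  have h3 : IntegrableOn (fun s => ⟪ζ r - ζ t, μ s • (ζ t - ζ (t - s))⟫) (Ioi 0) :=
    h2.const_inner _
  have h4 := hζ.integrable_sub_sq hμ ht (ζ t)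
  have e3 : ∫ s in Ioi (0 : ℝ), μ s * ‖ζ r - ζ (t - s)‖ ^ 2
      = mem μ ζ t + 2 * ⟪ζ r - ζ t, memVec μ ζ t⟫
      + (∫ s in Ioi (0 : ℝ), μ s) * ‖ζ r - ζ t‖ ^ 2 := by
    rw [memVec, ← integral_inner h2, ← integral_mul_const, mem,
      ← setIntegral_comb 2 h4 h3 (hμ.integrable.mul_const _)]
    refine integral_congr_ae (Eventually.of_forall fun s => ?_)
    simp only
    rw [show ζ r - ζ (t - s) = (ζ t - ζ (t - s)) + (ζ r - ζ t) by abel,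
      norm_add_sq_real (ζ t - ζ (t - s)), real_inner_smul_right,
      real_inner_comm (ζ r - ζ t)]
    ring
  linarith

/-- An upper bound for the right Dini derivative of the memory functional, which is all that the
energy inequality needs; the past need not be regular enough for a classical derivative. -/
theorem IsPath2.mem_slope (hμ : IsKernel μ) (hζ : IsPath2 μ ζ) [CompleteSpace H] {t c : ℝ} {v : H}
    (ht : 0 ≤ t) (hd : HasDerivWithinAt ζ v (Ici t) t) (hc : 2 * ⟪v, memVec μ ζ t⟫ < c) :
    ∀ᶠ r in 𝓝[>] t, slope (mem μ ζ) t r < c := by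
  -- `A` bounds the squared oscillation of `ζ` just after `t`. By continuity it may be as small as
  -- needed for the extra slope `μ 0 * A` to fit below `c`.
  obtain ⟨A, hA, hAc⟩ : ∃ A > 0, 2 * ⟪v, memVec μ ζ t⟫ + μ 0 * A < c := by
    have : Tendsto (fun A => 2 * ⟪v, memVec μ ζ t⟫ + μ 0 * A) (𝓝[>] 0)
        (𝓝 (2 * ⟪v, memVec μ ζ t⟫ + μ 0 * 0)) :=
      ((continuous_const.add (continuous_const.mul continuous_id)).tendsto 0).mono_left
        nhdsWithin_le_nhds
    have h2 := this.eventually (gt_mem_nhds (show 2 * ⟪v, memVec μ ζ t⟫ + μ 0 * 0 < c by simpa))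
    obtain ⟨A, h, hA⟩ := (h2.and self_mem_nhdsWithin).exists
    exact ⟨A, hA, h⟩
  set F : ℝ → ℝ := fun r => 2 * ⟪ζ r - ζ t, memVec μ ζ t⟫
      + (∫ s in Ioi (0 : ℝ), μ s) * ‖ζ r - ζ t‖ ^ 2 + μ 0 * A * (r - t) with hF
  have hd0 := hd.sub_const (ζ t)
  have hdF : HasDerivWithinAt F (2 * ⟪v, memVec μ ζ t⟫ + μ 0 * A) (Ioi t) t := by
    have h1 := ((hd0.inner ℝ (hasDerivWithinAt_const t (Ici t) (memVec μ ζ t))).const_mul 2)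
    have h2 := (hd0.norm_sq.const_mul (∫ s in Ioi (0 : ℝ), μ s))
    have h3 := (((hasDerivWithinAt_id t (Ici t)).sub_const t).const_mul (μ 0 * A))
    have := ((h1.add h2).add h3).mono Ioi_subset_Ici_self
    convert! this using 1
    simp
  have hs := hasDerivWithinAt_iff_tendsto_slope.1 hdF
  have hs' : ∀ᶠ r in 𝓝[Ioi t \ {t}] t, slope F t r < c := hs.eventually (gt_mem_nhds hAc)
  have hset : Ioi t \ {t} = Ioi t := by ext x; simp
  rw [hset] at hs'
  have hcw : ContinuousWithinAt ζ (Ici t) t := hd.continuousWithinAt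
  have hball : ∀ᶠ r in 𝓝[≥] t, ‖ζ r - ζ t‖ < √A / 2 := by
    have := (hcw.sub (continuousWithinAt_const (b := ζ t))).norm
    have h0 : ‖ζ t - ζ t‖ < √A / 2 := by simp; exact hA
    exact this.eventually (gt_mem_nhds h0)
  obtain ⟨u, hu, hball⟩ := (mem_nhdsGE_iff_exists_Ico_subset' (lt_add_one t)).1 hball
  have hu' : Ioo t u ∈ 𝓝[>] t := Ioo_mem_nhdsGT hu
  filter_upwards [hs', hu'] with r hr hru
  refine lt_of_le_of_lt ?_ hr
  have hstep := hζ.mem_step hμ ht hru.1.le (A := A) fun σ hσ => by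
    have a1 : ‖ζ r - ζ t‖ < √A / 2 := hball ⟨hru.1.le, hru.2⟩
    have a2 : ‖ζ σ - ζ t‖ < √A / 2 := hball ⟨hσ.1, hσ.2.trans_lt hru.2⟩
    have a3 : ‖ζ r - ζ σ‖ ≤ √A := by
      have := norm_sub_le (ζ r - ζ t) (ζ σ - ζ t)
      rw [sub_sub_sub_cancel_right] at this
      linarith
    calc ‖ζ r - ζ σ‖ ^ 2 ≤ √A ^ 2 := by gcongr
      _ = A := Real.sq_sqrt hA.le
  rw [slope_def_field, slope_def_field]
  have hrt : 0 < r - t := sub_pos.2 hru.1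
  refine div_le_div_of_nonneg_right ?_ hrt.le
  simp only [hF, sub_self, inner_zero_left, norm_zero]
  norm_num
  linarith

/-- Three ranges of lags are treated differently: up to `S` the oscillation of the path is used,
between `S` and `t` the smallness of the tail of the kernel, and beyond `t` the fading of the data
before time zero. -/
theorem IsPath2.mem_le_split (hμ : IsKernel μ) (hκ : ∫ s in Ioi (0 : ℝ), μ s ≤ 1)
    (hζ : IsPath2 μ ζ) {t S A B : ℝ} (hS : 0 ≤ S) (hSt : S ≤ t)
    (hA : ∀ s ∈ Ioc 0 S, ‖ζ t - ζ (t - s)‖ ^ 2 ≤ A) (hA0 : 0 ≤ A)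
    (hB : ∀ σ ∈ Icc 0 t, ‖ζ σ‖ ^ 2 ≤ B) :
    mem μ ζ t ≤ A + 4 * (∫ s in Ioi S, μ s) * B + 4 * hist μ ζ t := by
  have ht : 0 ≤ t := hS.trans hSt
  have hint := hζ.integrable_sub_sq hμ ht (ζ t)
  have e0 : mem μ ζ t = (∫ s in Ioc 0 S, μ s * ‖ζ t - ζ (t - s)‖ ^ 2)
      + (∫ s in Ioc S t, μ s * ‖ζ t - ζ (t - s)‖ ^ 2)
      + ∫ s in Ioi t, μ s * ‖ζ t - ζ (t - s)‖ ^ 2 := by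
    rw [add_assoc, ← setIntegral_union (Ioc_disjoint_Ioi le_rfl) measurableSet_Ioi
      (hint.mono_set (Ioc_subset_Ioi_self.trans (Ioi_subset_Ioi hS)))
      (hint.mono_set (Ioi_subset_Ioi ht)), Ioc_union_Ioi_eq_Ioi hSt,
      ← setIntegral_union (by simp) measurableSet_Ioi
      (hint.mono_set Ioc_subset_Ioi_self) (hint.mono_set (Ioi_subset_Ioi hS)),
      Ioc_union_Ioi_eq_Ioi hS, mem]
  have i1 := hμ.integrable.mono_set (Ioc_subset_Ioi_self : Ioc 0 S ⊆ Ioi 0)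
  have i2 := hμ.integrable.mono_set (Ioc_subset_Ioi_self.trans (Ioi_subset_Ioi hS) : Ioc S t ⊆ Ioi 0)
  have i3 := hμ.integrable.mono_set (Ioi_subset_Ioi ht)
  have e1 : ∫ s in Ioc 0 S, μ s * ‖ζ t - ζ (t - s)‖ ^ 2 ≤ A := by
    have h1 : ∫ s in Ioc 0 S, μ s * ‖ζ t - ζ (t - s)‖ ^ 2 ≤ ∫ s in Ioc 0 S, μ s * A :=
      setIntegral_mono_on (hint.mono_set Ioc_subset_Ioi_self) (i1.mul_const A) measurableSet_Ioc
        fun s hs => mul_le_mul_of_nonneg_left (hA s hs) (hμ.nonneg s hs.1.le)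
    have h2 : ∫ s in Ioc 0 S, μ s ≤ ∫ s in Ioi (0 : ℝ), μ s :=
      setIntegral_mono_set hμ.integrable hμ.ae_nonneg Ioc_subset_Ioi_self.eventuallyLE
    rw [integral_mul_const] at h1
    nlinarith
  have key : ∀ x y : H, ‖x - y‖ ^ 2 ≤ 2 * ‖x‖ ^ 2 + 2 * ‖y‖ ^ 2 := fun x y => by
    have := norm_sub_le x y
    nlinarith [norm_nonneg (x - y), sq_nonneg (‖x‖ - ‖y‖), norm_nonneg x, norm_nonneg y]
  have hBt : ‖ζ t‖ ^ 2 ≤ B := hB t ⟨ht, le_rfl⟩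
  have e2 : ∫ s in Ioc S t, μ s * ‖ζ t - ζ (t - s)‖ ^ 2 ≤ (∫ s in Ioc S t, μ s) * (4 * B) := by
    rw [← integral_mul_const]
    refine setIntegral_mono_on (hint.mono_set (Ioc_subset_Ioi_self.trans (Ioi_subset_Ioi hS)))
      (i2.mul_const _) measurableSet_Ioc fun s hs => ?_
    have h1 := hB (t - s) ⟨by linarith [hs.2], by linarith [hs.1]⟩
    exact mul_le_mul_of_nonneg_left (by linarith [key (ζ t) (ζ (t - s))])
      (hμ.nonneg s (by linarith [hs.1]))
  have e3 : ∫ s in Ioi t, μ s * ‖ζ t - ζ (t - s)‖ ^ 2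
      ≤ (∫ s in Ioi t, μ s) * (4 * B) + 4 * hist μ ζ t := by
    have i4 := (hζ.integrable_sq hμ ht).mono_set (Ioi_subset_Ioi ht)
    have hh : hist μ ζ t = ∫ s in Ioi t, μ s * ‖ζ (t - s)‖ ^ 2 := by
      rw [setIntegral_Ioi_shift _ t, hist]; simp
    rw [hh, ← integral_mul_const, ← integral_const_mul, ← integral_add (i3.mul_const _)
      (i4.const_mul _)]
    refine setIntegral_mono_on (hint.mono_set (Ioi_subset_Ioi ht))
      ((i3.mul_const _).add (i4.const_mul _)) measurableSet_Ioi fun s hs => ?_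
    have hs : t < s := hs
    have hk := mul_le_mul_of_nonneg_left (key (ζ t) (ζ (t - s))) (hμ.nonneg s (by linarith))
    have h0 := hμ.nonneg s (by linarith)
    nlinarith [mul_nonneg h0 (sub_nonneg.2 hBt), mul_nonneg h0 (sq_nonneg ‖ζ (t - s)‖),
      mul_nonneg h0 (sq_nonneg ‖ζ t‖)]
  have e4 : ∫ s in Ioi S, μ s = (∫ s in Ioc S t, μ s) + ∫ s in Ioi t, μ s := by
    rw [← Ioc_union_Ioi_eq_Ioi hSt, setIntegral_union (Ioc_disjoint_Ioi le_rfl) measurableSet_Ioi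
      i2 i3]
  rw [e4, e0]
  linarith

end Memory

end Love

end

/-! ### Abstract damped equations with memory: energy inequality and exponential decay up to memory
-/

noncomputable section

namespace Love

/-- Cauchy–Schwarz against a constant, obtained from the nonnegativity of the variance of `g` on
`[a,b]`. -/
theorem sq_intervalIntegral_le {g : ℝ → ℝ} (hg : Continuous g) {a b : ℝ} (hab : a ≤ b) :
    (∫ r in a..b, g r) ^ 2 ≤ (b - a) * ∫ r in a..b, g r ^ 2 := by
  rcases hab.eq_or_lt with rfl | hlt
  · simp
  have hpos : 0 < b - a := sub_pos.2 hlt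
  set c := (∫ r in a..b, g r) / (b - a) with hc
  have h0 : 0 ≤ ∫ r in a..b, (g r - c) ^ 2 :=
    intervalIntegral.integral_nonneg hab fun _ _ => sq_nonneg _
  have h1 : ∫ r in a..b, (g r - c) ^ 2
      = (∫ r in a..b, g r ^ 2) - 2 * c * (∫ r in a..b, g r) + c ^ 2 * (b - a) := by
    have e : ∀ r, (g r - c) ^ 2 = (g r ^ 2 - 2 * c * g r) + c ^ 2 := fun r => by ring
    simp_rw [e]
    rw [intervalIntegral.integral_add (Continuous.intervalIntegrable (by fun_prop) _ _)
      (Continuous.intervalIntegrable (by fun_prop) _ _),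
      intervalIntegral.integral_sub (Continuous.intervalIntegrable (by fun_prop) _ _)
      (Continuous.intervalIntegrable (by fun_prop) _ _), intervalIntegral.integral_const_mul]
    simp [mul_comm]
  have h2 : c * (b - a) = ∫ r in a..b, g r := by rw [hc]; field_simp
  rw [h1, ← h2] at h0
  rw [← h2]
  nlinarith

theorem mul_le_half_sq_add (a b : ℝ) : a * b ≤ 1 / 2 * a ^ 2 + 1 / 2 * b ^ 2 := by
  nlinarith [sq_nonneg (a - b)]

theorem mul_le_weighted_sq_add {c : ℝ} (hc : 0 < c) (a b : ℝ) :
    a * b ≤ c / 2 * (c * b ^ 2) + 1 / (2 * c ^ 2) * a ^ 2 := by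
  have h : 0 ≤ 1 / 2 * (c * b - 1 / c * a) ^ 2 := by positivity
  have e : 1 / 2 * (c * b - 1 / c * a) ^ 2
    = c / 2 * (c * b ^ 2) + 1 / (2 * c ^ 2) * a ^ 2 - a * b := by
    field_simp; ring
  linarith

section Damped

set_option linter.unusedSectionVars false

variable {V H : Type*} [NormedAddCommGroup V] [InnerProductSpace ℝ V]
  [NormedAddCommGroup H] [InnerProductSpace ℝ H] [CompleteSpace H]

local notation "⟪" x ", " y "⟫" => inner ℝ x y

/-- A trajectory `z` of a strongly damped second order evolution with fading memory, forcing `f`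
and potential `Γ`, tested with its velocity and with itself. -/
structure Damped (μ : ℝ → ℝ) (l : ℝ) (D : V →L[ℝ] H) (ζ : ℝ → H) (z z1 z2 : ℝ → V) (f : ℝ → H)
    (Γ Γ' ν : ℝ → ℝ) : Prop where
  path : IsPath2 μ ζ
  eq : ∀ t, 0 ≤ t → ζ t = D (z t)
  dz : ∀ t, HasDerivAt z (z1 t) t
  dz1 : ∀ t, HasDerivAt z1 (z2 t) t
  dΓ : ∀ t, HasDerivAt Γ (Γ' t) t
  energy_eq : ∀ t, 0 ≤ t → ⟪z2 t, z1 t⟫ + ⟪D (z1 t) + l • D (z t) + memVec μ ζ t, D (z1 t)⟫ + Γ' t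
    = ⟪f t, D (z1 t)⟫
  virial_eq : ∀ t, 0 ≤ t → ⟪z2 t, z t⟫ + ⟪D (z1 t) + l • D (z t) + memVec μ ζ t, D (z t)⟫ + ν t
    = ⟪f t, D (z t)⟫

/-- The energy without the memory term. -/
def kinPot (l : ℝ) (D : V →L[ℝ] H) (z z1 : ℝ → V) (Γ : ℝ → ℝ) (t : ℝ) : ℝ :=
  1 / 2 * ‖z1 t‖ ^ 2 + (l / 2 * ‖D (z t)‖ ^ 2 + Γ t)

/-- The energy of a damped evolution. -/
def en (μ : ℝ → ℝ) (l : ℝ) (D : V →L[ℝ] H) (ζ : ℝ → H) (z z1 : ℝ → V) (Γ : ℝ → ℝ) (t : ℝ) : ℝ :=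
  kinPot l D z z1 Γ t + 1 / 2 * mem μ ζ t

/-- Coercivity of the potential along a trajectory. -/
structure Coercive (l c : ℝ) (D : V →L[ℝ] H) (z : ℝ → V) (Γ ν : ℝ → ℝ) : Prop where
  lower : ∀ t, 0 ≤ t → c * ‖D (z t)‖ ^ 2 ≤ l / 2 * ‖D (z t)‖ ^ 2 + Γ t
  virial : ∀ t, 0 ≤ t → c * (l / 2 * ‖D (z t)‖ ^ 2 + Γ t) ≤ l * ‖D (z t)‖ ^ 2 + ν t

variable {μ : ℝ → ℝ} {l : ℝ} {D : V →L[ℝ] H} {ζ : ℝ → H} {z z1 z2 : ℝ → V} {f : ℝ → H}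
  {Γ Γ' ν : ℝ → ℝ}

theorem Damped.hasDerivAt_D (h : Damped μ l D ζ z z1 z2 f Γ Γ' ν) (t : ℝ) :
    HasDerivAt (fun t => D (z t)) (D (z1 t)) t :=
  D.hasFDerivAt.comp_hasDerivAt t (h.dz t)

theorem Damped.hasDerivAt_kinPot (h : Damped μ l D ζ z z1 z2 f Γ Γ' ν) (t : ℝ) :
    HasDerivAt (kinPot l D z z1 Γ) (⟪z2 t, z1 t⟫ + (l * ⟪D (z1 t), D (z t)⟫ + Γ' t)) t := by
  have h1 := ((h.dz1 t).norm_sq.const_mul (1 / 2)).add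
    ((((h.hasDerivAt_D t).norm_sq).const_mul (l / 2)).add (h.dΓ t))
  convert! h1 using 1
  rw [real_inner_comm (z2 t), real_inner_comm (D (z1 t))]
  ring

theorem Damped.continuousOn_en (hμ : IsKernel μ) (h : Damped μ l D ζ z z1 z2 f Γ Γ' ν) :
    ContinuousOn (en μ l D ζ z z1 Γ) (Ici 0) := by
  refine ContinuousOn.add ?_ (continuousOn_const.mul (h.path.continuousOn_mem hμ))
  exact fun t _ => (h.hasDerivAt_kinPot t).continuousAt.continuousWithinAt

theorem Damped.continuous_D1 (h : Damped μ l D ζ z z1 z2 f Γ Γ' ν) :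
    Continuous fun t => D (z1 t) :=
  D.continuous.comp (continuous_iff_continuousAt.2 fun t => (h.dz1 t).continuousAt)

/-- Testing with the velocity, the derivative of the memory functional is at most twice the pairing
with the memory force, which cancels the memory term of the equation. What is left is `-‖D z'‖²`
plus the work of `f`, and half of the dissipation absorbs that work. As the memory functional only
has a Dini bound, the comparison principle for right slopes replaces integration of a derivative. -/
theorem Damped.energy_le (hμ : IsKernel μ) (h : Damped μ l D ζ z z1 z2 f Γ Γ' ν) {a b K : ℝ}
    (ha : 0 ≤ a) (hab : a ≤ b) (hf : ∀ t ∈ Icc a b, ‖f t‖ ≤ K) :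
    en μ l D ζ z z1 Γ b + 1 / 2 * ∫ r in a..b, ‖D (z1 r)‖ ^ 2
      ≤ en μ l D ζ z z1 Γ a + 1 / 2 * K ^ 2 * (b - a) := by
  have hc : Continuous fun r => ‖D (z1 r)‖ ^ 2 := h.continuous_D1.norm.pow 2
  set B : ℝ → ℝ := fun x => en μ l D ζ z z1 Γ a + 1 / 2 * K ^ 2 * (x - a)
    - 1 / 2 * ∫ r in a..x, ‖D (z1 r)‖ ^ 2 with hB
  have hB' : ∀ x, HasDerivAt B (1 / 2 * K ^ 2 - 1 / 2 * ‖D (z1 x)‖ ^ 2) x := fun x => by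
    have h1 := (((((hasDerivAt_id x).sub_const a).const_mul (1 / 2 * K ^ 2)).const_add
      (en μ l D ζ z z1 Γ a)).sub
      ((hc.integral_hasStrictDerivAt a x).hasDerivAt.const_mul (1 / 2)))
    convert! h1 using 1
    simp
  have key := image_le_of_liminf_slope_right_le_deriv_boundary (f := en μ l D ζ z z1 Γ)
    (a := a) (b := b) ((h.continuousOn_en hμ).mono fun x hx => ha.trans hx.1) (B := B)
    (B' := fun x => 1 / 2 * K ^ 2 - 1 / 2 * ‖D (z1 x)‖ ^ 2) (by simp [hB])
    (fun x _ => (hB' x).continuousAt.continuousWithinAt) (fun x _ => (hB' x).hasDerivWithinAt)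
    (fun x hx r hr => by
      have hx0 : 0 ≤ x := ha.trans hx.1
      have hen := h.energy_eq x hx0
      simp only [inner_add_left, real_inner_smul_left, real_inner_self_eq_norm_sq] at hen
      have hfx : ⟪f x, D (z1 x)⟫ ≤ 1 / 2 * K ^ 2 + 1 / 2 * ‖D (z1 x)‖ ^ 2 := by
        have h1 := real_inner_le_norm (f x) (D (z1 x))
        have h2 := hf x ⟨hx.1, hx.2.le⟩
        nlinarith [sq_nonneg (K - ‖D (z1 x)‖), norm_nonneg (D (z1 x)), norm_nonneg (f x)]
      set q' := ⟪z2 x, z1 x⟫ + (l * ⟪D (z1 x), D (z x)⟫ + Γ' x) with hq'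
      have hsum : q' + ⟪D (z1 x), memVec μ ζ x⟫ < r := by
        rw [real_inner_comm (memVec μ ζ x)]
        rw [real_inner_comm (D (z x)) (D (z1 x))] at hq'
        linarith
      set ε := r - (q' + ⟪D (z1 x), memVec μ ζ x⟫) with hε
      have hε0 : 0 < ε := sub_pos.2 hsum
      have hq := hasDerivWithinAt_iff_tendsto_slope.1
        ((h.hasDerivAt_kinPot x).hasDerivWithinAt (s := Ioi x))
      have hset : Ioi x \ {x} = Ioi x := by ext y; simp
      rw [hset] at hq
      have hq2 := hq.eventually (gt_mem_nhds (show q' < q' + ε / 2 by linarith))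
      have hζd : HasDerivWithinAt ζ (D (z1 x)) (Ici x) x :=
        (h.hasDerivAt_D x).hasDerivWithinAt.congr (fun y hy => h.eq y (hx0.trans hy)) (h.eq x hx0)
      have hm := h.path.mem_slope hμ hx0 hζd
        (show 2 * ⟪D (z1 x), memVec μ ζ x⟫ < 2 * ⟪D (z1 x), memVec μ ζ x⟫ + ε by linarith)
      refine Eventually.frequently ?_
      filter_upwards [hq2, hm] with y h1 h2
      have : slope (en μ l D ζ z z1 Γ) x y
          = slope (kinPot l D z z1 Γ) x y + 1 / 2 * slope (mem μ ζ) x y := by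
        simp only [slope_def_field, en]; ring
      rw [this]
      linarith) (right_mem_Icc.2 hab)
  simp only [hB] at key
  linarith

theorem Damped.sub_sq_le (h : Damped μ l D ζ z z1 z2 f Γ Γ' ν) {a b : ℝ}
    (ha : 0 ≤ a) (hab : a ≤ b) : ‖ζ b - ζ a‖ ^ 2 ≤ (b - a) * ∫ r in a..b, ‖D (z1 r)‖ ^ 2 := by
  have h1 : ζ b - ζ a = ∫ r in a..b, D (z1 r) := by
    rw [intervalIntegral.integral_eq_sub_of_hasDerivAt (fun x _ => h.hasDerivAt_D x)
      (h.continuous_D1.intervalIntegrable _ _), h.eq a ha, h.eq b (ha.trans hab)]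
  have h2 : ‖ζ b - ζ a‖ ≤ ∫ r in a..b, ‖D (z1 r)‖ := by
    rw [h1]; exact intervalIntegral.norm_integral_le_integral_norm hab
  calc ‖ζ b - ζ a‖ ^ 2 ≤ (∫ r in a..b, ‖D (z1 r)‖) ^ 2 := by gcongr
    _ ≤ _ := sq_intervalIntegral_le h.continuous_D1.norm hab

theorem Coercive.kinPot_nonneg {c : ℝ} (hc : 0 < c) (hco : Coercive l c D z Γ ν) {t : ℝ}
    (ht : 0 ≤ t) : 0 ≤ kinPot l D z z1 Γ t := by
  have := hco.lower t ht
  have h2 : 0 ≤ c * ‖D (z t)‖ ^ 2 := by positivity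
  unfold kinPot
  have h3 : 0 ≤ 1 / 2 * ‖z1 t‖ ^ 2 := by positivity
  linarith

theorem Coercive.norm_sq_le {c : ℝ} (hco : Coercive l c D z Γ ν)
    {t : ℝ} (ht : 0 ≤ t) :
    1 / 2 * ‖z1 t‖ ^ 2 + c * ‖D (z t)‖ ^ 2 + 1 / 2 * mem μ ζ t ≤ en μ l D ζ z z1 Γ t := by
  have := hco.lower t ht
  unfold en kinPot
  linarith

theorem Coercive.en_nonneg {c : ℝ} (hc : 0 < c) (hco : Coercive l c D z Γ ν) (hμ : IsKernel μ)
    {t : ℝ} (ht : 0 ≤ t) : 0 ≤ en μ l D ζ z z1 Γ t := by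
  have h1 := hco.kinPot_nonneg (z1 := z1) hc ht
  have h2 := mem_nonneg (ζ := ζ) hμ t
  unfold en
  linarith

/-- Exponential decay of the memoryless energy, up to the size of the forcing. -/
theorem Damped.kinPot_decay {c P : ℝ} (hc : 0 < c) (hc1 : c ≤ 1) (hP : 1 ≤ P)
    (hPD : ∀ w, ‖w‖ ^ 2 ≤ P * ‖D w‖ ^ 2) :
    ∃ c1 > 0, ∃ C ≥ 0, ∀ ζ z z1 z2 f Γ Γ' ν, Damped μ l D ζ z z1 z2 f Γ Γ' ν →
      Coercive l c D z Γ ν → ∀ a b G, 0 ≤ a → a ≤ b →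
      (∀ t ∈ Icc a b, ‖f t - memVec μ ζ t‖ ^ 2 ≤ G) →
      kinPot l D z z1 Γ b ≤ C * (Real.exp (-c1 * (b - a)) * kinPot l D z z1 Γ a + G) := by
  have hP0 : 0 < P := by linarith
  -- `k` is large enough for `Ψ` below to dominate the energy and for the dissipation in `k Q'` to
  -- absorb the term `‖z'‖² ≤ P ‖D z'‖²` that the virial test produces.
  set k := 2 + 2 * P / c with hk
  set k2 := 1 + (P + 1) / (2 * c) + k with hk2
  have hk0 : 0 < k := by positivity
  have hk20 : 0 < k2 := by positivity
  set γ := c / (2 * P) with hγ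
  have hγ0 : 0 < γ := by positivity
  set k3 := 1 / (2 * c ^ 2) + k / 2 with hk3
  have hk30 : 0 < k3 := by positivity
  refine ⟨γ / k2, by positivity, k2 + k3 * k2 / γ, by positivity, ?_⟩
  intro ζ z z1 z2 f Γ Γ' ν h hco a b G ha hab hG
  set Q := kinPot l D z z1 Γ with hQ
  -- Lyapunov function. The derivative of `⟪z', z⟫` brings in the restoring force through the virial
  -- identity, and the term `1/2 ‖D z‖²` cancels the cross term `⟪D z', D z⟫` due to the strong
  -- damping.
  set Ψ : ℝ → ℝ := fun t => ⟪z1 t, z t⟫ + 1 / 2 * ‖D (z t)‖ ^ 2 + k * Q t with hΨ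
  have hG0 : 0 ≤ G := (sq_nonneg _).trans (hG a ⟨le_rfl, hab⟩)
  have hPc : P ≤ P / c := by rw [le_div_iff₀ hc]; nlinarith
  have hQ0 : ∀ t, 0 ≤ t → 0 ≤ Q t := fun t ht => hco.kinPot_nonneg hc ht
  have hz1Q : ∀ t, 0 ≤ t → 1 / 2 * ‖z1 t‖ ^ 2 ≤ Q t := fun t ht => by
    have h3 := hco.lower t ht
    have : 0 ≤ c * ‖D (z t)‖ ^ 2 := by positivity
    simp only [hQ, kinPot]; linarith
  have hDQ : ∀ t, 0 ≤ t → c * ‖D (z t)‖ ^ 2 ≤ Q t := fun t ht => by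
    have h3 := hco.lower t ht
    have : 0 ≤ 1 / 2 * ‖z1 t‖ ^ 2 := by positivity
    simp only [hQ, kinPot]; linarith
  have hup : ∀ t, 0 ≤ t → Ψ t ≤ k2 * Q t := fun t ht => by
    have h1 := real_inner_le_norm (z1 t) (z t)
    have h2 := hPD (z t)
    have h4 := mul_le_half_sq_add ‖z1 t‖ ‖z t‖
    have h5 : (P + 1) / (2 * c) * (c * ‖D (z t)‖ ^ 2) = (P + 1) / 2 * ‖D (z t)‖ ^ 2 := by
      field_simp
    have h6 := mul_le_mul_of_nonneg_left (hDQ t ht) (show 0 ≤ (P + 1) / (2 * c) by positivity)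
    have h7 := hz1Q t ht
    simp only [hΨ, hk2]
    linarith
  have hlow : ∀ t, 0 ≤ t → Q t ≤ Ψ t := fun t ht => by
    have h1 := neg_le_of_abs_le (abs_real_inner_le_norm (z1 t) (z t))
    have h2 := hPD (z t)
    have h4 := mul_le_half_sq_add ‖z1 t‖ ‖z t‖
    have h5 : P / c * (c * ‖D (z t)‖ ^ 2) = P * ‖D (z t)‖ ^ 2 := by
      field_simp
    have h6 := mul_le_mul_of_nonneg_left (hDQ t ht) (show 0 ≤ P / c by positivity)
    have h7 := hz1Q t ht
    have h9 : k * Q t = 2 * Q t + 2 * (P / c * Q t) := by rw [hk]; ring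
    have h10 : 0 ≤ P / c * Q t := mul_nonneg (by positivity) (hQ0 t ht)
    have h11 := sq_nonneg ‖D (z t)‖
    simp only [hΨ]
    linarith
  set Ψ' : ℝ → ℝ := fun t => (⟪z1 t, z1 t⟫ + ⟪z2 t, z t⟫) + 1 / 2 * (2 * ⟪D (z t), D (z1 t)⟫)
      + k * (⟪z2 t, z1 t⟫ + (l * ⟪D (z1 t), D (z t)⟫ + Γ' t)) with hΨ'
  have hd : ∀ t, HasDerivAt Ψ (Ψ' t) t := fun t =>
    (((h.dz1 t).inner ℝ (h.dz t)).add ((h.hasDerivAt_D t).norm_sq.const_mul (1 / 2))).add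
      ((h.hasDerivAt_kinPot t).const_mul k)
  have hde : ∀ t ∈ Icc a b, Ψ' t ≤ -(γ / k2) * Ψ t + k3 * G := fun t ht => by
    have ht0 := ha.trans ht.1
    have e1 := h.energy_eq t ht0
    have e2 := h.virial_eq t ht0
    have hGt := hG t ht
    -- The memory force is moved to the right-hand side and counted as forcing.
    set g := f t - memVec μ ζ t with hg
    have e1' : ⟪z2 t, z1 t⟫ + (l * ⟪D (z1 t), D (z t)⟫ + Γ' t)
        = -‖D (z1 t)‖ ^ 2 + ⟪g, D (z1 t)⟫ := by
      simp only [inner_add_left, real_inner_smul_left, real_inner_self_eq_norm_sq] at e1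
      rw [hg, inner_sub_left, real_inner_comm (D (z t)) (D (z1 t))]
      linarith
    have e2' : ⟪z2 t, z t⟫ + ⟪D (z t), D (z1 t)⟫ = -(l * ‖D (z t)‖ ^ 2 + ν t) + ⟪g, D (z t)⟫ := by
      simp only [inner_add_left, real_inner_smul_left, real_inner_self_eq_norm_sq] at e2
      rw [hg, inner_sub_left, real_inner_comm (D (z1 t)) (D (z t))]
      linarith
    have i1 : ⟪g, D (z1 t)⟫ ≤ 1 / 2 * G + 1 / 2 * ‖D (z1 t)‖ ^ 2 := by
      have := real_inner_le_norm g (D (z1 t))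
      have := mul_le_half_sq_add ‖g‖ ‖D (z1 t)‖
      linarith
    have i2 : ⟪g, D (z t)⟫ ≤ c / 2 * (c * ‖D (z t)‖ ^ 2) + 1 / (2 * c ^ 2) * G := by
      have h1 := real_inner_le_norm g (D (z t))
      have h2 := mul_le_weighted_sq_add hc ‖g‖ ‖D (z t)‖
      have h3 : 1 / (2 * c ^ 2) * ‖g‖ ^ 2 ≤ 1 / (2 * c ^ 2) * G :=
        mul_le_mul_of_nonneg_left hGt (by positivity)
      linarith
    have h3 := hco.lower t ht0
    have h4 := hco.virial t ht0
    have h5 := hPD (z1 t)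
    have hk' : k / 2 = 1 + P / c := by rw [hk]; ring
    set U := l / 2 * ‖D (z t)‖ ^ 2 + Γ t with hU
    have hU0 : 0 ≤ U := le_trans (by positivity) h3
    have hQU : Q t = 1 / 2 * ‖z1 t‖ ^ 2 + U := rfl
    have h6 : γ * Q t ≤ ‖D (z1 t)‖ ^ 2 + c / 2 * U := by
      rw [hQU]
      have a1 : γ * U ≤ c / 2 * U := by
        refine mul_le_mul_of_nonneg_right ?_ hU0
        rw [hγ, div_le_div_iff₀ (by positivity) (by norm_num)]; nlinarith
      have a2 : γ * (1 / 2 * ‖z1 t‖ ^ 2) ≤ γ * (1 / 2 * (P * ‖D (z1 t)‖ ^ 2)) :=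
        mul_le_mul_of_nonneg_left (by linarith) hγ0.le
      have a3 : γ * (1 / 2 * (P * ‖D (z1 t)‖ ^ 2)) = c / 4 * ‖D (z1 t)‖ ^ 2 := by
        rw [hγ]; field_simp; ring
      have a4 : c / 4 * ‖D (z1 t)‖ ^ 2 ≤ 1 * ‖D (z1 t)‖ ^ 2 :=
        mul_le_mul_of_nonneg_right (by linarith) (sq_nonneg _)
      linarith
    have h7 : γ / k2 * Ψ t ≤ γ * Q t := by
      have := mul_le_mul_of_nonneg_left (hup t ht0) (show 0 ≤ γ / k2 by positivity)
      have e : γ / k2 * (k2 * Q t) = γ * Q t := by field_simp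
      linarith
    have h8 : c / 2 * (c * ‖D (z t)‖ ^ 2) ≤ c / 2 * U := mul_le_mul_of_nonneg_left h3 (by positivity)
    have h9 : k * (-‖D (z1 t)‖ ^ 2 + ⟪g, D (z1 t)⟫) ≤ k / 2 * G - k / 2 * ‖D (z1 t)‖ ^ 2 := by
      have := mul_le_mul_of_nonneg_left i1 hk0.le
      linarith
    have h10 : P * ‖D (z1 t)‖ ^ 2 ≤ P / c * ‖D (z1 t)‖ ^ 2 :=
      mul_le_mul_of_nonneg_right hPc (sq_nonneg _)
    simp only [hΨ']
    rw [e1', real_inner_self_eq_norm_sq]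
    rw [hk'] at h9
    have h11 : k3 * G = 1 / (2 * c ^ 2) * G + (1 + P / c) * G := by rw [hk3, hk']; ring
    rw [h11]
    linarith
  set c1 := γ / k2 with hc1'
  have hc10 : 0 < c1 := by positivity
  -- The inequality `Ψ' ≤ -c1 Ψ + k3 G` integrates by the factor `exp (c1 t)`, after subtraction of
  -- the equilibrium value `k3 / c1 * G`.
  have hanti : AntitoneOn (fun t => Real.exp (c1 * t) * (Ψ t - k3 / c1 * G)) (Icc a b) := by
    have hder : ∀ t, HasDerivAt (fun t => Real.exp (c1 * t) * (Ψ t - k3 / c1 * G))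
        (Real.exp (c1 * t) * (c1 * 1) * (Ψ t - k3 / c1 * G) + Real.exp (c1 * t) * Ψ' t) t :=
      fun t => (((hasDerivAt_id t).const_mul c1).exp).mul ((hd t).sub_const _)
    refine antitoneOn_of_hasDerivWithinAt_nonpos (convex_Icc a b)
      (fun t _ => (hder t).continuousAt.continuousWithinAt)
      (fun t _ => (hder t).hasDerivWithinAt) fun t ht => ?_
    have h1 := hde t (interior_subset ht)
    have h2 : c1 * (k3 / c1 * G) = k3 * G := by field_simp
    have h3 := mul_le_mul_of_nonneg_left h1 (Real.exp_pos (c1 * t)).le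
    have h4 : Real.exp (c1 * t) * (c1 * (k3 / c1 * G)) = Real.exp (c1 * t) * (k3 * G) := by rw [h2]
    linarith
  have hfin := hanti (left_mem_Icc.2 hab) (right_mem_Icc.2 hab) hab
  simp only at hfin
  have hQa : 0 ≤ Q a := hco.kinPot_nonneg hc ha
  have hE : Real.exp (-c1 * (b - a)) * Real.exp (c1 * b) = Real.exp (c1 * a) := by
    rw [← Real.exp_add]; ring_nf
  have hEb := Real.exp_pos (c1 * b)
  have h1 : Ψ b - k3 / c1 * G ≤ Real.exp (-c1 * (b - a)) * (Ψ a - k3 / c1 * G) := by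
    refine le_of_mul_le_mul_left ?_ hEb
    calc _ ≤ _ := hfin
      _ = _ := by rw [← hE]; ring
  have hE0 := Real.exp_pos (-c1 * (b - a))
  have h2 : k3 / c1 * G = k3 * k2 / γ * G := by rw [hc1']; field_simp
  have h3 : 0 ≤ k3 / c1 * G := by positivity
  have h4 := mul_le_mul_of_nonneg_left (hup a ha) hE0.le
  have h5 := hlow b (ha.trans hab)
  have h6 : 0 ≤ k3 * k2 / γ * (Real.exp (-c1 * (b - a)) * Q a) := by positivity
  have h7 : 0 ≤ k2 * G := by positivity
  have h8 : 0 ≤ Real.exp (-c1 * (b - a)) * (k3 / c1 * G) := by positivity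
  linarith

end Damped

end Love

end

/-! ### Quiet windows, decay without a rate, and uniform boundedness -/

noncomputable section

namespace Love

section Damped

variable {V H : Type*} [NormedAddCommGroup V] [InnerProductSpace ℝ V]
  [NormedAddCommGroup H] [InnerProductSpace ℝ H] [CompleteSpace H]
  {μ : ℝ → ℝ} {l : ℝ} {D : V →L[ℝ] H} {ζ : ℝ → H} {z z1 z2 : ℝ → V} {f : ℝ → H}
  {Γ Γ' ν : ℝ → ℝ}

/-- Among `n` consecutive windows there is one with little dissipation. -/
theorem Damped.exists_window (hμ : IsKernel μ) (h : Damped μ l D ζ z z1 z2 f Γ Γ' ν)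
    {c : ℝ} (hc : 0 < c) (hco : Coercive l c D z Γ ν) {a T B K : ℝ} {n : ℕ} (hn : 0 < n)
    (ha : 0 ≤ a) (hT : 0 ≤ T) (hB : en μ l D ζ z z1 Γ a ≤ B)
    (hf : ∀ τ ∈ Icc a (a + n * T), ‖f τ‖ ≤ K) :
    ∃ j < n, ∫ r in (a + j * T)..(a + (j + 1) * T), ‖D (z1 r)‖ ^ 2 ≤ 2 * B / n + T * K ^ 2 := by
  by_contra! hcon
  have hn' : (0 : ℝ) < n := by exact_mod_cast hn
  -- If every window dissipated more than the stated amount, the energy would drop by more than `B /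
  -- n` over each window, hence be negative after `n` of them. Strictness only starts with the first
  -- window.
  have key : ∀ k : ℕ, k ≤ n → en μ l D ζ z z1 Γ (a + k * T) ≤ B - k * (B / n) ∧
      (0 < k → en μ l D ζ z z1 Γ (a + k * T) < B - k * (B / n)) := by
    intro k
    induction k with
    | zero => intro _; simpa using hB
    | succ k ih =>
      intro hk
      have h1 := (ih (by omega)).1
      have h2 := hcon k (by omega)
      have hkn : (k : ℝ) + 1 ≤ n := by exact_mod_cast hk
      have h0 : (0 : ℝ) ≤ k * T := by positivity
      have h3 := h.energy_le hμ (a := a + k * T) (b := a + (k + 1) * T) (K := K) (by linarith)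
        (by linarith) (fun t ht => hf t ⟨by linarith [ht.1], by
          have := mul_le_mul_of_nonneg_right hkn hT
          linarith [ht.2]⟩)
      have h4 : en μ l D ζ z z1 Γ (a + (k + 1) * T) < B - (k + 1) * (B / n) := by
        have e1 : 2 * B / n = 2 * (B / n) := by ring
        have e2 : a + (k + 1) * T - (a + k * T) = T := by ring
        rw [e2] at h3
        rw [e1] at h2
        linarith
      push_cast
      exact ⟨h4.le, fun _ => h4⟩
  have h1 := (key n le_rfl).2 hn
  have h2 : (n : ℝ) * (B / n) = B := by field_simp
  rw [h2, sub_self] at h1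
  have h3 := hco.en_nonneg (z1 := z1) (ζ := ζ) hc hμ (t := a + n * T) (by positivity)
  linarith

/-- A trajectory with energy at most `B` has energy at most `ε B` after a sufficiently long time,
up to the contributions of the distant past and of the recent forcing. -/
theorem Damped.window (hμ : IsKernel μ) (hκ : ∫ s in Ioi (0 : ℝ), μ s ≤ 1) {c P : ℝ}
    (hc : 0 < c) (hc1 : c ≤ 1) (hP : 1 ≤ P) (hPD : ∀ w, ‖w‖ ^ 2 ≤ P * ‖D w‖ ^ 2) {ε : ℝ}
    (hε : 0 < ε) :
    ∃ N > 0, ∃ C ≥ 0, ∀ ζ z z1 z2 f Γ Γ' ν, Damped μ l D ζ z z1 z2 f Γ Γ' ν →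
      Coercive l c D z Γ ν → ∀ t B K, N ≤ t → (∀ τ ∈ Icc 0 t, en μ l D ζ z z1 Γ τ ≤ B) →
      (∀ τ ∈ Icc (t - N) t, ‖f τ‖ ≤ K) →
      en μ l D ζ z z1 Γ t ≤ ε * B + C * (hist μ ζ (t - N) + K ^ 2) := by
  obtain ⟨c1, hc10, C0, hC0, hdecay⟩ := Damped.kinPot_decay (μ := μ) (l := l) hc hc1 hP hPD
  -- The denominator is the total factor with which `ε1 * B` enters the final estimate.
  set ε1 := ε / (C0 + (C0 + 1) * (2 + 8 / c)) with hε1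
  have hden : 0 < C0 + (C0 + 1) * (2 + 8 / c) := by positivity
  have hε10 : 0 < ε1 := by positivity
  -- One length `S` serves both as a memory span, beyond which the kernel has little mass, and as a
  -- time in which the exponential decay takes effect.
  obtain ⟨S, hS1, hSexp, hStail⟩ : ∃ S : ℝ, 0 < S ∧ Real.exp (-c1 * S) ≤ ε1 ∧
      ∫ s in Ioi S, μ s ≤ ε1 := by
    have t1 : Tendsto (fun S : ℝ => Real.exp (-c1 * S)) atTop (𝓝 0) :=
      Real.tendsto_exp_atBot.comp (tendsto_id.const_mul_atTop_of_neg (by linarith))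
    have e1 := t1.eventually (Iic_mem_nhds hε10)
    have e2 := hμ.tendsto_tail.eventually (Iic_mem_nhds hε10)
    obtain ⟨S, h1, h2, h3⟩ := ((eventually_gt_atTop 0).and (e1.and e2)).exists
    exact ⟨S, h1, h2, h3⟩
  -- With `n` windows of length `2 S`, the quiet one dissipates about `2 B / n`, so the squared
  -- displacement within lag `S` is about `2 S B / n ≤ ε1 B`.
  obtain ⟨n, hn⟩ := exists_nat_gt (2 * S / ε1)
  have hn0 : (0 : ℝ) < n := lt_trans (by positivity) hn
  have hn1 : 0 < n := by exact_mod_cast hn0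
  have hSn : 2 * S / n ≤ ε1 := by
    rw [div_le_iff₀ hn0]; rw [div_lt_iff₀ hε10] at hn; linarith
  set N := n * (2 * S) with hN
  set CK := (C0 + 1) * (4 * S ^ 2 + 2) + N / 2 with hCK
  have hN0 : 0 < N := by positivity
  refine ⟨N, hN0, 8 * (C0 + 1) + CK, by positivity, ?_⟩
  intro ζ z z1 z2 f Γ Γ' ν h hco t B K hNt hB hf
  set a := t - N with ha
  have ha0 : 0 ≤ a := by linarith
  have haN : a + n * (2 * S) = t := by rw [ha, hN]; ring
  have hen0 : ∀ τ, 0 ≤ τ → 0 ≤ en μ l D ζ z z1 Γ τ := fun τ hτ => hco.en_nonneg hc hμ hτ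
  have hB0 : 0 ≤ B := (hen0 0 le_rfl).trans (hB 0 ⟨le_rfl, by linarith⟩)
  obtain ⟨j, hj, hjI⟩ := h.exists_window hμ hc hco hn1 ha0 (T := 2 * S) (by positivity)
    (hB a ⟨ha0, by linarith⟩) (K := K) (by rw [haN]; exact hf)
  have hj1 : (j : ℝ) + 1 ≤ n := by exact_mod_cast hj
  set b := a + j * (2 * S) with hb
  have hb2 : a + (j + 1) * (2 * S) = b + 2 * S := by rw [hb]; ring
  have hab : a ≤ b := by rw [hb]; linarith [show (0 : ℝ) ≤ j * (2 * S) by positivity]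
  have hbt : b + 2 * S ≤ t := by
    rw [← hb2, ← haN]
    linarith [mul_le_mul_of_nonneg_right hj1 (show 0 ≤ 2 * S by positivity)]
  rw [hb2] at hjI
  set h0 := hist μ ζ a with hh0
  have hh00 : 0 ≤ h0 := hist_nonneg hμ ha0
  set A := S * (2 * B / n + 2 * S * K ^ 2) with hA
  have hA0 : 0 ≤ A := by positivity
  have hAle : A ≤ ε1 * B + 2 * S ^ 2 * K ^ 2 := by
    have e : A = 2 * S / n * B + 2 * S ^ 2 * K ^ 2 := by rw [hA]; ring
    have := mul_le_mul_of_nonneg_right hSn hB0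
    linarith
  have hcon := (h.continuous_D1.norm.pow 2)
  -- In the second half of the quiet window all lags up to `S` stay inside the window, where the
  -- path moves little.
  have hmem : ∀ τ ∈ Icc (b + S) (b + 2 * S),
      mem μ ζ τ ≤ A + 4 * ε1 * (B / c) + 4 * h0 := fun τ hτ => by
    have hτ0 : 0 ≤ τ := by linarith [hτ.1]
    have hBc : 0 ≤ B / c := by positivity
    have hsplit := h.path.mem_le_split hμ hκ (t := τ) (S := S) (A := A) (B := B / c) hS1.le
      (by linarith [hτ.1]) (fun s hs => by
        have h1 := h.sub_sq_le (a := τ - s) (b := τ) (by linarith [hτ.1, hs.2]) (by linarith [hs.1])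
        have h2 : ∫ r in (τ - s)..τ, ‖D (z1 r)‖ ^ 2 ≤ ∫ r in b..(b + 2 * S), ‖D (z1 r)‖ ^ 2 :=
          intervalIntegral.integral_mono_interval (by linarith [hτ.1, hs.2]) (by linarith [hs.1])
            hτ.2 (Eventually.of_forall fun _ => sq_nonneg _) (hcon.intervalIntegrable _ _)
        have h3 : 0 ≤ ∫ r in b..(b + 2 * S), ‖D (z1 r)‖ ^ 2 :=
          intervalIntegral.integral_nonneg (by linarith) fun _ _ => sq_nonneg _
        calc _ ≤ _ := h1
          _ ≤ S * ∫ r in b..(b + 2 * S), ‖D (z1 r)‖ ^ 2 := by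
            rw [sub_sub_cancel]
            exact (mul_le_mul_of_nonneg_left h2 hs.1.le).trans (mul_le_mul_of_nonneg_right hs.2 h3)
          _ ≤ A := by rw [hA]; gcongr) hA0
      (fun σ hσ => by
        rw [h.eq σ hσ.1, le_div_iff₀ hc]
        have h1 := hB σ ⟨hσ.1, by linarith [hσ.2, hτ.2]⟩
        have h2 := hco.norm_sq_le (z1 := z1) (ζ := ζ) (μ := μ) hσ.1
        have h3 := mem_nonneg (ζ := ζ) hμ σ
        have h4 := sq_nonneg ‖z1 σ‖
        linarith)
    have h1 : hist μ ζ τ ≤ h0 := h.path.hist_anti hμ ha0 (by linarith [hτ.1])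
    have h2 := mul_le_mul_of_nonneg_right hStail hBc
    linarith
  set G := 2 * (A + 4 * ε1 * (B / c) + 4 * h0) + 2 * K ^ 2 with hG
  -- The memory is now a small forcing on the second half, so the remaining energy decays there for
  -- a time `S`.
  have hdec := hdecay ζ z z1 z2 f Γ Γ' ν h hco (b + S) (b + 2 * S) G (by linarith) (by linarith)
    (fun τ hτ => by
      have h1 := h.path.norm_memVec_sq_le hμ hκ (t := τ) (by linarith [hτ.1])
      have h2 := hf τ ⟨by linarith [hτ.1], by linarith [hτ.2]⟩
      have h3 := norm_sub_le (f τ) (memVec μ ζ τ)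
      have h4 := hmem τ hτ
      have h5 : ‖f τ - memVec μ ζ τ‖ ^ 2 ≤ 2 * ‖f τ‖ ^ 2 + 2 * ‖memVec μ ζ τ‖ ^ 2 := by
        calc _ ≤ (‖f τ‖ + ‖memVec μ ζ τ‖) ^ 2 := by gcongr
          _ ≤ _ := by linarith [mul_le_half_sq_add ‖f τ‖ ‖memVec μ ζ τ‖]
      have h6 : ‖f τ‖ ^ 2 ≤ K ^ 2 := by gcongr
      rw [hG]
      linarith)
  rw [show b + 2 * S - (b + S) = S by ring] at hdec
  have hkin : kinPot l D z z1 Γ (b + S) ≤ B := by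
    have h1 := hB (b + S) ⟨by linarith, by linarith⟩
    have h3 := mem_nonneg (ζ := ζ) hμ (b + S)
    unfold en at h1
    linarith
  have hkin0 := hco.kinPot_nonneg (z1 := z1) hc (t := b + S) (by linarith)
  have hQ : kinPot l D z z1 Γ (b + 2 * S) ≤ C0 * (ε1 * B + G) := by
    refine hdec.trans (mul_le_mul_of_nonneg_left ?_ hC0)
    have := mul_le_mul hSexp hkin hkin0 hε10.le
    linarith
  -- The energy inequality carries the smallness from the end of the window to `t`, at a cost
  -- proportional to `N K²`.
  have hfin := h.energy_le hμ (a := b + 2 * S) (b := t) (K := K) (by linarith) hbt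
    (fun τ hτ => hf τ ⟨by linarith [hτ.1], hτ.2⟩)
  have hint0 : 0 ≤ ∫ r in (b + 2 * S)..t, ‖D (z1 r)‖ ^ 2 :=
    intervalIntegral.integral_nonneg hbt fun _ _ => sq_nonneg _
  have hen1 : en μ l D ζ z z1 Γ (b + 2 * S) ≤ C0 * (ε1 * B + G) + G := by
    have := hmem (b + 2 * S) ⟨by linarith, le_rfl⟩
    have hK := sq_nonneg K
    unfold en
    rw [hG] at hQ ⊢
    have : 0 ≤ mem μ ζ (b + 2 * S) := mem_nonneg hμ _
    linarith
  have hlen : 1 / 2 * K ^ 2 * (t - (b + 2 * S)) ≤ N / 2 * K ^ 2 := by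
    have h1 : t - (b + 2 * S) ≤ N := by linarith
    have := mul_le_mul_of_nonneg_left h1 (show 0 ≤ 1 / 2 * K ^ 2 by positivity)
    linarith
  have hGle : G ≤ (2 + 8 / c) * ε1 * B + 8 * h0 + (4 * S ^ 2 + 2) * K ^ 2 := by
    have e : 4 * ε1 * (B / c) = 4 / c * ε1 * B := by ring
    rw [hG, e]
    have e2 : (2 + 8 / c) * ε1 * B = 2 * (ε1 * B) + 2 * (4 / c * ε1 * B) := by ring
    linarith
  have hGC := mul_le_mul_of_nonneg_left hGle (show 0 ≤ C0 + 1 by positivity)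
  have hεB : (C0 + (C0 + 1) * (2 + 8 / c)) * (ε1 * B) = ε * B := by
    rw [hε1]; field_simp
  have hx1 : 0 ≤ CK * h0 := by positivity
  have hx2 : 0 ≤ 8 * (C0 + 1) * K ^ 2 := by positivity
  have hx3 : CK * K ^ 2 = (C0 + 1) * ((4 * S ^ 2 + 2) * K ^ 2) + N / 2 * K ^ 2 := by rw [hCK]; ring
  linarith

/-- Uniform boundedness of the energy under bounded forcing plus a small linear perturbation. -/
theorem Damped.bounded (hμ : IsKernel μ) (hκ : ∫ s in Ioi (0 : ℝ), μ s ≤ 1) {c P : ℝ}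
    (hc : 0 < c) (hc1 : c ≤ 1) (hP : 1 ≤ P) (hPD : ∀ w, ‖w‖ ^ 2 ≤ P * ‖D w‖ ^ 2) :
    ∃ C ≥ 0, ∃ η > 0, ∀ ζ z z1 z2 f Γ Γ' ν, Damped μ l D ζ z z1 z2 f Γ Γ' ν →
      Coercive l c D z Γ ν → ∀ K, 0 ≤ K → (∀ t, 0 ≤ t → ‖f t‖ ≤ K + η * ‖D (z t)‖) →
      ∀ t, 0 ≤ t → en μ l D ζ z z1 Γ t ≤ C * (en μ l D ζ z z1 Γ 0 + hist μ ζ 0 + K ^ 2) := by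
  obtain ⟨N, hN, C, hC, hwin⟩ := Damped.window (l := l) hμ hκ hc hc1 hP hPD
    (show (0 : ℝ) < 1 / 4 by norm_num)
  -- `M` covers both cases below: `N / 2` for times before `N`, from the energy inequality, and `C`
  -- for later times, from the window estimate.
  set M := N / 2 + C with hM
  have hM0 : 0 < M := by positivity
  -- Chosen so that the linear part of the forcing contributes a quarter of the maximal energy, as
  -- does the window estimate; half of the maximum then remains to be absorbed.
  set η := √(c / (8 * M)) with hη
  have hη0 : 0 < η := Real.sqrt_pos.2 (by positivity)
  have hη2 : η ^ 2 = c / (8 * M) := Real.sq_sqrt (by positivity)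
  refine ⟨2 + 4 * M, by positivity, η, hη0, ?_⟩
  intro ζ z z1 z2 f Γ Γ' ν h hco K hK hf T hT
  -- The window estimate is applied at a time where the energy is maximal on `[0, T]`, so that the
  -- bound `B` it requires is the energy at that very time.
  obtain ⟨t, ht, hmax⟩ := isCompact_Icc.exists_isMaxOn (nonempty_Icc.2 hT)
    ((h.continuousOn_en hμ).mono (fun x hx => hx.1))
  set B := en μ l D ζ z z1 Γ t with hB
  have hBle : ∀ τ ∈ Icc 0 T, en μ l D ζ z z1 Γ τ ≤ B := fun τ hτ => hmax hτ
  have hB0 : 0 ≤ B := hco.en_nonneg hc hμ ht.1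
  have hE0 : 0 ≤ en μ l D ζ z z1 Γ 0 := hco.en_nonneg hc hμ le_rfl
  have hh0 : 0 ≤ hist μ ζ 0 := hist_nonneg hμ le_rfl
  set K' := K + η * √(B / c) with hK'
  have hK'2 : K' ^ 2 ≤ 2 * K ^ 2 + 1 / (4 * M) * B := by
    have h1 : √(B / c) ^ 2 = B / c := Real.sq_sqrt (by positivity)
    have h2 := mul_le_half_sq_add K (η * √(B / c))
    have h3 : (η * √(B / c)) ^ 2 = 1 / (8 * M) * B := by
      rw [mul_pow, h1, hη2]; field_simp
    have h4 : 1 / (4 * M) * B = 2 * (1 / (8 * M) * B) := by field_simp; ring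
    rw [hK', h4, ← h3]
    linarith
  have hfK : ∀ τ ∈ Icc 0 t, ‖f τ‖ ≤ K' := fun τ hτ => by
    refine (hf τ hτ.1).trans ?_
    have h1 : ‖D (z τ)‖ ≤ √(B / c) := by
      refine Real.le_sqrt_of_sq_le ?_
      rw [le_div_iff₀ hc]
      have h1 := hBle τ ⟨hτ.1, hτ.2.trans ht.2⟩
      have h2 := hco.norm_sq_le (z1 := z1) (ζ := ζ) (μ := μ) hτ.1
      have h3 := mem_nonneg (ζ := ζ) hμ τ
      have h4 := sq_nonneg ‖z1 τ‖
      linarith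
    have := mul_le_mul_of_nonneg_left h1 hη0.le
    linarith
  have hMB : M * (1 / (4 * M) * B) = 1 / 4 * B := by field_simp
  have hmain : B ≤ en μ l D ζ z z1 Γ 0 + 1 / 4 * B + M * (hist μ ζ 0 + K' ^ 2) := by
    have hMh : 0 ≤ M * hist μ ζ 0 := by positivity
    rcases le_total t N with htN | htN
    · have h1 := h.energy_le hμ le_rfl ht.1 hfK
      have h2 : 0 ≤ ∫ r in (0 : ℝ)..t, ‖D (z1 r)‖ ^ 2 :=
        intervalIntegral.integral_nonneg ht.1 fun _ _ => sq_nonneg _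
      have h3 : 1 / 2 * K' ^ 2 * (t - 0) ≤ M * K' ^ 2 := by
        have : 1 / 2 * (t - 0) ≤ M := by rw [hM]; linarith
        nlinarith [sq_nonneg K']
      linarith
    · have h1 := hwin ζ z z1 z2 f Γ Γ' ν h hco t B K' htN
        (fun τ hτ => hBle τ ⟨hτ.1, hτ.2.trans ht.2⟩)
        (fun τ hτ => hfK τ ⟨by linarith [hτ.1], hτ.2⟩)
      have h2 := h.path.hist_anti hμ le_rfl (show 0 ≤ t - N by linarith)
      have h3 : C * (hist μ ζ (t - N) + K' ^ 2) ≤ M * (hist μ ζ 0 + K' ^ 2) := by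
        have h4 := hist_nonneg (ζ := ζ) hμ (show 0 ≤ t - N by linarith)
        exact mul_le_mul (by rw [hM]; linarith) (by linarith) (by positivity) hM0.le
      linarith
  have h5 := mul_le_mul_of_nonneg_left hK'2 hM0.le
  have hfin : B ≤ (2 + 4 * M) * (en μ l D ζ z z1 Γ 0 + hist μ ζ 0 + K ^ 2) := by
    have x1 : 0 ≤ M * en μ l D ζ z z1 Γ 0 := by positivity
    have x2 : 0 ≤ M * hist μ ζ 0 := by positivity
    have x3 := sq_nonneg K
    linarith
  exact (hBle T ⟨hT, le_rfl⟩).trans hfin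

end Damped

end Love

end

/-! ### The truncated power and its primitive -/

noncomputable section

namespace Love

/-- The power nonlinearity `|s|^{p-2} s`, continued linearly beyond `|s| = R`. -/
def trunc (p R s : ℝ) : ℝ := s * min |s| R ^ (p - 2)

/-- The primitive of `trunc`. -/
def truncPrim (p R s : ℝ) : ℝ := ∫ σ in (0 : ℝ)..s, trunc p R σ

section Trunc

variable {p R : ℝ}

theorem trunc_neg (s : ℝ) : trunc p R (-s) = -trunc p R s := by simp [trunc]

@[simp] theorem trunc_zero : trunc p R 0 = 0 := by simp [trunc]

theorem trunc_of_abs_le {s : ℝ} (h : |s| ≤ R) : trunc p R s = |s| ^ (p - 2) * s := by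
  rw [trunc, min_eq_left h, mul_comm]

theorem trunc_eq_trunc {R' s : ℝ} (h : |s| ≤ R) (h' : |s| ≤ R') : trunc p R s = trunc p R' s := by
  rw [trunc_of_abs_le h, trunc_of_abs_le h']

theorem trunc_two (s : ℝ) : trunc 2 R s = s := by simp [trunc]

theorem mul_trunc_nonneg (hR : 0 ≤ R) (s : ℝ) : 0 ≤ s * trunc p R s := by
  have : 0 ≤ min |s| R ^ (p - 2) := Real.rpow_nonneg (le_min (abs_nonneg _) hR) _
  rw [trunc, ← mul_assoc]
  exact mul_nonneg (mul_self_nonneg s) this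

theorem trunc_nonneg (hR : 0 ≤ R) {s : ℝ} (hs : 0 ≤ s) : 0 ≤ trunc p R s :=
  mul_nonneg hs (Real.rpow_nonneg (le_min (abs_nonneg _) hR) _)

theorem trunc_mono_nonneg (hp : 2 ≤ p) (hR : 0 ≤ R) {x y : ℝ} (hx : 0 ≤ x) (hxy : x ≤ y) :
    trunc p R x ≤ trunc p R y := by
  have hy := hx.trans hxy
  unfold trunc
  rw [abs_of_nonneg hx, abs_of_nonneg hy]
  refine mul_le_mul hxy (Real.rpow_le_rpow (le_min hx hR) (min_le_min_right _ hxy) (by linarith))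
    (Real.rpow_nonneg (le_min hx hR) _) hy

/-- Bernoulli's inequality for the exponent `p - 1 ≥ 1`, applied to the ratio `x / y`. -/
theorem rpow_sub_rpow_le (hp : 2 ≤ p) {x y : ℝ} (hx : 0 ≤ x) (hxy : x ≤ y) :
    y * y ^ (p - 2) - x * x ^ (p - 2) ≤ (p - 1) * y ^ (p - 2) * (y - x) := by
  rcases (hx.trans hxy).eq_or_lt with h0 | hy
  · have hx0 : x = 0 := le_antisymm (h0 ▸ hxy) hx
    simp [hx0, ← h0]
  have key : ∀ w : ℝ, 0 ≤ w → w * w ^ (p - 2) = w ^ (p - 1) := fun w hw => by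
    rw [show p - 1 = 1 + (p - 2) by ring, Real.rpow_add' hw (by linarith), Real.rpow_one]
  have hb := one_add_mul_self_le_rpow_one_add (s := x / y - 1) (p := p - 1)
    (by have : 0 ≤ x / y := by positivity
        linarith) (by linarith)
  rw [add_sub_cancel, Real.div_rpow hx hy.le, ← key y hy.le, ← key x hx] at hb
  have hpos : 0 < y * y ^ (p - 2) := by positivity
  rw [le_div_iff₀ hpos] at hb
  have e : (1 + (p - 1) * (x / y - 1)) * (y * y ^ (p - 2))
      = y * y ^ (p - 2) + (p - 1) * y ^ (p - 2) * (x - y) := by field_simp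
  linarith

theorem trunc_sub_le (hp : 2 ≤ p) (hR : 0 ≤ R) {x y : ℝ} (hx : 0 ≤ x) (hxy : x ≤ y) :
    trunc p R y - trunc p R x ≤ (p - 1) * R ^ (p - 2) * (y - x) := by
  have hy := hx.trans hxy
  have hRp : 0 ≤ R ^ (p - 2) := Real.rpow_nonneg hR _
  have h1 : ∀ {x y : ℝ}, 0 ≤ x → x ≤ y → y ≤ R →
      trunc p R y - trunc p R x ≤ (p - 1) * R ^ (p - 2) * (y - x) := fun {x y} hx hxy hyR => by
    have hy := hx.trans hxy
    rw [trunc, trunc, abs_of_nonneg hx, abs_of_nonneg hy, min_eq_left hyR,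
      min_eq_left (hxy.trans hyR)]
    refine (rpow_sub_rpow_le hp hx hxy).trans ?_
    have := Real.rpow_le_rpow hy hyR (show 0 ≤ p - 2 by linarith)
    exact mul_le_mul_of_nonneg_right (mul_le_mul_of_nonneg_left this (by linarith)) (by linarith)
  have h2 : ∀ {x y : ℝ}, R ≤ x → x ≤ y →
      trunc p R y - trunc p R x ≤ (p - 1) * R ^ (p - 2) * (y - x) := fun {x y} hx hxy => by
    rw [trunc, trunc, abs_of_nonneg (hR.trans hx), abs_of_nonneg (hR.trans (hx.trans hxy)),
      min_eq_right hx, min_eq_right (hx.trans hxy)]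
    have : 0 ≤ (p - 2) * (R ^ (p - 2) * (y - x)) :=
      mul_nonneg (by linarith) (mul_nonneg hRp (by linarith))
    linarith
  rcases le_total y R with hyR | hyR
  · exact h1 hx hxy hyR
  rcases le_total R x with hxR | hxR
  · exact h2 hxR hxy
  · have a1 := h1 hx hxR le_rfl
    have a2 := h2 le_rfl hyR
    linarith

/-- By oddness, arguments of equal sign reduce to nonnegative ones; for opposite signs the bounds on
the two sides of zero add up. -/
theorem abs_trunc_sub_le (hp : 2 ≤ p) (hR : 0 ≤ R) (x y : ℝ) :
    |trunc p R y - trunc p R x| ≤ (p - 1) * R ^ (p - 2) * |y - x| := by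
  wlog hxy : x ≤ y generalizing x y
  · rw [abs_sub_comm, abs_sub_comm y]
    exact this y x (le_of_not_ge hxy)
  rw [abs_of_nonneg (sub_nonneg.2 hxy)]
  rcases le_total 0 x with hx | hx
  · rw [abs_of_nonneg (sub_nonneg.2 (trunc_mono_nonneg hp hR hx hxy))]
    exact trunc_sub_le hp hR hx hxy
  rcases le_total y 0 with hy | hy
  · have h1 := trunc_mono_nonneg hp hR (neg_nonneg.2 hy) (neg_le_neg hxy)
    have h2 := trunc_sub_le hp hR (neg_nonneg.2 hy) (neg_le_neg hxy)
    rw [trunc_neg, trunc_neg] at h1 h2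
    rw [abs_of_nonneg (by linarith)]
    linarith
  · have h1 := trunc_sub_le hp hR le_rfl hy
    have h2 := trunc_sub_le hp hR le_rfl (neg_nonneg.2 hx)
    have h3 := trunc_nonneg (p := p) hR hy
    have h4 := trunc_nonneg (p := p) hR (neg_nonneg.2 hx)
    rw [trunc_neg] at h2 h4
    simp only [trunc_zero, sub_zero] at h1 h2
    rw [abs_of_nonneg (by linarith)]
    linarith

/-- The Lipschitz constant of `trunc`. -/
def truncLip (p R : ℝ) : ℝ≥0 := ((p - 1) * R ^ (p - 2)).toNNReal

theorem coe_truncLip (hp : 2 ≤ p) (hR : 0 ≤ R) : (truncLip p R : ℝ) = (p - 1) * R ^ (p - 2) :=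
  Real.coe_toNNReal _ (mul_nonneg (by linarith) (Real.rpow_nonneg hR _))

theorem lipschitz_trunc (hp : 2 ≤ p) (hR : 0 ≤ R) : LipschitzWith (truncLip p R) (trunc p R) := by
  refine LipschitzWith.of_dist_le_mul fun x y => ?_
  rw [coe_truncLip hp hR, Real.dist_eq, Real.dist_eq]
  exact abs_trunc_sub_le hp hR y x

theorem continuous_trunc (hp : 2 ≤ p) (hR : 0 ≤ R) : Continuous (trunc p R) :=
  (lipschitz_trunc hp hR).continuous

theorem abs_trunc_le (hp : 2 ≤ p) (hR : 0 ≤ R) (s : ℝ) : |trunc p R s| ≤ |s| ^ (p - 1) := by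
  have h0 : 0 ≤ min |s| R := le_min (abs_nonneg _) hR
  rw [trunc, abs_mul, abs_of_nonneg (Real.rpow_nonneg h0 _), show p - 1 = 1 + (p - 2) by ring,
    Real.rpow_add' (abs_nonneg _) (by linarith), Real.rpow_one]
  exact mul_le_mul_of_nonneg_left (Real.rpow_le_rpow h0 (min_le_left _ _) (by linarith))
    (abs_nonneg _)

theorem mul_trunc_le (hp : 2 ≤ p) (hR : 0 ≤ R) (s : ℝ) : s * trunc p R s ≤ |s| ^ p := by
  have h1 := mul_le_mul_of_nonneg_left (abs_trunc_le hp hR s) (abs_nonneg s)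
  rw [← abs_mul, abs_of_nonneg (mul_trunc_nonneg hR s)] at h1
  rw [show p = 1 + (p - 1) by ring, Real.rpow_add' (abs_nonneg _) (by linarith), Real.rpow_one]
  ring_nf at h1 ⊢
  exact h1

theorem hasDerivAt_truncPrim (hp : 2 ≤ p) (hR : 0 ≤ R) (s : ℝ) :
    HasDerivAt (truncPrim p R) (trunc p R s) s :=
  ((continuous_trunc hp hR).integral_hasStrictDerivAt 0 s).hasDerivAt

theorem truncPrim_neg (s : ℝ) : truncPrim p R (-s) = truncPrim p R s := by
  have := intervalIntegral.integral_comp_neg (a := (0 : ℝ)) (b := s) (fun σ => trunc p R σ)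
  simp only [trunc_neg, neg_zero] at this
  rw [intervalIntegral.integral_neg] at this
  rw [truncPrim, intervalIntegral.integral_symm, ← this, neg_neg, truncPrim]

theorem truncPrim_abs (s : ℝ) : truncPrim p R |s| = truncPrim p R s := by
  rcases abs_choice s with h | h <;> rw [h]
  exact truncPrim_neg s

theorem truncPrim_nonneg (hR : 0 ≤ R) (s : ℝ) : 0 ≤ truncPrim p R s := by
  rw [← truncPrim_abs]
  exact intervalIntegral.integral_nonneg (abs_nonneg s) fun u hu => trunc_nonneg hR hu.1

theorem mul_trunc_abs (s : ℝ) : |s| * trunc p R |s| = s * trunc p R s := by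
  rcases abs_choice s with h | h <;> rw [h]
  rw [trunc_neg]; ring

theorem truncPrim_le_mul (hp : 2 ≤ p) (hR : 0 ≤ R) (s : ℝ) : truncPrim p R s ≤ s * trunc p R s := by
  rw [← truncPrim_abs, ← mul_trunc_abs]
  have h := intervalIntegral.integral_mono_on (abs_nonneg s)
    ((continuous_trunc hp hR).intervalIntegrable _ _)
    (intervalIntegrable_const (μ := volume) (c := trunc p R |s|)) fun u hu => trunc_mono_nonneg hp hR hu.1 hu.2
  rwa [intervalIntegral.integral_const, smul_eq_mul, sub_zero] at h

theorem truncPrim_le_rpow (hp : 2 ≤ p) (hR : 0 ≤ R) (s : ℝ) : truncPrim p R s ≤ |s| ^ p / p := by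
  rw [← truncPrim_abs]
  have h : truncPrim p R |s| ≤ ∫ u in (0 : ℝ)..|s|, u ^ (p - 1) := by
    refine intervalIntegral.integral_mono_on (abs_nonneg s)
      ((continuous_trunc hp hR).intervalIntegrable _ _)
      (intervalIntegral.intervalIntegrable_rpow' (by linarith)) fun u hu => ?_
    have := abs_trunc_le hp hR u
    rw [abs_of_nonneg hu.1] at this
    exact (le_abs_self _).trans this
  rw [integral_rpow (Or.inl (by linarith)), Real.zero_rpow (by linarith)] at h
  simpa using h

theorem truncPrim_of_abs_le (hp : 2 ≤ p) {s : ℝ} (hs : |s| ≤ R) :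
    truncPrim p R s = |s| ^ p / p := by
  rw [← truncPrim_abs]
  have h : truncPrim p R |s| = ∫ u in (0 : ℝ)..|s|, u ^ (p - 1) := by
    refine intervalIntegral.integral_congr fun u hu => ?_
    rw [uIcc_of_le (abs_nonneg s)] at hu
    rw [trunc_of_abs_le (by rw [abs_of_nonneg hu.1]; exact hu.2.trans hs), abs_of_nonneg hu.1,
      show p - 1 = (p - 2) + 1 by ring, Real.rpow_add' hu.1 (by linarith), Real.rpow_one]
  rw [h, integral_rpow (Or.inl (by linarith)), Real.zero_rpow (by linarith)]
  simp

/-- A doubling argument with a constant independent of `R`: the primitive is at least the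
contribution of `[x/2, x]`, and halving the argument costs at most the factor `2 ^ p`. -/
theorem mul_trunc_le_truncPrim (hp : 2 ≤ p) (hR : 0 ≤ R) (s : ℝ) :
    s * trunc p R s ≤ 2 ^ p * truncPrim p R s := by
  rw [← truncPrim_abs, ← mul_trunc_abs]
  set x := |s| with hx
  have hx0 : 0 ≤ x := abs_nonneg s
  have hc := continuous_trunc hp hR
  have h1 : x / 2 * trunc p R (x / 2) ≤ truncPrim p R x := by
    rw [truncPrim, ← intervalIntegral.integral_add_adjacent_intervals
      (hc.intervalIntegrable 0 (x / 2)) (hc.intervalIntegrable (x / 2) x)]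
    have a1 : 0 ≤ ∫ u in (0 : ℝ)..(x / 2), trunc p R u :=
      intervalIntegral.integral_nonneg (by linarith) fun u hu => trunc_nonneg hR hu.1
    have a2 := intervalIntegral.integral_mono_on (show x / 2 ≤ x by linarith)
      (intervalIntegrable_const (μ := volume) (c := trunc p R (x / 2))) (hc.intervalIntegrable _ _)
      fun u hu => trunc_mono_nonneg hp hR (by linarith) hu.1
    rw [intervalIntegral.integral_const, smul_eq_mul] at a2
    linarith
  have h2 : x * trunc p R x ≤ 2 ^ p * (x / 2 * trunc p R (x / 2)) := by
    have hm : min x R ≤ 2 * min (x / 2) R := by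
      rcases le_total (x / 2) R with h | h
      · rw [min_eq_left h]; linarith [min_le_left x R]
      · rw [min_eq_right h]; linarith [min_le_right x R]
    have hm0 : 0 ≤ min x R := le_min hx0 hR
    have hm2 : 0 ≤ min (x / 2) R := le_min (by linarith) hR
    have h3 := Real.rpow_le_rpow hm0 hm (show 0 ≤ p - 2 by linarith)
    rw [Real.mul_rpow (by norm_num) hm2] at h3
    have h4 : (2 : ℝ) ^ p = 2 ^ (p - 2) * 4 := by
      rw [show p = (p - 2) + 2 by ring, Real.rpow_add (by norm_num)]; norm_num
    unfold trunc
    rw [abs_of_nonneg hx0, abs_of_nonneg (show 0 ≤ x / 2 by linarith), h4]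
    have h5 := mul_le_mul_of_nonneg_left h3 (mul_nonneg hx0 hx0)
    linarith
  exact h2.trans (mul_le_mul_of_nonneg_left h1 (by positivity))

/-- This is what lets the energy control the `L¹` norm of the nonlinear stress uniformly in `R`,
whereas its `L²` norm would involve the Lipschitz constant. -/
theorem abs_trunc_le_truncPrim (hp : 2 ≤ p) (hR : 0 ≤ R) (s : ℝ) :
    |trunc p R s| ≤ 1 + 2 ^ p * truncPrim p R s := by
  rcases le_total |s| 1 with h | h
  · have h1 := (abs_trunc_le hp hR s).trans (Real.rpow_le_one (abs_nonneg s) h (by linarith))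
    have h2 : 0 ≤ (2 : ℝ) ^ p * truncPrim p R s := mul_nonneg (by positivity) (truncPrim_nonneg hR s)
    linarith
  · have h1 := mul_trunc_le_truncPrim hp hR s
    rw [← abs_of_nonneg (mul_trunc_nonneg hR s), abs_mul] at h1
    have h2 := mul_le_mul_of_nonneg_right h (abs_nonneg (trunc p R s))
    linarith

theorem abs_truncPrim_sub_le (hp : 2 ≤ p) (hR : 0 ≤ R) (a b : ℝ) :
    |truncPrim p R b - truncPrim p R a - trunc p R a * (b - a)|
      ≤ (p - 1) * R ^ (p - 2) * (b - a) ^ 2 := by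
  have hc := continuous_trunc hp hR
  have h1 : truncPrim p R b - truncPrim p R a - trunc p R a * (b - a)
      = ∫ u in a..b, (trunc p R u - trunc p R a) := by
    rw [intervalIntegral.integral_sub (hc.intervalIntegrable _ _) intervalIntegrable_const,
      intervalIntegral.integral_const, smul_eq_mul, truncPrim, truncPrim,
      intervalIntegral.integral_interval_sub_left (hc.intervalIntegrable _ _)
      (hc.intervalIntegrable _ _)]
    ring
  have hC : 0 ≤ (p - 1) * R ^ (p - 2) := mul_nonneg (by linarith) (Real.rpow_nonneg hR _)
  have h2 := intervalIntegral.norm_integral_le_of_norm_le_const (a := a) (b := b)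
    (f := fun u => trunc p R u - trunc p R a) (C := (p - 1) * R ^ (p - 2) * |b - a|)
    fun u hu => (abs_trunc_sub_le hp hR a u).trans
      (mul_le_mul_of_nonneg_left (abs_sub_left_of_mem_uIcc (uIoc_subset_uIcc hu)) hC)
  rw [h1, ← sq_abs (b - a)]
  calc _ ≤ _ := h2
    _ = _ := by ring

end Trunc

end Love

end

/-! ### Primitives and weak derivatives on `(0,L)` -/

noncomputable section

namespace Love

/-- Lebesgue measure on `(0,L)`. -/
abbrev om (L : ℝ) : Measure ℝ := volume.restrict (Ioo (0 : ℝ) L)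

section L2tools

variable {L : ℝ}

theorem L2.inner_eq (a b : L2 L) : inner ℝ a b = ∫ x in Ioo (0 : ℝ) L, a x * b x := by
  rw [MeasureTheory.L2.inner_def]
  refine integral_congr_ae (Eventually.of_forall fun x => ?_)
  simp [mul_comm]

theorem L2.norm_sq_eq (a : L2 L) : ‖a‖ ^ 2 = ∫ x in Ioo (0 : ℝ) L, a x ^ 2 := by
  rw [← real_inner_self_eq_norm_sq, L2.inner_eq]
  simp_rw [sq]

theorem L2.integrable_mul (a b : L2 L) : Integrable (fun x => a x * b x) (om L) :=
  (Lp.memLp a).integrable_mul (Lp.memLp b)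

theorem L2.integrable_sq (a : L2 L) : Integrable (fun x => a x ^ 2) (om L) :=
  (Lp.memLp a).integrable_sq

theorem L2.integrable (a : L2 L) : Integrable a (om L) := (Lp.memLp a).integrable one_le_two

/-- The constant function `1`. -/
def oneL2 (L : ℝ) : L2 L := Lp.const 2 (om L) 1

theorem coeFn_oneL2 : ∀ᵐ x ∂om L, oneL2 L x = 1 := Lp.coeFn_const 2 (om L) 1

theorem norm_oneL2 (hL : 0 ≤ L) : ‖oneL2 L‖ = √L := by
  rw [← Real.sqrt_sq (norm_nonneg _), L2.norm_sq_eq]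
  congr 1
  have : ∫ x in Ioo (0 : ℝ) L, oneL2 L x ^ 2 = ∫ x in Ioo (0 : ℝ) L, (1 : ℝ) := by
    refine integral_congr_ae ?_
    filter_upwards [coeFn_oneL2] with x hx
    simp [hx]
  rw [this]
  simp [hL]

theorem inner_oneL2 (a : L2 L) : inner ℝ (oneL2 L) a = ∫ x in Ioo (0 : ℝ) L, a x := by
  rw [L2.inner_eq]
  refine integral_congr_ae ?_
  filter_upwards [coeFn_oneL2] with x hx
  simp [hx]

theorem L2.integral_abs_le (hL : 0 ≤ L) (a : L2 L) :
    ∫ x in Ioo (0 : ℝ) L, |a x| ≤ √L * ‖a‖ := by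
  have h1 : ∫ x in Ioo (0 : ℝ) L, |a x| = inner ℝ (oneL2 L) |a| := by
    rw [inner_oneL2]
    refine integral_congr_ae ?_
    filter_upwards [Lp.coeFn_abs a] with x hx
    rw [hx]
  rw [h1]
  refine (real_inner_le_norm _ _).trans ?_
  rw [norm_oneL2 hL, norm_abs_eq_norm]

theorem L2.norm_le_of_abs_le (hL : 0 ≤ L) {a : L2 L} {C : ℝ}
    (h : ∀ᵐ x ∂om L, |a x| ≤ C) : ‖a‖ ≤ √L * C := by
  have h1 : ‖a‖ ≤ C * ‖oneL2 L‖ := by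
    refine Lp.norm_le_mul_norm_of_ae_le_mul ?_
    filter_upwards [h, coeFn_oneL2] with x hx h1
    simpa [h1] using hx
  rw [norm_oneL2 hL] at h1
  linarith

theorem L2.eq_of_ae {a b : L2 L} (h : ∀ᵐ x ∂om L, a x = b x) : a = b := Lp.ext h

theorem L2.integrable_indicator (a : L2 L) : Integrable ((Ioo (0 : ℝ) L).indicator a) :=
  (integrable_indicator_iff measurableSet_Ioo).2 (L2.integrable a)

/-- The primitive `∫₀ˣ b`. -/
def primFun (b : L2 L) (x : ℝ) : ℝ := ∫ s in (0 : ℝ)..x, (Ioo (0 : ℝ) L).indicator b s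

theorem continuous_primFun (b : L2 L) : Continuous (primFun b) :=
  intervalIntegral.continuous_primitive (fun _ _ => (L2.integrable_indicator b).intervalIntegrable) 0

theorem abs_primFun_le (hL : 0 ≤ L) (b : L2 L) (x : ℝ) : |primFun b x| ≤ √L * ‖b‖ := by
  have h1 : |primFun b x| ≤ ∫ s in uIoc 0 x, |(Ioo (0 : ℝ) L).indicator b s| :=
    intervalIntegral.norm_integral_le_integral_norm_uIoc (f := (Ioo (0 : ℝ) L).indicator b)
  have h2 : ∫ s in uIoc 0 x, |(Ioo (0 : ℝ) L).indicator b s|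
      ≤ ∫ s, |(Ioo (0 : ℝ) L).indicator b s| :=
    setIntegral_le_integral (L2.integrable_indicator b).abs
      (Eventually.of_forall fun _ => abs_nonneg _)
  have h3 : ∫ s, |(Ioo (0 : ℝ) L).indicator b s| = ∫ x in Ioo (0 : ℝ) L, |b x| := by
    rw [← integral_indicator measurableSet_Ioo]
    congr 1; ext s
    by_cases hs : s ∈ Ioo 0 L <;> simp [hs]
  linarith [L2.integral_abs_le hL b]

theorem memLp_of_continuous_bounded {g : ℝ → ℝ} (hg : Continuous g) {C : ℝ}
    (h : ∀ x, |g x| ≤ C) : MemLp g 2 (om L) :=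
  MemLp.of_bound hg.aestronglyMeasurable C (Eventually.of_forall h)

theorem primFun_add (a b : L2 L) (x : ℝ) : primFun (a + b) x = primFun a x + primFun b x := by
  rw [primFun, primFun, primFun, ← intervalIntegral.integral_add
    (L2.integrable_indicator a).intervalIntegrable (L2.integrable_indicator b).intervalIntegrable]
  refine intervalIntegral.integral_congr_ae ?_
  have := (ae_restrict_iff' measurableSet_Ioo).1 (Lp.coeFn_add a b)
  filter_upwards [this] with s hs _
  by_cases h : s ∈ Ioo 0 L
  · rw [indicator_of_mem h, indicator_of_mem h, indicator_of_mem h, hs h, Pi.add_apply]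
  · simp [h]

theorem primFun_smul (c : ℝ) (a : L2 L) (x : ℝ) : primFun (c • a) x = c * primFun a x := by
  rw [primFun, primFun, ← intervalIntegral.integral_const_mul]
  refine intervalIntegral.integral_congr_ae ?_
  have := (ae_restrict_iff' measurableSet_Ioo).1 (Lp.coeFn_smul c a)
  filter_upwards [this] with s hs _
  by_cases h : s ∈ Ioo 0 L
  · rw [indicator_of_mem h, indicator_of_mem h, hs h, Pi.smul_apply, smul_eq_mul]
  · simp [h]

/-- The primitive as an element of `L²`. -/
def primL2 (hL : 0 ≤ L) (b : L2 L) : L2 L :=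
  (memLp_of_continuous_bounded (continuous_primFun b) (abs_primFun_le hL b)).toLp

theorem coeFn_primL2 (hL : 0 ≤ L) (b : L2 L) : ∀ᵐ x ∂om L, primL2 hL b x = primFun b x :=
  MemLp.coeFn_toLp _

theorem norm_primL2_le (hL : 0 ≤ L) (b : L2 L) : ‖primL2 hL b‖ ≤ L * ‖b‖ := by
  have := L2.norm_le_of_abs_le hL (a := primL2 hL b) (C := √L * ‖b‖) (by
    filter_upwards [coeFn_primL2 hL b] with x hx
    rw [hx]; exact abs_primFun_le hL b x)
  rwa [← mul_assoc, Real.mul_self_sqrt hL] at this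

/-- Integration from `0` as a continuous linear operator on `L²(0,L)`. -/
def primCLM (hL : 0 ≤ L) : L2 L →L[ℝ] L2 L :=
  LinearMap.mkContinuous
    { toFun := primL2 hL
      map_add' := fun a b => L2.eq_of_ae (by
        filter_upwards [coeFn_primL2 hL a, coeFn_primL2 hL b, coeFn_primL2 hL (a + b),
          Lp.coeFn_add (primL2 hL a) (primL2 hL b)] with x h1 h2 h3 h4
        rw [h4, Pi.add_apply, h1, h2, h3, primFun_add])
      map_smul' := fun c a => L2.eq_of_ae (by
        filter_upwards [coeFn_primL2 hL a, coeFn_primL2 hL (c • a),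
          Lp.coeFn_smul c (primL2 hL a)] with x h1 h2 h3
        rw [RingHom.id_apply, h3, Pi.smul_apply, h1, h2, primFun_smul, smul_eq_mul]) } L
    (norm_primL2_le hL)

theorem primCLM_apply (hL : 0 ≤ L) (b : L2 L) : primCLM hL b = primL2 hL b := rfl

theorem exists_testPair {φ : ℝ → ℝ} (h1 : ContDiff ℝ (⊤ : ℕ∞) φ) (h2 : HasCompactSupport φ)
    (h3 : tsupport φ ⊆ Ioo 0 L) : ∃ r ∈ testPairs L,
    (∀ᵐ x ∂om L, r.1 x = φ x) ∧ (∀ᵐ x ∂om L, r.2 x = deriv φ x) := by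
  have hd : Continuous (deriv φ) := h1.continuous_deriv (by simp)
  have m1 : MemLp φ 2 (om L) :=
    (h1.continuous.memLp_of_hasCompactSupport h2).mono_measure Measure.restrict_le_self
  have m2 : MemLp (deriv φ) 2 (om L) :=
    (hd.memLp_of_hasCompactSupport h2.deriv).mono_measure Measure.restrict_le_self
  exact ⟨(m1.toLp, m2.toLp), ⟨φ, h1, h2, h3, m1.coeFn_toLp, m2.coeFn_toLp⟩,
    m1.coeFn_toLp, m2.coeFn_toLp⟩

theorem setIntegral_Ioo_eq (hL : 0 ≤ L) (f : ℝ → ℝ) :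
    ∫ x in Ioo (0 : ℝ) L, f x = ∫ x in (0 : ℝ)..L, f x := by
  rw [intervalIntegral.integral_of_le hL, integral_Ioc_eq_integral_Ioo]

/-- `q'` is the weak derivative of `q` on `(0,L)`. -/
def IsWD (q q' : L2 L) : Prop := ∀ r ∈ testPairs L, inner ℝ q r.2 = - inner ℝ q' r.1

/-- A primitive of an `L²` function is absolutely continuous, so it can be integrated by parts
against a test function; the boundary terms vanish because the test function does. -/
theorem isWD_prim (hL : 0 ≤ L) (b : L2 L) : IsWD (primCLM hL b) b := by
  rintro r ⟨φ, h1, h2, h3, h4, h5⟩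
  have hint := L2.integrable_indicator b
  have hac : AbsolutelyContinuousOnInterval (primFun b) 0 L :=
    hint.intervalIntegrable.absolutelyContinuousOnInterval_intervalIntegral
      (f := (Ioo (0 : ℝ) L).indicator b) (by simp)
  have hφ : AbsolutelyContinuousOnInterval φ 0 L :=
    ((h1.of_le (by simp)).contDiffOn).absolutelyContinuousOnInterval
  have key := hac.integral_mul_deriv_eq_deriv_mul hφ
  have z0 : φ 0 = 0 := image_eq_zero_of_notMem_tsupport fun h => by simpa using h3 h
  have zL : φ L = 0 := image_eq_zero_of_notMem_tsupport fun h => by simpa using h3 h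
  rw [z0, zL] at key
  have e1 : inner ℝ (primCLM hL b) r.2 = ∫ x in (0 : ℝ)..L, primFun b x * deriv φ x := by
    rw [L2.inner_eq, ← setIntegral_Ioo_eq hL]
    refine integral_congr_ae ?_
    filter_upwards [coeFn_primL2 hL b, h5] with x hx hx2
    rw [primCLM_apply, hx, hx2]
  have e2 : inner ℝ b r.1 = ∫ x in (0 : ℝ)..L, deriv (primFun b) x * φ x := by
    rw [L2.inner_eq, ← setIntegral_Ioo_eq hL]
    refine integral_congr_ae ?_
    have hd := (hint.intervalIntegrable (a := 0) (b := L)).ae_hasDerivAt_integral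
    have hd' : ∀ᵐ x ∂om L, deriv (primFun b) x = b x := by
      rw [ae_restrict_iff' measurableSet_Ioo]
      filter_upwards [hd] with x hx hxm
      have := (hx (by rw [uIcc_of_le hL]; exact Ioo_subset_Icc_self hxm) 0 (by simp)).deriv
      rw [indicator_of_mem hxm] at this
      exact this
    filter_upwards [hd', h4] with x hx hx2
    rw [hx, hx2]
  rw [e1, e2, key]
  ring

theorem IsWD.sub {q q' w w' : L2 L} (h : IsWD q q') (h' : IsWD w w') : IsWD (q - w) (q' - w') :=
  fun r hr => by rw [inner_sub_left, inner_sub_left, h r hr, h' r hr]; ring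

theorem exists_test_integral_one (hL : 0 < L) : ∃ χ : ℝ → ℝ, ContDiff ℝ (⊤ : ℕ∞) χ ∧
    HasCompactSupport χ ∧ tsupport χ ⊆ Ioo 0 L ∧ ∫ x, χ x = 1 := by
  let f : ContDiffBump (L / 2 : ℝ) := ⟨L / 8, L / 4, by positivity, by linarith⟩
  refine ⟨f.normed volume, f.contDiff_normed, f.hasCompactSupport_normed, ?_,
    f.integral_normed⟩
  rw [f.tsupport_normed_eq]
  intro x hx
  rw [Metric.mem_closedBall, Real.dist_eq, abs_le] at hx
  have h1 : -(L / 4) ≤ x - L / 2 := hx.1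
  have h2 : x - L / 2 ≤ L / 4 := hx.2
  constructor <;> linarith

/-- The primitive of a smooth test function with zero mean is a test function. -/
theorem exists_test_primitive {ψ : ℝ → ℝ} (h1 : ContDiff ℝ (⊤ : ℕ∞) ψ)
    (h3 : tsupport ψ ⊆ Ioo 0 L) (h2 : HasCompactSupport ψ) (h0 : ∫ x, ψ x = 0) :
    ∃ φ : ℝ → ℝ, ContDiff ℝ (⊤ : ℕ∞) φ ∧ HasCompactSupport φ ∧ tsupport φ ⊆ Ioo 0 L ∧
      deriv φ = ψ := by
  set φ : ℝ → ℝ := fun x => ∫ s in (0 : ℝ)..x, ψ s with hφ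
  have hd : ∀ x, HasDerivAt φ (ψ x) x := fun x =>
    (h1.continuous.integral_hasStrictDerivAt 0 x).hasDerivAt
  have hderiv : deriv φ = ψ := funext fun x => (hd x).deriv
  have hint : Integrable ψ := h1.continuous.integrable_of_hasCompactSupport h2
  -- the support of `ψ` lies in a compact interval `[a, b] ⊆ (0, L)`
  rcases (tsupport ψ).eq_empty_or_nonempty with hemp | hne
  · have hψ : ψ = 0 := by
      rw [tsupport_eq_empty_iff] at hemp; exact hemp
    refine ⟨0, contDiff_const, HasCompactSupport.zero, by simp [tsupport], ?_⟩
    rw [hψ]; ext x; simp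
  obtain ⟨a, haK, ha⟩ := h2.isCompact.exists_isLeast hne
  obtain ⟨b, hbK, hb⟩ := h2.isCompact.exists_isGreatest hne
  have ha0 := h3 haK
  have hb0 := h3 hbK
  have hout : ∀ s, s ∉ Icc a b → ψ s = 0 := fun s hs =>
    image_eq_zero_of_notMem_tsupport fun h => hs ⟨ha h, hb h⟩
  have hφout : ∀ x, x ∉ Icc a b → φ x = 0 := fun x hx => by
    -- To the left of the support nothing has been integrated yet; to the right all of it has, and
    -- the mean is zero.
    rcases lt_or_ge x a with hxa | hxa
    · simp only [hφ]
      rw [intervalIntegral.integral_congr (g := fun _ => 0), intervalIntegral.integral_zero]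
      intro s hs
      refine hout s fun h => ?_
      have := hs.2
      have h' : s ≤ max 0 x := this
      rcases le_max_iff.1 h' with h4 | h4
      · linarith [h.1, ha0.1]
      · linarith [h.1]
    · have hxb : b < x := not_le.1 fun h => hx ⟨hxa, h⟩
      have e1 : ∫ s, ψ s = ∫ s in Ioc 0 x, ψ s := by
        rw [← integral_indicator measurableSet_Ioc]
        congr 1; ext s
        by_cases hs : s ∈ Ioc 0 x
        · simp [hs]
        · rw [indicator_of_notMem hs]
          exact hout s fun h => hs ⟨by linarith [h.1, ha0.1], by linarith [h.2]⟩
      simp only [hφ]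
      rw [intervalIntegral.integral_of_le (by linarith [hb0.1]), ← e1, h0]
  have hts : tsupport φ ⊆ Icc a b := by
    refine closure_minimal (fun x hx => ?_) isClosed_Icc
    by_contra h
    exact hx (hφout x h)
  refine ⟨φ, ?_, HasCompactSupport.of_support_subset_isCompact isCompact_Icc
    (subset_closure.trans hts), hts.trans fun x hx => ⟨by linarith [hx.1, ha0.1],
    by linarith [hx.2, hb0.2]⟩, hderiv⟩
  have : ContDiff ℝ ((⊤ : ℕ∞) : WithTop ℕ∞) φ := by
    rw [contDiff_infty_iff_deriv]
    exact ⟨fun x => (hd x).differentiableAt, by rw [hderiv]; exact h1⟩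
  exact this

theorem inner_test {w r : L2 L} {φ : ℝ → ℝ} (h : ∀ᵐ x ∂om L, r x = φ x) :
    inner ℝ w r = ∫ x in Ioo (0 : ℝ) L, w x * φ x := by
  rw [L2.inner_eq]
  refine integral_congr_ae ?_
  filter_upwards [h] with x hx
  rw [hx]

/-- A function with vanishing weak derivative is constant. -/
theorem IsWD.const (hL : 0 < L) {w : L2 L} (h : IsWD w 0) : ∃ c : ℝ, w = c • oneL2 L := by
  obtain ⟨χ, c1, c2, c3, c4⟩ := exists_test_integral_one hL
  set c := ∫ x in Ioo (0 : ℝ) L, w x * χ x with hc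
  refine ⟨c, ?_⟩
  set u := w - c • oneL2 L with hu
  have huae : ∀ᵐ x ∂om L, u x = w x - c := by
    filter_upwards [Lp.coeFn_sub w (c • oneL2 L), Lp.coeFn_smul c (oneL2 L), coeFn_oneL2]
      with x h1 h2 h3
    rw [hu, h1, Pi.sub_apply, h2, Pi.smul_apply, h3]; simp
  have hin : ∀ {ψ : ℝ → ℝ}, tsupport ψ ⊆ Ioo 0 L → ∫ x in Ioo (0 : ℝ) L, ψ x = ∫ x, ψ x := by
    intro ψ hψ
    refine setIntegral_eq_integral_of_forall_compl_eq_zero fun x hx => ?_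
    exact image_eq_zero_of_notMem_tsupport fun h' => hx (hψ h')
  have hzero := isOpen_Ioo.ae_eq_zero_of_integral_contDiff_smul_eq_zero (μ := volume)
    (U := Ioo (0 : ℝ) L) (f := u) (IntegrableOn.locallyIntegrableOn (L2.integrable u)) ?_
  · have h0 : u = 0 := L2.eq_of_ae (by
      filter_upwards [(ae_restrict_iff' measurableSet_Ioo).2 hzero, Lp.coeFn_zero ℝ 2 (om L)]
        with x h1 h2
      rw [h1, h2]; rfl)
    exact sub_eq_zero.1 h0
  · intro ψ g1 g2 g3
    set m := ∫ x, ψ x with hm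
    -- The argument of du Bois-Reymond: subtracting `m χ` gives mean zero, so the difference is the
    -- derivative of a test function, against which `w` integrates to zero.
    obtain ⟨φ, p1, p2, p3, p4⟩ := exists_test_primitive (L := L) (ψ := fun x => ψ x - m * χ x)
      (g1.sub (contDiff_const.mul c1))
      ((tsupport_sub ψ (fun x => m * χ x)).trans (union_subset g3
        ((tsupport_mul_subset_right (f := fun _ => m) (g := χ)).trans c3)))
      (g2.sub (c2.mul_left)) (by
        rw [integral_sub (g1.continuous.integrable_of_hasCompactSupport g2)
          ((c1.continuous.integrable_of_hasCompactSupport c2).const_mul m),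
          integral_const_mul, c4]; simp [hm])
    obtain ⟨r, hr, r1, r2⟩ := exists_testPair p1 p2 p3
    have hw := h r hr
    rw [inner_zero_left, neg_zero, inner_test r2, p4] at hw
    have iw : ∀ {g : ℝ → ℝ}, ContDiff ℝ (⊤ : ℕ∞) g → HasCompactSupport g →
        Integrable (fun x => w x * g x) (om L) := fun {g} k1 k2 =>
      MemLp.integrable_mul (p := 2) (q := 2) (Lp.memLp w)
        ((k1.continuous.memLp_of_hasCompactSupport k2).mono_measure Measure.restrict_le_self)
    have e1 : ∫ x in Ioo (0 : ℝ) L, w x * (ψ x - m * χ x)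
        = (∫ x in Ioo (0 : ℝ) L, w x * ψ x) - m * c := by
      rw [hc, ← integral_const_mul, ← integral_sub (iw g1 g2) ((iw c1 c2).const_mul m)]
      refine integral_congr_ae (Eventually.of_forall fun x => ?_)
      simp only; ring
    have e2 : ∫ x, ψ x • u x = ∫ x in Ioo (0 : ℝ) L, ψ x * u x := by
      refine (setIntegral_eq_integral_of_forall_compl_eq_zero fun x hx => ?_).symm
      rw [image_eq_zero_of_notMem_tsupport fun h' => hx (g3 h'), zero_smul]
    have e3 : ∫ x in Ioo (0 : ℝ) L, ψ x * u x
        = (∫ x in Ioo (0 : ℝ) L, w x * ψ x) - c * ∫ x in Ioo (0 : ℝ) L, ψ x := by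
      rw [← integral_const_mul, ← integral_sub (iw g1 g2)
        (((g1.continuous.integrable_of_hasCompactSupport g2).integrableOn).const_mul c)]
      refine integral_congr_ae ?_
      filter_upwards [huae] with x hx
      rw [hx]; ring
    rw [e2, e3, hin g3, ← hm]
    rw [e1] at hw
    linarith

theorem IsWD.eq_prim (hL : 0 < L) {q q' : L2 L} (h : IsWD q q') :
    ∃ c : ℝ, q = c • oneL2 L + primCLM hL.le q' := by
  have h0 : IsWD (q - primCLM hL.le q') 0 := by
    have := h.sub (isWD_prim hL.le q')
    rwa [sub_self] at this
  obtain ⟨c, hc⟩ := h0.const hL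
  exact ⟨c, sub_eq_iff_eq_add.1 hc⟩

theorem IsWD.ae_eq (hL : 0 < L) {q q' : L2 L} (h : IsWD q q') :
    ∃ c : ℝ, ∀ᵐ x ∂om L, q x = c + primFun q' x := by
  obtain ⟨c, hc⟩ := h.eq_prim hL
  refine ⟨c, ?_⟩
  filter_upwards [Lp.coeFn_add (c • oneL2 L) (primCLM hL.le q'), Lp.coeFn_smul c (oneL2 L),
    coeFn_oneL2, coeFn_primL2 hL.le q'] with x h1 h2 h3 h4
  rw [hc, h1, Pi.add_apply, h2, Pi.smul_apply, h3, primCLM_apply, h4]; simp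

/-- Sup bound of an `H¹` function by its mean and its derivative. -/
theorem IsWD.abs_le (hL : 0 < L) {q q' : L2 L} (h : IsWD q q') :
    ∀ᵐ x ∂om L, |q x| ≤ 1 / L * |∫ y in Ioo (0 : ℝ) L, q y| + 2 * √L * ‖q'‖ := by
  obtain ⟨c, hc⟩ := h.ae_eq hL
  have i1 : Integrable (primFun q') (om L) :=
    (memLp_of_continuous_bounded (continuous_primFun q') (abs_primFun_le hL.le q')).integrable
      one_le_two
  have e : ∫ y in Ioo (0 : ℝ) L, q y = c * L + ∫ y in Ioo (0 : ℝ) L, primFun q' y := by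
    rw [integral_congr_ae hc, integral_add (integrable_const c) i1]
    simp [hL.le, mul_comm]
  have b1 : |∫ y in Ioo (0 : ℝ) L, primFun q' y| ≤ √L * ‖q'‖ * L := by
    have := norm_setIntegral_le_of_norm_le_const (μ := volume) (s := Ioo (0 : ℝ) L)
      (f := primFun q') (C := √L * ‖q'‖) (by simp) (fun x _ => abs_primFun_le hL.le q' x)
    simpa [hL.le] using this
  filter_upwards [hc] with x hx
  have b2 := abs_primFun_le hL.le q' x
  have b3 : c = 1 / L * (∫ y in Ioo (0 : ℝ) L, q y)
      - 1 / L * ∫ y in Ioo (0 : ℝ) L, primFun q' y := by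
    rw [e]; field_simp; ring
  have b4 : |1 / L * ∫ y in Ioo (0 : ℝ) L, primFun q' y| ≤ √L * ‖q'‖ := by
    rw [abs_mul, abs_of_pos (by positivity : 0 < 1 / L)]
    calc _ ≤ 1 / L * (√L * ‖q'‖ * L) := mul_le_mul_of_nonneg_left b1 (by positivity)
      _ = _ := by field_simp
  have b5 : |1 / L * ∫ y in Ioo (0 : ℝ) L, q y| = 1 / L * |∫ y in Ioo (0 : ℝ) L, q y| := by
    rw [abs_mul, abs_of_pos (by positivity : 0 < 1 / L)]
  rw [hx, b3]
  have t1 := abs_add_le (1 / L * (∫ y in Ioo (0 : ℝ) L, q y)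
      - 1 / L * ∫ y in Ioo (0 : ℝ) L, primFun q' y) (primFun q' x)
  have t2 := abs_sub (1 / L * (∫ y in Ioo (0 : ℝ) L, q y))
      (1 / L * ∫ y in Ioo (0 : ℝ) L, primFun q' y)
  linarith

end L2tools

end Love

end

/-! ### The Hilbert space `H¹₀`, Riesz representatives, flux bounds, and superposition operators -/

noncomputable section

namespace Love

section SpaceV

/-- `H¹₀(0,L)` as a Hilbert space, a closed subspace of the Hilbert sum `L² ⊕ L²`. -/
def VSub (L : ℝ) : Submodule ℝ (WithLp 2 (L2 L × L2 L)) :=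
  (H10 L).comap (WithLp.linearEquiv 2 ℝ (L2 L × L2 L)).toLinearMap

/-- `H¹₀(0,L)` with the inner product `⟪u, w⟫ + ⟪u_x, w_x⟫`. -/
abbrev V (L : ℝ) : Type := VSub L

variable {L : ℝ}

instance : CompleteSpace (V L) := by
  have h1 : IsClosed (H10 L : Set (L2 L × L2 L)) :=
    Submodule.isClosed_topologicalClosure (Submodule.span ℝ (testPairs L))
  have h2 : IsClosed ((VSub L : Submodule ℝ _) : Set (WithLp 2 (L2 L × L2 L))) :=
    h1.preimage (WithLp.prodContinuousLinearEquiv 2 ℝ (L2 L) (L2 L)).continuous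
  exact h2.completeSpace_coe

/-- The function underlying an element of `H¹₀`. -/
def fnV : V L →L[ℝ] L2 L := (WithLp.fstL 2 ℝ (L2 L) (L2 L)).comp (VSub L).subtypeL

/-- The derivative `u_x` of an element of `H¹₀`. -/
def dxV : V L →L[ℝ] L2 L := (WithLp.sndL 2 ℝ (L2 L) (L2 L)).comp (VSub L).subtypeL

theorem V.pair_mem (u : V L) : (fnV u, dxV u) ∈ H10 L := u.2

/-- The element of `V` given by a pair in `H¹₀`. -/
def V.mk (q : L2 L × L2 L) (hq : q ∈ H10 L) : V L := ⟨WithLp.toLp 2 q, hq⟩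

theorem fnV_mk (q : L2 L × L2 L) (hq : q ∈ H10 L) : fnV (V.mk q hq) = q.1 := rfl

theorem dxV_mk (q : L2 L × L2 L) (hq : q ∈ H10 L) : dxV (V.mk q hq) = q.2 := rfl

theorem V.inner_eq (u w : V L) :
    inner ℝ u w = inner ℝ (fnV u) (fnV w) + inner ℝ (dxV u) (dxV w) :=
  WithLp.prod_inner_apply _ _

theorem V.norm_sq_eq (u : V L) : ‖u‖ ^ 2 = ‖fnV u‖ ^ 2 + ‖dxV u‖ ^ 2 := by
  simp only [← real_inner_self_eq_norm_sq, V.inner_eq]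

theorem norm_fnV_le (u : V L) : ‖fnV u‖ ≤ ‖u‖ :=
  (sq_le_sq₀ (norm_nonneg _) (norm_nonneg _)).1
    (by rw [V.norm_sq_eq]; nlinarith [sq_nonneg ‖dxV u‖])

theorem norm_dxV_le (u : V L) : ‖dxV u‖ ≤ ‖u‖ :=
  (sq_le_sq₀ (norm_nonneg _) (norm_nonneg _)).1
    (by rw [V.norm_sq_eq]; nlinarith [sq_nonneg ‖fnV u‖])

/-- A continuous linear identity that holds for test pairs holds on `H¹₀`. -/
theorem H10_induction {F : Type*} [AddCommGroup F] [Module ℝ F] [TopologicalSpace F] [T1Space F]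
    (T : L2 L × L2 L →L[ℝ] F) (h : ∀ r ∈ testPairs L, T r = 0) : ∀ q ∈ H10 L, T q = 0 := by
  have h1 : Submodule.span ℝ (testPairs L) ≤ LinearMap.ker T.toLinearMap :=
    Submodule.span_le.2 fun r hr => h r hr
  have h2 : IsClosed ((LinearMap.ker T.toLinearMap : Submodule ℝ _) : Set (L2 L × L2 L)) :=
    isClosed_singleton.preimage (f := T) T.continuous
  exact fun q hq => Submodule.topologicalClosure_minimal _ h1 h2 hq

theorem testPair_mem_H10 {r : L2 L × L2 L} (hr : r ∈ testPairs L) : r ∈ H10 L :=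
  Submodule.le_topologicalClosure _ (Submodule.subset_span hr)

theorem primFun_eq_intervalIntegral {b : L2 L} {g : ℝ → ℝ} (hb : ∀ᵐ x ∂om L, b x = g x)
    {x : ℝ} (hx : x ∈ Ioc 0 L) : primFun b x = ∫ s in (0 : ℝ)..x, g s := by
  have h1 : ∀ᵐ s ∂(volume : Measure ℝ), s ≠ L := by
    simp [ae_iff, measure_singleton]
  refine intervalIntegral.integral_congr_ae ?_
  filter_upwards [(ae_restrict_iff' measurableSet_Ioo).1 hb, h1] with s hs hsL hs'
  rw [uIoc_of_le hx.1.le] at hs'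
  have hm : s ∈ Ioo 0 L := ⟨hs'.1, lt_of_le_of_ne (hs'.2.trans hx.2) hsL⟩
  rw [indicator_of_mem hm, hs hm]

theorem test_primitive {φ : ℝ → ℝ} (h1 : ContDiff ℝ (⊤ : ℕ∞) φ) (h3 : tsupport φ ⊆ Ioo 0 L)
    (x : ℝ) : ∫ s in (0 : ℝ)..x, deriv φ s = φ x := by
  have hd : Continuous (deriv φ) := h1.continuous_deriv (by simp)
  rw [intervalIntegral.integral_deriv_eq_sub
    (fun y _ => (h1.differentiable (by simp)) y) (hd.intervalIntegrable _ _),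
    image_eq_zero_of_notMem_tsupport (f := φ) (x := (0 : ℝ)) fun h => by simpa using h3 h, sub_zero]

/-- A continuous linear identity between `u` and `u_x`; it holds for test functions and passes to
the closure. -/
theorem fnV_eq_prim (hL : 0 ≤ L) (u : V L) : fnV u = primCLM hL (dxV u) := by
  have key := H10_induction (L := L)
    (ContinuousLinearMap.fst ℝ (L2 L) (L2 L)
      - (primCLM hL).comp (ContinuousLinearMap.snd ℝ (L2 L) (L2 L))) (fun r hr => ?_)
    _ (V.pair_mem u)
  · exact sub_eq_zero.1 key
  · obtain ⟨φ, h1, h2, h3, h4, h5⟩ := hr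
    refine sub_eq_zero.2 (L2.eq_of_ae ?_)
    filter_upwards [h4, coeFn_primL2 hL r.2, ae_restrict_mem measurableSet_Ioo] with x hx hx2 hm
    change r.1 x = primCLM hL r.2 x
    rw [primCLM_apply, hx2, hx, primFun_eq_intervalIntegral h5 ⟨hm.1, hm.2.le⟩,
      test_primitive h1 h3]

theorem integral_dxV (hL : 0 ≤ L) (u : V L) : ∫ x in Ioo (0 : ℝ) L, dxV u x = 0 := by
  have key := H10_induction (L := L)
    ((innerSL ℝ (oneL2 L)).comp (ContinuousLinearMap.snd ℝ (L2 L) (L2 L))) (fun r hr => ?_)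
    _ (V.pair_mem u)
  · rw [← inner_oneL2]; exact key
  · obtain ⟨φ, h1, h2, h3, h4, h5⟩ := hr
    change inner ℝ (oneL2 L) r.2 = 0
    rw [inner_oneL2, integral_congr_ae h5, setIntegral_Ioo_eq hL, test_primitive h1 h3]
    exact image_eq_zero_of_notMem_tsupport fun h => by simpa using h3 h

theorem fnV_abs_le (hL : 0 ≤ L) (u : V L) : ∀ᵐ x ∂om L, |fnV u x| ≤ √L * ‖dxV u‖ := by
  filter_upwards [coeFn_primL2 hL (dxV u)] with x hx
  rw [fnV_eq_prim hL, primCLM_apply, hx]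
  exact abs_primFun_le hL _ x

theorem norm_fnV_le_dxV (hL : 0 ≤ L) (u : V L) : ‖fnV u‖ ≤ L * ‖dxV u‖ := by
  rw [fnV_eq_prim hL]; exact norm_primL2_le hL _

theorem V.norm_sq_le (hL : 0 ≤ L) (u : V L) : ‖u‖ ^ 2 ≤ (1 + L ^ 2) * ‖dxV u‖ ^ 2 := by
  have := norm_fnV_le_dxV hL u
  rw [V.norm_sq_eq]
  nlinarith [norm_nonneg (fnV u), norm_nonneg (dxV u), mul_nonneg hL (norm_nonneg (dxV u))]

/-- The Riesz representative in `H¹₀` of `w ↦ ⟪f, w⟫ + ⟪h, w_x⟫`. -/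
def PV (f h : L2 L) : V L := (VSub L).orthogonalProjectionOnto (WithLp.toLp 2 (f, h))

theorem PV_inner (f h : L2 L) (w : V L) :
    inner ℝ (PV f h) w = inner ℝ f (fnV w) + inner ℝ h (dxV w) := by
  rw [PV, Submodule.inner_orthogonalProjectionOnto_eq_of_mem_right]
  exact WithLp.prod_inner_apply _ _

theorem eq_PV {u : V L} {f h : L2 L}
    (H : ∀ w : V L, inner ℝ u w = inner ℝ f (fnV w) + inner ℝ h (dxV w)) : u = PV f h :=
  ext_inner_right ℝ fun w => by rw [H, PV_inner]

theorem PV_sub (f h f' h' : L2 L) : PV f h - PV f' h' = PV (f - f') (h - h') :=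
  eq_PV fun w => by
    rw [inner_sub_left, PV_inner, PV_inner, inner_sub_left, inner_sub_left]; ring

theorem norm_PV_le (f h : L2 L) : ‖PV f h‖ ≤ ‖f‖ + ‖h‖ := by
  have h1 : ‖PV f h‖ ^ 2 ≤ (‖f‖ + ‖h‖) * ‖PV f h‖ := by
    rw [← real_inner_self_eq_norm_sq, PV_inner, add_mul]
    exact add_le_add
      ((real_inner_le_norm _ _).trans (mul_le_mul_of_nonneg_left (norm_fnV_le _) (norm_nonneg _)))
      ((real_inner_le_norm _ _).trans (mul_le_mul_of_nonneg_left (norm_dxV_le _) (norm_nonneg _)))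
  rcases (norm_nonneg (PV f h)).eq_or_lt with h0 | h0
  · rw [← h0]; positivity
  · rw [sq] at h1; exact le_of_mul_le_mul_right h1 h0

theorem continuous_PV : Continuous fun q : L2 L × L2 L => PV q.1 q.2 :=
  (VSub L).orthogonalProjectionOnto.continuous.comp
    (WithLp.prodContinuousLinearEquiv 2 ℝ (L2 L) (L2 L)).symm.continuous

/-- `PV f h` solves `u - u_xx = f - h_x` weakly, so `u_x - h` has a square integrable derivative
even though `u_x` and `h` separately need not. -/
theorem isWD_PV (f h : L2 L) : IsWD (dxV (PV f h) - h) (fnV (PV f h) - f) := by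
  intro r hr
  have h1 := PV_inner f h (V.mk r (testPair_mem_H10 hr))
  rw [V.inner_eq, fnV_mk, dxV_mk] at h1
  rw [inner_sub_left, inner_sub_left]
  linarith

theorem integrable_abs (h : L2 L) : Integrable (fun x => |h x|) (om L) := (L2.integrable h).abs

theorem abs_integral_sub_le (hL : 0 ≤ L) (u : V L) (h : L2 L) :
    |∫ x in Ioo (0 : ℝ) L, (dxV u - h) x| ≤ ∫ x in Ioo (0 : ℝ) L, |h x| := by
  have e : ∫ x in Ioo (0 : ℝ) L, (dxV u - h) x = - ∫ x in Ioo (0 : ℝ) L, h x := by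
    rw [integral_congr_ae (Lp.coeFn_sub _ _)]
    simp only [Pi.sub_apply]
    rw [integral_sub (L2.integrable _) (L2.integrable _), integral_dxV hL, zero_sub]
  rw [e, abs_neg]
  exact norm_integral_le_integral_norm (f := (h : ℝ → ℝ))

/-- For `h = 0` the derivative `u_x` has mean zero and weak derivative `u - f` in `L²`, which bounds
it pointwise. -/
theorem dxV_PV_abs_le (hL : 0 < L) (f : L2 L) :
    ∀ᵐ x ∂om L, |dxV (PV f 0) x| ≤ 4 * √L * ‖f‖ := by
  have h0 : ‖PV f 0‖ ≤ ‖f‖ := by simpa using norm_PV_le f 0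
  filter_upwards [(isWD_PV f 0).abs_le hL] with x hx
  have h1 := abs_integral_sub_le hL.le (PV f 0) 0
  have h2 : ∫ x in Ioo (0 : ℝ) L, |(0 : L2 L) x| = 0 := by
    rw [integral_congr_ae (g := fun _ => (0 : ℝ))]
    · simp
    · filter_upwards [Lp.coeFn_zero ℝ 2 (om L)] with x hx
      rw [hx]; simp
  rw [h2] at h1
  have h3 : |∫ x in Ioo (0 : ℝ) L, (dxV (PV f 0) - 0) x| = 0 := le_antisymm h1 (abs_nonneg _)
  rw [h3, mul_zero, zero_add, sub_zero] at hx
  have h4 : ‖fnV (PV f 0) - f‖ ≤ 2 * ‖f‖ := by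
    have := norm_sub_le (fnV (PV f 0)) f
    linarith [norm_fnV_le (PV f 0)]
  nlinarith [Real.sqrt_nonneg L]

/-- Duality: with `s` the Riesz representative of `(u, 0)`, the square of `‖u‖` is `⟪f, s⟫ + ⟪h,
s_x⟫`. Since `s_x` is bounded pointwise, the `L¹` norm of `h` is enough. -/
theorem norm_fnV_PV_le (hL : 0 < L) (f h : L2 L) :
    ‖fnV (PV f h)‖ ≤ ‖f‖ + 4 * √L * ∫ x in Ioo (0 : ℝ) L, |h x| := by
  set u := PV f h with hu
  set s := PV (fnV u) 0 with hs
  have hsn : ‖s‖ ≤ ‖fnV u‖ := by simpa using norm_PV_le (fnV u) 0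
  have e1 : ‖fnV u‖ ^ 2 = inner ℝ f (fnV s) + inner ℝ h (dxV s) := by
    rw [← PV_inner, ← hu, real_inner_comm, hs, PV_inner, inner_zero_left, add_zero,
      real_inner_self_eq_norm_sq]
  have b1 : inner ℝ f (fnV s) ≤ ‖f‖ * ‖fnV u‖ := (real_inner_le_norm _ _).trans
    (mul_le_mul_of_nonneg_left ((norm_fnV_le s).trans hsn) (norm_nonneg _))
  have b2 : inner ℝ h (dxV s) ≤ 4 * √L * ‖fnV u‖ * ∫ x in Ioo (0 : ℝ) L, |h x| := by
    rw [L2.inner_eq, ← integral_const_mul]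
    refine integral_mono_ae (L2.integrable_mul _ _) ((integrable_abs h).const_mul _) ?_
    filter_upwards [dxV_PV_abs_le hL (fnV u)] with x hx
    calc h x * dxV s x ≤ |h x * dxV s x| := le_abs_self _
      _ = |dxV s x| * |h x| := by rw [abs_mul, mul_comm]
      _ ≤ _ := mul_le_mul_of_nonneg_right hx (abs_nonneg _)
  rcases (norm_nonneg (fnV u)).eq_or_lt with h0 | h0
  · rw [← h0]
    have : 0 ≤ ∫ x in Ioo (0 : ℝ) L, |h x| := integral_nonneg fun _ => abs_nonneg _
    positivity
  · refine le_of_mul_le_mul_right ?_ h0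
    nlinarith

/-- Sup bound of `u_x - h`, for `u` the Riesz representative of `(f, h)`, by the `L¹` norm of
`h` and the `L²` norm of `f`. -/
theorem flux_abs_le (hL : 0 < L) (f h : L2 L) : ∀ᵐ x ∂om L, |(dxV (PV f h) - h) x| ≤
    (1 / L + 8 * L) * (∫ x in Ioo (0 : ℝ) L, |h x|) + 4 * √L * ‖f‖ := by
  filter_upwards [(isWD_PV f h).abs_le hL] with x hx
  have h1 := mul_le_mul_of_nonneg_left (abs_integral_sub_le hL.le (PV f h) h)
    (by positivity : 0 ≤ 1 / L)
  have h2 := norm_fnV_PV_le hL f h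
  have h3 := norm_sub_le (fnV (PV f h)) f
  have h4 : 2 * √L * ‖fnV (PV f h) - f‖
      ≤ 2 * √L * (2 * ‖f‖ + 4 * √L * ∫ x in Ioo (0 : ℝ) L, |h x|) :=
    mul_le_mul_of_nonneg_left (by linarith) (by positivity)
  have h5 : √L * √L = L := Real.mul_self_sqrt hL.le
  have h6 : 2 * √L * (2 * ‖f‖ + 4 * √L * ∫ x in Ioo (0 : ℝ) L, |h x|)
      = 4 * √L * ‖f‖ + 8 * (√L * √L) * ∫ x in Ioo (0 : ℝ) L, |h x| := by ring
  rw [h6, h5] at h4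
  linarith

/-- The inclusion of `H¹₀ ∩ H²` in `H¹₀`. -/
def toV : H10H2 L →L[ℝ] V L where
  toFun u := V.mk (fn u, dx u) u.2.1
  map_add' _ _ := rfl
  map_smul' _ _ := rfl
  cont := by
    refine Continuous.subtype_mk ?_ _
    refine (WithLp.prodContinuousLinearEquiv 2 ℝ (L2 L) (L2 L)).symm.continuous.comp ?_
    exact (by fun_prop : Continuous fun u : H10H2 L => (u.1.1, u.1.2.1))

theorem fnV_toV (u : H10H2 L) : fnV (toV u) = fn u := rfl

theorem dxV_toV (u : H10H2 L) : dxV (toV u) = dx u := rfl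

theorem isWD_dx (u : H10H2 L) : IsWD (dx u) u.1.2.2 := u.2.2

theorem dx_abs_le (hL : 0 < L) (u : H10H2 L) : ∀ᵐ x ∂om L, |dx u x| ≤ 2 * √L * ‖u‖ := by
  filter_upwards [(isWD_dx u).abs_le hL] with x hx
  rw [← dxV_toV, integral_dxV hL.le, abs_zero, mul_zero, zero_add, dxV_toV] at hx
  have : ‖u.1.2.2‖ ≤ ‖u‖ := (norm_snd_le u.1.2).trans (norm_snd_le u.1)
  exact hx.trans (mul_le_mul_of_nonneg_left this (by positivity))

end SpaceV

section Nemytskii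

variable {L p R : ℝ}

/-- The Nemytskii operator of the truncated power on `L²`. -/
def nem (hp : 2 ≤ p) (hR : 0 ≤ R) (u : L2 L) : L2 L :=
  (lipschitz_trunc hp hR).compLp trunc_zero u

theorem coeFn_nem (hp : 2 ≤ p) (hR : 0 ≤ R) (u : L2 L) :
    ∀ᵐ x ∂om L, nem hp hR u x = trunc p R (u x) :=
  (lipschitz_trunc hp hR).coeFn_compLp trunc_zero u

theorem norm_nem_sub_le (hp : 2 ≤ p) (hR : 0 ≤ R) (u w : L2 L) :
    ‖nem hp hR u - nem hp hR w‖ ≤ (p - 1) * R ^ (p - 2) * ‖u - w‖ := by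
  rw [← coe_truncLip hp hR]
  exact (lipschitz_trunc hp hR).norm_compLp_sub_le trunc_zero u w

theorem continuous_nem (hp : 2 ≤ p) (hR : 0 ≤ R) : Continuous (nem (L := L) hp hR) :=
  (lipschitz_trunc hp hR).continuous_compLp trunc_zero

/-- The integral of the primitive of the truncated power. -/
def nemInt (p R : ℝ) (u : L2 L) : ℝ := ∫ x in Ioo (0 : ℝ) L, truncPrim p R (u x)

theorem integrable_mul_nem (hp : 2 ≤ p) (hR : 0 ≤ R) (u w : L2 L) :
    Integrable (fun x => trunc p R (u x) * w x) (om L) := by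
  refine (L2.integrable_mul (nem hp hR u) w).congr ?_
  filter_upwards [coeFn_nem hp hR u] with x hx
  rw [hx]

theorem inner_nem (hp : 2 ≤ p) (hR : 0 ≤ R) (u w : L2 L) :
    inner ℝ (nem hp hR u) w = ∫ x in Ioo (0 : ℝ) L, trunc p R (u x) * w x := by
  rw [L2.inner_eq]
  refine integral_congr_ae ?_
  filter_upwards [coeFn_nem hp hR u] with x hx
  rw [hx]

theorem integrable_truncPrim (hp : 2 ≤ p) (hR : 0 ≤ R) (u : L2 L) :
    Integrable (fun x => truncPrim p R (u x)) (om L) := by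
  have hc : Continuous (truncPrim p R) :=
    continuous_iff_continuousAt.2 fun s => (hasDerivAt_truncPrim hp hR s).continuousAt
  refine (integrable_mul_nem hp hR u u).mono
    (hc.comp_aestronglyMeasurable (Lp.aestronglyMeasurable u)) (Eventually.of_forall fun x => ?_)
  rw [Real.norm_of_nonneg (truncPrim_nonneg hR _)]
  have := truncPrim_le_mul hp hR (u x)
  rw [mul_comm] at this
  exact this.trans (le_abs_self _)

theorem nemInt_nonneg (hR : 0 ≤ R) (u : L2 L) : 0 ≤ nemInt p R u :=
  integral_nonneg fun _ => truncPrim_nonneg hR _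

theorem nemInt_le_inner (hp : 2 ≤ p) (hR : 0 ≤ R) (u : L2 L) :
    nemInt p R u ≤ inner ℝ (nem hp hR u) u := by
  rw [inner_nem]
  refine integral_mono (integrable_truncPrim hp hR u) (integrable_mul_nem hp hR u u) fun x => ?_
  simpa only [mul_comm] using truncPrim_le_mul hp hR (u x)

theorem abs_nemInt_sub_le (hp : 2 ≤ p) (hR : 0 ≤ R) (a b : L2 L) :
    |nemInt p R b - nemInt p R a - inner ℝ (nem hp hR a) (b - a)|
      ≤ (p - 1) * R ^ (p - 2) * ‖b - a‖ ^ 2 := by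
  have hba := Lp.coeFn_sub b a
  have i1 := integrable_truncPrim hp hR a
  have i2 := integrable_truncPrim hp hR b
  have i3 := integrable_mul_nem hp hR a (b - a)
  have e : nemInt p R b - nemInt p R a - inner ℝ (nem hp hR a) (b - a) =
      ∫ x in Ioo (0 : ℝ) L, (truncPrim p R (b x) - truncPrim p R (a x)
        - trunc p R (a x) * (b - a) x) := by
    rw [nemInt, nemInt, inner_nem, ← integral_sub i2 i1]
    exact (integral_sub (i2.sub i1) i3).symm
  rw [e, L2.norm_sq_eq, ← integral_const_mul]
  refine (norm_integral_le_integral_norm (μ := om L) _).trans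
    (integral_mono_ae ((i2.sub i1).sub i3).norm ((L2.integrable_sq (b - a)).const_mul _) ?_)
  filter_upwards [hba] with x hx
  simp only [Pi.sub_apply] at hx
  simp only [hx, Pi.sub_apply]
  exact abs_truncPrim_sub_le hp hR (a x) (b x)

/-- The Lipschitz bound of the truncated power makes the remainder quadratic in the `L²` norm. The
untruncated functional would not be differentiable on `L²` in this way. -/
theorem hasFDerivAt_nemInt (hp : 2 ≤ p) (hR : 0 ≤ R) (a : L2 L) :
    HasFDerivAt (nemInt p R) (innerSL ℝ (nem hp hR a)) a := by
  rw [hasFDerivAt_iff_isLittleO]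
  refine Asymptotics.IsBigO.trans_isLittleO (g := fun b => ‖b - a‖ ^ 2) ?_ ?_
  · refine Asymptotics.IsBigO.of_bound ((p - 1) * R ^ (p - 2)) (Eventually.of_forall fun b => ?_)
    rw [Real.norm_eq_abs, Real.norm_of_nonneg (sq_nonneg _)]
    exact abs_nemInt_sub_le hp hR a b
  · have := Asymptotics.isLittleO_norm_pow_id (E' := L2 L) one_lt_two
    have h2 : Tendsto (fun b : L2 L => b - a) (𝓝 a) (𝓝 0) := by
      have := (by fun_prop : Continuous fun b : L2 L => b - a).tendsto a
      rwa [sub_self] at this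
    exact this.comp_tendsto h2

theorem hasDerivAt_nemInt (hp : 2 ≤ p) (hR : 0 ≤ R) {v : ℝ → L2 L} {v' : L2 L} {t : ℝ}
    (h : HasDerivAt v v' t) :
    HasDerivAt (fun t => nemInt p R (v t)) (inner ℝ (nem hp hR (v t)) v') t :=
  (hasFDerivAt_nemInt hp hR (v t)).comp_hasDerivAt t h

end Nemytskii

end Love

end

/-! ### Fixed points and Gronwall estimates in exponentially weighted norms; gluing of past and
future -/

noncomputable section

namespace Love

section Volterra

/-- A map on paths that is causal and contracting in exponentially weighted norms has a
continuous fixed point. -/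
theorem exists_fixed_path {X : Type*} [NormedAddCommGroup X] [NormedSpace ℝ X] [CompleteSpace X]
    (Φ : (ℝ → X) → ℝ → X) (hcont : ∀ u, Continuous u → ContinuousOn (Φ u) (Ici 0))
    {C K : ℝ} (hC : 0 ≤ C)
    (hlip : ∀ u w, Continuous u → Continuous w → ∀ a M, 1 ≤ a → 0 ≤ M →
      (∀ s, 0 ≤ s → ‖u s - w s‖ ≤ M * Real.exp (a * s)) →
      ∀ t, 0 ≤ t → ‖Φ u t - Φ w t‖ ≤ C / a * M * Real.exp (a * t))
    (hzero : ∀ t, 0 ≤ t → ‖Φ 0 t‖ ≤ K * Real.exp t) :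
    ∃ u, Continuous u ∧ ∀ t, 0 ≤ t → u t = Φ u t := by
  -- A weight so strong that the contraction factor `C / a` is at most one half.
  set a : ℝ := 2 * C + 1 with ha
  have ha1 : 1 ≤ a := by linarith
  have ha0 : 0 < a := by linarith
  have hCa : C / a ≤ 1 / 2 := by rw [div_le_div_iff₀ ha0 two_pos]; linarith
  -- Bounded functions on the half-line parametrize paths of exponential growth; for negative times
  -- the path is frozen at its initial value, which keeps it continuous on `ℝ`.
  let P : BoundedContinuousFunction ℝ≥0 X → ℝ → X := fun ψ t =>
    Real.exp (a * max t 0) • ψ (Real.toNNReal t)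
  have hP : ∀ ψ, Continuous (P ψ) := fun ψ => by
    have := continuous_real_toNNReal
    have h2 := ψ.continuous
    fun_prop
  have hPnn : ∀ ψ (t : ℝ≥0), P ψ t = Real.exp (a * t) • ψ t := fun ψ t => by
    simp [P]
  have hdiff : ∀ ψ ψ' : BoundedContinuousFunction ℝ≥0 X, ∀ s, 0 ≤ s →
      ‖P ψ s - P ψ' s‖ ≤ ‖ψ - ψ'‖ * Real.exp (a * s) := fun ψ ψ' s hs => by
    lift s to ℝ≥0 using hs
    rw [hPnn, hPnn, ← smul_sub, norm_smul, Real.norm_of_nonneg (Real.exp_pos _).le, mul_comm]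
    exact mul_le_mul_of_nonneg_right ((ψ - ψ').norm_coe_le_norm s) (Real.exp_pos _).le
  have hP0 : P 0 = 0 := by ext t; simp [P]
  have hK : 0 ≤ K := by
    have := (norm_nonneg _).trans (hzero 0 le_rfl)
    simpa using this
  have hbound : ∀ ψ, ∀ t, 0 ≤ t → ‖Φ (P ψ) t‖ ≤ (1 / 2 * ‖ψ‖ + K) * Real.exp (a * t) := by
    intro ψ t ht
    have h1 := hlip (P ψ) (P 0) (hP _) (hP _) a ‖ψ - 0‖ ha1 (norm_nonneg _) (hdiff ψ 0) t ht
    rw [hP0, sub_zero] at h1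
    have h2 := norm_sub_norm_le (Φ (P ψ) t) (Φ 0 t)
    have h3 : K * Real.exp t ≤ K * Real.exp (a * t) :=
      mul_le_mul_of_nonneg_left (Real.exp_le_exp.2 (le_mul_of_one_le_left ht ha1)) hK
    have h4 : C / a * ‖ψ‖ * Real.exp (a * t) ≤ 1 / 2 * ‖ψ‖ * Real.exp (a * t) := by gcongr
    linarith [hzero t ht]
  let F : BoundedContinuousFunction ℝ≥0 X → BoundedContinuousFunction ℝ≥0 X := fun ψ =>
    BoundedContinuousFunction.ofNormedAddCommGroup
      (fun t : ℝ≥0 => Real.exp (-(a * t)) • Φ (P ψ) t)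
      (by
        have h1 : Continuous fun t : ℝ≥0 => Φ (P ψ) t :=
          (hcont _ (hP ψ)).comp_continuous NNReal.continuous_coe fun t => t.2
        have h2 : Continuous fun t : ℝ≥0 => Real.exp (-(a * t)) := by fun_prop
        exact h2.smul h1)
      (1 / 2 * ‖ψ‖ + K) (fun t => by
        rw [norm_smul, Real.norm_of_nonneg (Real.exp_pos _).le, Real.exp_neg,
          inv_mul_le_iff₀ (Real.exp_pos _), mul_comm]
        exact hbound ψ t t.2)
  have hF : ∀ ψ (t : ℝ≥0), F ψ t = Real.exp (-(a * t)) • Φ (P ψ) t := fun _ _ => rfl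
  have hK2 : ContractingWith (1 / 2 : ℝ≥0) F := by
    refine ⟨by rw [← NNReal.coe_lt_coe]; norm_num, LipschitzWith.of_dist_le_mul fun ψ ψ' => ?_⟩
    rw [dist_eq_norm, dist_eq_norm]
    refine (BoundedContinuousFunction.norm_le (by positivity)).2 fun t => ?_
    have h1 := hlip (P ψ) (P ψ') (hP _) (hP _) a ‖ψ - ψ'‖ ha1 (norm_nonneg _) (hdiff ψ ψ') t t.2
    rw [BoundedContinuousFunction.sub_apply, hF, hF, ← smul_sub, norm_smul,
      Real.norm_of_nonneg (Real.exp_pos _).le, Real.exp_neg, inv_mul_le_iff₀ (Real.exp_pos _)]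
    have h4 : C / a * ‖ψ - ψ'‖ * Real.exp (a * t) ≤ 1 / 2 * ‖ψ - ψ'‖ * Real.exp (a * t) := by gcongr
    have h5 : ((1 / 2 : ℝ≥0) : ℝ) = 1 / 2 := by norm_num
    rw [h5]
    linarith
  set ψ := ContractingWith.fixedPoint F hK2 with hψ
  have hfix : F ψ = ψ := hK2.fixedPoint_isFixedPt
  refine ⟨P ψ, hP ψ, fun t ht => ?_⟩
  lift t to ℝ≥0 using ht
  conv_lhs => rw [hPnn, ← hfix, hF, smul_smul, ← Real.exp_add]
  simp

/-- A Gronwall lemma in exponentially weighted norms. -/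
theorem weighted_gronwall {φ : ℝ → ℝ} {T K a : ℝ}
    (hbdd : BddAbove (φ '' Icc 0 T)) (hnn : ∀ t ∈ Icc 0 T, 0 ≤ φ t) (ha : 0 ≤ a)
    (H : ∀ M, 0 ≤ M → (∀ s ∈ Icc 0 T, φ s ≤ M * Real.exp (a * s)) →
      ∀ t ∈ Icc 0 T, φ t ≤ (K + M / 2) * Real.exp (a * t)) :
    ∀ t ∈ Icc 0 T, φ t ≤ 2 * K * Real.exp (a * t) := by
  intro t ht
  set S := (fun s => φ s * Real.exp (-(a * s))) '' Icc 0 T with hS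
  have hbd : BddAbove S := by
    obtain ⟨B, hB⟩ := hbdd
    refine ⟨B, ?_⟩
    rintro _ ⟨s, hs, rfl⟩
    have h1 : Real.exp (-(a * s)) ≤ 1 := Real.exp_le_one_iff.2 (by nlinarith [mul_nonneg ha hs.1])
    have h2 := hB (mem_image_of_mem φ hs)
    simp only
    nlinarith [hnn s hs]
  have hne : S.Nonempty := ⟨_, mem_image_of_mem _ ht⟩
  set M := sSup S with hM
  have hle : ∀ s ∈ Icc 0 T, φ s ≤ M * Real.exp (a * s) := fun s hs => by
    have h1 : φ s * Real.exp (-(a * s)) ≤ M := le_csSup hbd (mem_image_of_mem _ hs)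
    rw [Real.exp_neg, ← div_eq_mul_inv, div_le_iff₀ (Real.exp_pos _)] at h1
    exact h1
  have hM0 : 0 ≤ M := (mul_nonneg (hnn t ht) (Real.exp_pos _).le).trans
    (le_csSup hbd (mem_image_of_mem _ ht))
  -- The hypothesis is applied with `M` equal to the weighted supremum itself, which is finite by
  -- boundedness of `φ`.
  have h2 : M ≤ K + M / 2 := csSup_le hne (by
    rintro _ ⟨s, hs, rfl⟩
    have := H M hM0 hle s hs
    simp only
    rw [Real.exp_neg, ← div_eq_mul_inv, div_le_iff₀ (Real.exp_pos _)]
    exact this)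
  have h3 : M ≤ 2 * K := by linarith
  exact (hle t ht).trans (by gcongr)

theorem norm_integral_le_exp {X : Type*} [NormedAddCommGroup X] [NormedSpace ℝ X]
    {u : ℝ → X} {a M t : ℝ} (ha : 0 < a) (hM : 0 ≤ M) (ht : 0 ≤ t)
    (h : ∀ᵐ s ∂volume.restrict (Ioc 0 t), ‖u s‖ ≤ M * Real.exp (a * s)) :
    ‖∫ s in (0 : ℝ)..t, u s‖ ≤ M / a * Real.exp (a * t) := by
  have h1 : ‖∫ s in (0 : ℝ)..t, u s‖ ≤ ∫ s in (0 : ℝ)..t, M * Real.exp (a * s) := by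
    refine intervalIntegral.norm_integral_le_of_norm_le ht
      ((ae_restrict_iff' measurableSet_Ioc).1 h) (Continuous.intervalIntegrable (by fun_prop) _ _)
  have h2 : ∫ s in (0 : ℝ)..t, M * Real.exp (a * s) = M / a * (Real.exp (a * t) - 1) := by
    rw [intervalIntegral.integral_const_mul, intervalIntegral.integral_comp_mul_left _ ha.ne',
      integral_exp]
    simp only [mul_zero, Real.exp_zero, smul_eq_mul]
    ring
  have h3 : 0 ≤ M / a := by positivity
  linarith

end Volterra

section ConvBounds

variable {F : Type*} [NormedAddCommGroup F] [NormedSpace ℝ F] {μ : ℝ → ℝ}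

set_option linter.unusedSectionVars false

theorem IsKernel.norm_integral_smul_le (hμ : IsKernel μ) (hκ : ∫ s in Ioi (0 : ℝ), μ s ≤ 1)
    {φ : ℝ → F} {t B : ℝ} (ht : 0 ≤ t) (hB : 0 ≤ B) (h : ∀ s ∈ Ioc 0 t, ‖φ s‖ ≤ B) :
    ‖∫ s in (0 : ℝ)..t, μ s • φ s‖ ≤ B := by
  rw [intervalIntegral.integral_of_le ht]
  have i1 : IntegrableOn (fun s => μ s * B) (Ioi 0) := hμ.integrable.mul_const B
  have h1 : ‖∫ s in Ioc 0 t, μ s • φ s‖ ≤ ∫ s in Ioc 0 t, μ s * B := by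
    refine norm_integral_le_of_norm_le (i1.mono_set Ioc_subset_Ioi_self) ?_
    filter_upwards [ae_restrict_mem measurableSet_Ioc] with s hs
    rw [norm_smul, Real.norm_of_nonneg (hμ.nonneg s hs.1.le)]
    exact mul_le_mul_of_nonneg_left (h s hs) (hμ.nonneg s hs.1.le)
  have h2 : ∫ s in Ioc 0 t, μ s * B ≤ ∫ s in Ioi (0 : ℝ), μ s * B :=
    setIntegral_mono_set i1 (by
      filter_upwards [hμ.ae_nonneg] with s hs using mul_nonneg hs hB)
      Ioc_subset_Ioi_self.eventuallyLE
  have h3 : ∫ s in Ioi (0 : ℝ), μ s * B ≤ 1 * B := by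
    rw [integral_mul_const]; exact mul_le_mul_of_nonneg_right hκ hB
  linarith

theorem IsPath.norm_conv_le (hμ : IsKernel μ) (hκ : ∫ s in Ioi (0 : ℝ), μ s ≤ 1)
    {φ : ℝ → F} (hφ : IsPath μ φ) {t B : ℝ} (ht : 0 ≤ t) (hB : 0 ≤ B)
    (h : ∀ s ∈ Icc 0 t, ‖φ s‖ ≤ B) :
    ‖conv μ φ t‖ ≤ B + ∫ s in Ioi (0 : ℝ), μ s * ‖φ (-s)‖ := by
  rw [hφ.conv_eq hμ ht]
  refine (norm_add_le _ _).trans (add_le_add ?_ ?_)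
  · exact hμ.norm_integral_smul_le hκ ht hB fun s hs => h _ ⟨by linarith [hs.2], by linarith [hs.1]⟩
  · refine norm_integral_le_of_norm_le hφ.int ?_
    filter_upwards [ae_restrict_mem measurableSet_Ioi] with s hs
    have hs' : 0 ≤ s := le_of_lt hs
    rw [norm_smul, Real.norm_of_nonneg (hμ.nonneg _ (by linarith))]
    exact mul_le_mul_of_nonneg_right (hμ.shift_le ht hs') (norm_nonneg _)

/-- With a common past only the lags in `(0, t]` contribute, so the map is causal and the past costs
nothing. -/
theorem IsPath.norm_conv_sub_le (hμ : IsKernel μ) (hκ : ∫ s in Ioi (0 : ℝ), μ s ≤ 1)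
    {φ ψ : ℝ → F} (hφ : IsPath μ φ) (hψ : IsPath μ ψ) {t B : ℝ} (ht : 0 ≤ t) (hB : 0 ≤ B)
    (hpast : ∀ s, 0 < s → φ (-s) = ψ (-s))
    (h : ∀ s ∈ Icc 0 t, ‖φ s - ψ s‖ ≤ B) :
    ‖conv μ φ t - conv μ ψ t‖ ≤ B := by
  have e : ∫ s in Ioi (0 : ℝ), μ (t + s) • φ (-s) = ∫ s in Ioi (0 : ℝ), μ (t + s) • ψ (-s) :=
    setIntegral_congr_fun measurableSet_Ioi fun s hs => by
      simp only [hpast s hs]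
  rw [hφ.conv_eq hμ ht, hψ.conv_eq hμ ht, e, add_sub_add_right_eq_sub,
    ← intervalIntegral.integral_sub
      ((intervalIntegrable_iff_integrableOn_Ioc_of_le ht).2 (hφ.integrable_Ioc hμ))
      ((intervalIntegrable_iff_integrableOn_Ioc_of_le ht).2 (hψ.integrable_Ioc hμ))]
  simp only [← smul_sub]
  exact hμ.norm_integral_smul_le hκ ht hB
    fun s hs => h _ ⟨by linarith [hs.2], by linarith [hs.1]⟩

/-- The path with past `w`, `w(s)` being the value at time `-s`, and future `v`. -/
def glue (w v : ℝ → F) (t : ℝ) : F := if t ≤ 0 then w (-t) else v t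

theorem glue_of_nonneg {w v : ℝ → F} (h : w 0 = v 0) {t : ℝ} (ht : 0 ≤ t) : glue w v t = v t := by
  rcases ht.eq_or_lt with h0 | h0
  · rw [← h0, glue, if_pos le_rfl, neg_zero, h]
  · rw [glue, if_neg (not_le.2 h0)]

theorem glue_neg {w v : ℝ → F} {s : ℝ} (hs : 0 < s) : glue w v (-s) = w s := by
  rw [glue, if_pos (by linarith), neg_neg]

theorem isPath2_glue {w v : ℝ → F} (h : w 0 = v 0) (hv : ContinuousOn v (Ici 0))
    (hw : AEStronglyMeasurable w (volume.restrict (Ioi 0)))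
    (hw2 : IntegrableOn (fun s => μ s * ‖w s‖ ^ 2) (Ioi 0)) : IsPath2 μ (glue w v) where
  cont := hv.congr fun t ht => glue_of_nonneg h ht
  meas := hw.congr (by
    filter_upwards [ae_restrict_mem measurableSet_Ioi] with s hs using (glue_neg hs).symm)
  int := hw2.congr_fun (fun s hs => by simp only [glue_neg hs]) measurableSet_Ioi

end ConvBounds

end Love

end

/-! ### Global solutions of the truncated problem -/

noncomputable section

namespace Love

variable {L : ℝ}

/-- A past `w(s)`, `s ≥ 0`, of finite weighted energy that ends at `v`. -/
structure PastOf {F : Type*} [NormedAddCommGroup F] (μ : ℝ → ℝ) (w : ℝ → F) (v : F) : Prop where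
  zero : w 0 = v
  meas : AEStronglyMeasurable w (volume.restrict (Ioi 0))
  int : IntegrableOn (fun s => μ s * ‖w s‖ ^ 2) (Ioi 0)

theorem PastOf.isPath2 {F : Type*} [NormedAddCommGroup F] [NormedSpace ℝ F] {μ : ℝ → ℝ}
    {w v : ℝ → F} {a : F} (hw : PastOf μ w a) (ha : v 0 = a) (hv : ContinuousOn v (Ici 0)) :
    IsPath2 μ (glue w v) :=
  isPath2_glue (hw.zero.trans ha.symm) hv hw.meas hw.int

/-- The stress `u_x + u'_x - ∫ μ(s) u_x(t-s) ds + g(u_x)` of the truncated problem. -/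
def stress {p R : ℝ} (hp : 2 ≤ p) (hR : 0 ≤ R) (μ : ℝ → ℝ) (w : ℝ → L2 L) (Y Y1 : ℝ → V L)
    (t : ℝ) : L2 L :=
  dxV (Y t) + dxV (Y1 t) - conv μ (glue w fun t => dxV (Y t)) t + nem hp hR (dxV (Y t))

/-- A global solution of the problem with truncated nonlinearities. -/
structure TruncSol {p R : ℝ} (hp : 2 ≤ p) (hR : 0 ≤ R) (μ : ℝ → ℝ) (w : ℝ → L2 L) (u0 u1 : V L)
    (Y Y1 Y2 : ℝ → V L) : Prop where
  cont : Continuous Y2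
  d0 : ∀ t, HasDerivAt Y (Y1 t) t
  d1 : ∀ t, HasDerivAt Y1 (Y2 t) t
  init0 : Y 0 = u0
  init1 : Y1 0 = u1
  eq : ∀ t, 0 ≤ t → Y2 t = PV (nem hp hR (fnV (Y t))) (-stress hp hR μ w Y Y1 t)

/-- The right-hand side of the truncated problem depends Lipschitz continuously on the path. -/
theorem norm_rhs_sub_le {p R : ℝ} (hp : 2 ≤ p) (hR : 0 ≤ R) {μ : ℝ → ℝ} (hμ : IsKernel μ)
    (hκ : ∫ s in Ioi (0 : ℝ), μ s ≤ 1) {w : ℝ → L2 L} {u0 : V L} (hw : PastOf μ w (dxV u0))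
    {Y Y1 Z Z1 : ℝ → V L} (hY : ContinuousOn Y (Ici 0)) (hZ : ContinuousOn Z (Ici 0))
    (hY0 : Y 0 = u0) (hZ0 : Z 0 = u0) {t B : ℝ} (ht : 0 ≤ t)
    (h0 : ∀ s ∈ Icc 0 t, ‖Y s - Z s‖ ≤ B) (h1 : ‖Y1 t - Z1 t‖ ≤ B) :
    ‖PV (nem hp hR (fnV (Y t))) (-stress hp hR μ w Y Y1 t)
      - PV (nem hp hR (fnV (Z t))) (-stress hp hR μ w Z Z1 t)‖
      ≤ (3 + 2 * ((p - 1) * R ^ (p - 2))) * B := by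
  set Λ := (p - 1) * R ^ (p - 2) with hΛ
  have hΛ0 : 0 ≤ Λ := mul_nonneg (by linarith) (Real.rpow_nonneg hR _)
  have hB : 0 ≤ B := (norm_nonneg _).trans h1
  have ht' := h0 t (right_mem_Icc.2 ht)
  have hd : ∀ s ∈ Icc 0 t, ‖dxV (Y s) - dxV (Z s)‖ ≤ B := fun s hs => by
    rw [← map_sub]; exact (norm_dxV_le _).trans (h0 s hs)
  have cY : ContinuousOn (fun t => dxV (Y t)) (Ici 0) := dxV.continuous.comp_continuousOn hY
  have cZ : ContinuousOn (fun t => dxV (Z t)) (Ici 0) := dxV.continuous.comp_continuousOn hZ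
  have pY := (hw.isPath2 (v := fun t => dxV (Y t)) (by rw [hY0]) cY).isPath hμ
  have pZ := (hw.isPath2 (v := fun t => dxV (Z t)) (by rw [hZ0]) cZ).isPath hμ
  have b1 : ‖nem hp hR (fnV (Y t)) - nem hp hR (fnV (Z t))‖ ≤ Λ * B := by
    refine (norm_nem_sub_le hp hR _ _).trans (mul_le_mul_of_nonneg_left ?_ hΛ0)
    rw [← map_sub]; exact (norm_fnV_le _).trans ht'
  have b2 : ‖nem hp hR (dxV (Y t)) - nem hp hR (dxV (Z t))‖ ≤ Λ * B :=
    (norm_nem_sub_le hp hR _ _).trans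
      (mul_le_mul_of_nonneg_left (hd t (right_mem_Icc.2 ht)) hΛ0)
  have b3 : ‖conv μ (glue w fun t => dxV (Y t)) t - conv μ (glue w fun t => dxV (Z t)) t‖ ≤ B := by
    refine pY.norm_conv_sub_le hμ hκ pZ ht hB (fun s hs => by rw [glue_neg hs, glue_neg hs])
      fun s hs => ?_
    rw [glue_of_nonneg (by rw [hw.zero, hY0]) hs.1, glue_of_nonneg (by rw [hw.zero, hZ0]) hs.1]
    exact hd s hs
  have b4 : ‖dxV (Y1 t) - dxV (Z1 t)‖ ≤ B := by
    rw [← map_sub]; exact (norm_dxV_le _).trans h1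
  have b5 := hd t (right_mem_Icc.2 ht)
  rw [PV_sub]
  refine (norm_PV_le _ _).trans ?_
  have e : -stress hp hR μ w Y Y1 t - -stress hp hR μ w Z Z1 t
      = -((dxV (Y t) - dxV (Z t)) + (dxV (Y1 t) - dxV (Z1 t))
        - (conv μ (glue w fun t => dxV (Y t)) t - conv μ (glue w fun t => dxV (Z t)) t)
        + (nem hp hR (dxV (Y t)) - nem hp hR (dxV (Z t)))) := by
    simp only [stress]; abel
  rw [e, norm_neg]
  have n1 := norm_add_le ((dxV (Y t) - dxV (Z t)) + (dxV (Y1 t) - dxV (Z1 t))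
        - (conv μ (glue w fun t => dxV (Y t)) t - conv μ (glue w fun t => dxV (Z t)) t))
        (nem hp hR (dxV (Y t)) - nem hp hR (dxV (Z t)))
  have n2 := norm_sub_le ((dxV (Y t) - dxV (Z t)) + (dxV (Y1 t) - dxV (Z1 t)))
        (conv μ (glue w fun t => dxV (Y t)) t - conv μ (glue w fun t => dxV (Z t)) t)
  have n3 := norm_add_le (dxV (Y t) - dxV (Z t)) (dxV (Y1 t) - dxV (Z1 t))
  linarith

theorem nem_zero {p R : ℝ} (hp : 2 ≤ p) (hR : 0 ≤ R) : nem hp hR (0 : L2 L) = 0 :=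
  L2.eq_of_ae (by
    filter_upwards [coeFn_nem hp hR (0 : L2 L), Lp.coeFn_zero ℝ 2 (om L)] with x h1 h2
    rw [h1, h2, Pi.zero_apply, trunc_zero])

theorem norm_nem_le {p R : ℝ} (hp : 2 ≤ p) (hR : 0 ≤ R) (u : L2 L) :
    ‖nem hp hR u‖ ≤ (p - 1) * R ^ (p - 2) * ‖u‖ := by
  simpa [nem_zero] using norm_nem_sub_le hp hR u 0

/-- Growth bound for the right-hand side of the truncated problem. -/
theorem norm_rhs_le {p R : ℝ} (hp : 2 ≤ p) (hR : 0 ≤ R) {μ : ℝ → ℝ} (hμ : IsKernel μ)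
    (hκ : ∫ s in Ioi (0 : ℝ), μ s ≤ 1) {w : ℝ → L2 L} {u0 : V L} (hw : PastOf μ w (dxV u0))
    {Y Y1 : ℝ → V L} (hY : ContinuousOn Y (Ici 0)) (hY0 : Y 0 = u0) {t B : ℝ} (ht : 0 ≤ t)
    (h0 : ∀ s ∈ Icc 0 t, ‖Y s‖ ≤ B) (h1 : ‖Y1 t‖ ≤ B) :
    ‖PV (nem hp hR (fnV (Y t))) (-stress hp hR μ w Y Y1 t)‖
      ≤ (3 + 2 * ((p - 1) * R ^ (p - 2))) * B + ∫ s in Ioi (0 : ℝ), μ s * ‖w s‖ := by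
  set Λ := (p - 1) * R ^ (p - 2) with hΛ
  have hΛ0 : 0 ≤ Λ := mul_nonneg (by linarith) (Real.rpow_nonneg hR _)
  have hB : 0 ≤ B := (norm_nonneg _).trans h1
  have hd : ∀ s ∈ Icc 0 t, ‖dxV (Y s)‖ ≤ B := fun s hs => (norm_dxV_le _).trans (h0 s hs)
  have cY : ContinuousOn (fun t => dxV (Y t)) (Ici 0) := dxV.continuous.comp_continuousOn hY
  have pY := (hw.isPath2 (v := fun t => dxV (Y t)) (by rw [hY0]) cY).isPath hμ
  have b1 : ‖nem hp hR (fnV (Y t))‖ ≤ Λ * B := (norm_nem_le hp hR _).trans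
    (mul_le_mul_of_nonneg_left ((norm_fnV_le _).trans (h0 t (right_mem_Icc.2 ht))) hΛ0)
  have b2 : ‖nem hp hR (dxV (Y t))‖ ≤ Λ * B := (norm_nem_le hp hR _).trans
    (mul_le_mul_of_nonneg_left (hd t (right_mem_Icc.2 ht)) hΛ0)
  have b3 : ‖conv μ (glue w fun t => dxV (Y t)) t‖ ≤ B + ∫ s in Ioi (0 : ℝ), μ s * ‖w s‖ := by
    have e : ∫ s in Ioi (0 : ℝ), μ s * ‖w s‖
        = ∫ s in Ioi (0 : ℝ), μ s * ‖glue w (fun t => dxV (Y t)) (-s)‖ :=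
      setIntegral_congr_fun measurableSet_Ioi fun s hs => by simp only [glue_neg hs]
    rw [e]
    refine pY.norm_conv_le hμ hκ ht hB fun s hs => ?_
    rw [glue_of_nonneg (by rw [hw.zero, hY0]) hs.1]
    exact hd s hs
  have b4 : ‖dxV (Y1 t)‖ ≤ B := (norm_dxV_le _).trans h1
  have b5 := hd t (right_mem_Icc.2 ht)
  refine (norm_PV_le _ _).trans ?_
  rw [norm_neg, stress]
  have n1 := norm_add_le (dxV (Y t) + dxV (Y1 t) - conv μ (glue w fun t => dxV (Y t)) t)
    (nem hp hR (dxV (Y t)))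
  have n2 := norm_sub_le (dxV (Y t) + dxV (Y1 t)) (conv μ (glue w fun t => dxV (Y t)) t)
  have n3 := norm_add_le (dxV (Y t)) (dxV (Y1 t))
  linarith

theorem continuousOn_stress {p R : ℝ} (hp : 2 ≤ p) (hR : 0 ≤ R) {μ : ℝ → ℝ} (hμ : IsKernel μ)
    {w : ℝ → L2 L} {u0 : V L} (hw : PastOf μ w (dxV u0))
    {Y Y1 : ℝ → V L} (hY : Continuous Y) (hY1 : Continuous Y1) (hY0 : Y 0 = u0) :
    ContinuousOn (stress hp hR μ w Y Y1) (Ici 0) := by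
  have cY : Continuous (fun t => dxV (Y t)) := dxV.continuous.comp hY
  have pY := (hw.isPath2 (v := fun t => dxV (Y t)) (by rw [hY0]) cY.continuousOn).isPath hμ
  have c1 := pY.continuousOn_conv hμ
  have c3 : Continuous fun t => nem hp hR (dxV (Y t)) := (continuous_nem hp hR).comp cY
  have c4 : Continuous fun t => dxV (Y1 t) := dxV.continuous.comp hY1
  have c5 : ContinuousOn (fun t => dxV (Y t) + dxV (Y1 t)) (Ici 0) := (cY.add c4).continuousOn
  have c6 : ContinuousOn (fun t => dxV (Y t) + dxV (Y1 t)
      - conv μ (glue w fun t => dxV (Y t)) t) (Ici 0) := c5.sub c1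
  exact c6.add c3.continuousOn

theorem continuousOn_rhs {p R : ℝ} (hp : 2 ≤ p) (hR : 0 ≤ R) {μ : ℝ → ℝ} (hμ : IsKernel μ)
    {w : ℝ → L2 L} {u0 : V L} (hw : PastOf μ w (dxV u0))
    {Y Y1 : ℝ → V L} (hY : Continuous Y) (hY1 : Continuous Y1) (hY0 : Y 0 = u0) :
    ContinuousOn (fun t => PV (nem hp hR (fnV (Y t))) (-stress hp hR μ w Y Y1 t)) (Ici 0) := by
  have c2 : Continuous fun t => nem hp hR (fnV (Y t)) :=
    (continuous_nem hp hR).comp (fnV.continuous.comp hY)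
  have c5 : ContinuousOn (fun t => -stress hp hR μ w Y Y1 t) (Ici 0) :=
    (continuousOn_stress hp hR hμ hw hY hY1 hY0).neg
  have c6 : ContinuousOn (fun t => (nem hp hR (fnV (Y t)), -stress hp hR μ w Y Y1 t)) (Ici 0) :=
    c2.continuousOn.prodMk c5
  exact Continuous.comp_continuousOn (g := fun q : L2 L × L2 L => PV q.1 q.2)
    (f := fun t => (nem hp hR (fnV (Y t)), -stress hp hR μ w Y Y1 t)) continuous_PV c6

section Primitives

variable {X : Type*} [NormedAddCommGroup X] [NormedSpace ℝ X] [CompleteSpace X]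

/-- The path with initial value `x` and derivative `u`. -/
def path (x : X) (u : ℝ → X) (t : ℝ) : X := x + ∫ s in (0 : ℝ)..t, u s

set_option linter.unusedSectionVars false

theorem path_zero (x : X) (u : ℝ → X) : path x u 0 = x := by simp [path]

theorem hasDerivAt_path (x : X) {u : ℝ → X} (hu : Continuous u) (t : ℝ) :
    HasDerivAt (path x u) (u t) t :=
  ((hu.integral_hasStrictDerivAt 0 t).hasDerivAt).const_add x

theorem continuous_path (x : X) {u : ℝ → X} (hu : Continuous u) : Continuous (path x u) :=
  continuous_iff_continuousAt.2 fun t => (hasDerivAt_path x hu t).continuousAt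

theorem norm_path_sub_le (x : X) {u u' : ℝ → X} (hu : Continuous u) (hu' : Continuous u')
    {a M : ℝ} (ha : 1 ≤ a) (hM : 0 ≤ M)
    (h : ∀ s, 0 ≤ s → ‖u s - u' s‖ ≤ M * Real.exp (a * s)) (s : ℝ) (hs : 0 ≤ s) :
    ‖path x u s - path x u' s‖ ≤ M / a * Real.exp (a * s) := by
  rw [path, path, add_sub_add_left_eq_sub,
    ← intervalIntegral.integral_sub (hu.intervalIntegrable _ _) (hu'.intervalIntegrable _ _)]
  refine norm_integral_le_exp (by linarith) hM hs ?_
  filter_upwards [ae_restrict_mem measurableSet_Ioc] with r hr using h r hr.1.le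

theorem norm_path_const_le (x v : X) {t : ℝ} (ht : 0 ≤ t) :
    ‖path x (fun _ => v) t‖ ≤ (‖x‖ + ‖v‖) * Real.exp t := by
  have h1 := Real.add_one_le_exp t
  rw [path, intervalIntegral.integral_const, sub_zero]
  refine (norm_add_le _ _).trans ?_
  rw [norm_smul, Real.norm_of_nonneg ht, add_mul]
  refine add_le_add (le_mul_of_one_le_right (norm_nonneg _) (by linarith)) ?_
  rw [mul_comm]
  exact mul_le_mul_of_nonneg_left (by linarith) (norm_nonneg _)

end Primitives

/-- The unknown of the fixed point equation is the acceleration; velocity and position are recovered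
by integration, each of which gains a factor `1 / a` in the norm with weight `exp (a t)`. -/
theorem exists_truncSol {p R : ℝ} (hp : 2 ≤ p) (hR : 0 ≤ R) {μ : ℝ → ℝ} (hμ : IsKernel μ)
    (hκ : ∫ s in Ioi (0 : ℝ), μ s ≤ 1) {w : ℝ → L2 L} {u0 : V L} (hw : PastOf μ w (dxV u0))
    (u1 : V L) : ∃ Y Y1 Y2 : ℝ → V L, TruncSol hp hR μ w u0 u1 Y Y1 Y2 := by
  set C := 3 + 2 * ((p - 1) * R ^ (p - 2)) with hC
  have hC0 : 0 ≤ C := by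
    have : 0 ≤ (p - 1) * R ^ (p - 2) := mul_nonneg (by linarith) (Real.rpow_nonneg hR _)
    linarith
  set m := ∫ s in Ioi (0 : ℝ), μ s * ‖w s‖ with hm
  have hm0 : 0 ≤ m := setIntegral_nonneg measurableSet_Ioi fun s hs =>
    mul_nonneg (hμ.nonneg s (le_of_lt hs)) (norm_nonneg _)
  have c1 : ∀ u : ℝ → V L, Continuous u → Continuous (path u1 u) := fun u => continuous_path u1
  have c0 : ∀ u : ℝ → V L, Continuous u → Continuous (path u0 (path u1 u)) := fun u hu =>
    continuous_path u0 (c1 u hu)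
  have hlip : ∀ u u' : ℝ → V L, Continuous u → Continuous u' → ∀ a M, 1 ≤ a → 0 ≤ M →
      (∀ s, 0 ≤ s → ‖u s - u' s‖ ≤ M * Real.exp (a * s)) → ∀ t, 0 ≤ t →
      ‖PV (nem hp hR (fnV (path u0 (path u1 u) t)))
          (-stress hp hR μ w (path u0 (path u1 u)) (path u1 u) t)
        - PV (nem hp hR (fnV (path u0 (path u1 u') t)))
          (-stress hp hR μ w (path u0 (path u1 u')) (path u1 u') t)‖
      ≤ C / a * M * Real.exp (a * t) := by
    intro u u' hu hu' a M ha hM h t ht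
    have ha0 : 0 < a := by linarith
    have hMa : 0 ≤ M / a := by positivity
    have k1 := norm_path_sub_le u1 hu hu' ha hM h
    have k0 := norm_path_sub_le u0 (c1 u hu) (c1 u' hu') ha hMa k1
    have := norm_rhs_sub_le hp hR hμ hκ hw (Y1 := path u1 u) (Z1 := path u1 u')
      (c0 u hu).continuousOn (c0 u' hu').continuousOn (path_zero _ _) (path_zero _ _) ht
      (B := M / a * Real.exp (a * t)) (fun s hs => (k0 s hs.1).trans (by
        have h1 : Real.exp (a * s) ≤ Real.exp (a * t) :=
          Real.exp_le_exp.2 (mul_le_mul_of_nonneg_left hs.2 ha0.le)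
        exact mul_le_mul (div_le_self hMa ha) h1 (Real.exp_pos _).le hMa)) (k1 t ht)
    refine this.trans (le_of_eq ?_)
    rw [← hC]; ring
  have hzero : ∀ t, 0 ≤ t → ‖PV (nem hp hR (fnV (path u0 (path u1 0) t)))
      (-stress hp hR μ w (path u0 (path u1 0)) (path u1 0) t)‖
      ≤ (C * (‖u0‖ + ‖u1‖) + m) * Real.exp t := by
    intro t ht
    have e1 : path u1 (0 : ℝ → V L) = fun _ => u1 := by ext1 s; simp [path]
    rw [e1]
    have hone : 1 ≤ Real.exp t := Real.one_le_exp ht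
    have := norm_rhs_le hp hR hμ hκ hw (Y := path u0 fun _ => u1) (Y1 := fun _ => u1)
      (continuous_path u0 continuous_const).continuousOn (path_zero _ _) ht
      (B := (‖u0‖ + ‖u1‖) * Real.exp t) (fun s hs => (norm_path_const_le u0 u1 hs.1).trans
        (mul_le_mul_of_nonneg_left (Real.exp_le_exp.2 hs.2) (by positivity)))
      ((le_add_of_nonneg_left (norm_nonneg u0)).trans
        (le_mul_of_one_le_right (by positivity) hone))
    refine this.trans ?_
    rw [← hC, ← hm]
    nlinarith
  obtain ⟨u, hu, hfix⟩ := exists_fixed_path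
    (fun u t => PV (nem hp hR (fnV (path u0 (path u1 u) t)))
      (-stress hp hR μ w (path u0 (path u1 u)) (path u1 u) t))
    (fun u hu => continuousOn_rhs hp hR hμ hw (c0 u hu) (c1 u hu) (path_zero _ _)) hC0 hlip hzero
  exact ⟨_, _, u, hu, hasDerivAt_path u0 (c1 u hu), hasDerivAt_path u1 hu, path_zero _ _,
    path_zero _ _, hfix⟩

end Love

end

/-! ### The potential well, uniformly in the truncation level -/

noncomputable section

namespace Love

/-- Scalar potential well: a path whose energy stays below the barrier stays in the well. -/
theorem potential_well {p b E0 : ℝ} (hp : 2 ≤ p) (hb : 0 ≤ b)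
    (h : b * (2 * p / (p - 2) * E0) ^ ((p - 2) / 2) < 1) :
    ∃ θ, 0 ≤ θ ∧ θ < 1 ∧ ∀ x : ℝ → ℝ, ContinuousOn x (Ici 0) → (∀ t, 0 ≤ t → 0 ≤ x t) →
      (1 / 2 - 1 / p) * x 0 ^ 2 ≤ E0 →
      (∀ t, 0 ≤ t → 1 / 2 * x t ^ 2 - b / p * x t ^ p ≤ E0) →
      ∀ t, 0 ≤ t → b * x t ^ p ≤ θ * x t ^ 2 := by
  have hp0 : 0 < p := by linarith
  have split : ∀ y : ℝ, 0 ≤ y → y ^ p = (y ^ 2) ^ ((p - 2) / 2) * y ^ 2 := fun y hy => by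
    rw [← Real.rpow_natCast y 2, ← Real.rpow_mul hy]
    rcases hy.eq_or_lt with h0 | h0
    · rw [← h0]
      simp [hp0.ne']
    · rw [← Real.rpow_add h0]; congr 1; push_cast; ring
  -- For `p = 2` the quotient `2 p / (p - 2)` evaluates to zero and `0 ^ 0 = 1`, so the hypothesis
  -- says `b < 1` and `θ = b` works without a barrier.
  rcases hp.eq_or_lt with rfl | hp2
  · refine ⟨b, hb, by simpa using h, fun x _ _ _ _ t _ => le_of_eq ?_⟩
    rw [Real.rpow_two]
  have hq : 0 < (p - 2) / 2 := by linarith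
  have hcoef : 0 < 1 / 2 - 1 / p := by
    have : 1 / p < 1 / 2 := one_div_lt_one_div_of_lt two_pos hp2
    linarith
  -- For `p > 2` a negative `E0` contradicts the condition on the initial value.
  rcases lt_or_ge E0 0 with hE | hE
  · refine ⟨0, le_rfl, one_pos, fun x _ _ h0 _ t _ => ?_⟩
    exact absurd h0 (not_le.2 (hE.trans_le (by positivity)))
  set A := 2 * p / (p - 2) * E0 with hA
  have hA0 : 0 ≤ A := mul_nonneg (div_nonneg (by linarith) (by linarith)) hE
  have hAE : (1 / 2 - 1 / p) * A = E0 := by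
    have : p - 2 ≠ 0 := by linarith
    rw [hA]; field_simp
  have hc : ContinuousAt (fun a : ℝ => b * a ^ ((p - 2) / 2)) A :=
    (Real.continuousAt_rpow_const A _ (Or.inr hq.le)).const_mul b
  have hev := (hc.eventually (gt_mem_nhds h)).filter_mono (nhdsWithin_le_nhds (s := Ioi A))
  -- By continuity the strict smallness survives at some `A'` slightly above `A`. This room makes
  -- the barrier strict and gives `θ < 1`.
  obtain ⟨A', hA', hAA⟩ := (hev.and self_mem_nhdsWithin).exists
  have hAA' : A < A' := hAA
  have hA'0 : 0 < A' := hA0.trans_lt hAA'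
  refine ⟨b * A' ^ ((p - 2) / 2), by positivity, hA', fun x hx hnn h0 hE' t ht => ?_⟩
  -- At `x² = A'` the potential would be at least `(1/2 - 1/p) A'`, which exceeds `E0`. The path
  -- starts below this value, so by continuity it stays below.
  have hne : ∀ s, 0 ≤ s → x s ^ 2 ≠ A' := fun s hs heq => by
    have h1 := hE' s hs
    rw [split _ (hnn s hs), heq] at h1
    have h2 : b / p * (A' ^ ((p - 2) / 2) * A') ≤ 1 / p * A' := by
      have : b / p * (A' ^ ((p - 2) / 2) * A') = 1 / p * A' * (b * A' ^ ((p - 2) / 2)) := by ring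
      rw [this]
      exact mul_le_of_le_one_right (by positivity) hA'.le
    have h3 : (1 / 2 - 1 / p) * A < (1 / 2 - 1 / p) * A' := mul_lt_mul_of_pos_left hAA' hcoef
    linarith
  have hx0 : x 0 ^ 2 < A' := by
    have : (1 / 2 - 1 / p) * x 0 ^ 2 ≤ (1 / 2 - 1 / p) * A := by linarith
    exact (le_of_mul_le_mul_left this hcoef).trans_lt hAA'
  have hxt : x t ^ 2 < A' := by
    by_contra! hge
    have hcx : ContinuousOn (fun s => x s ^ 2) (Icc 0 t) :=
      (hx.mono Icc_subset_Ici_self).pow 2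
    obtain ⟨s, hs, hs'⟩ := intermediate_value_Icc ht hcx ⟨hx0.le, hge⟩
    exact hne s hs.1 hs'
  rw [split _ (hnn t ht), ← mul_assoc]
  gcongr

variable {L : ℝ}

theorem powInt_nonneg (p : ℝ) (u : L2 L) : 0 ≤ powInt p u :=
  integral_nonneg fun _ => Real.rpow_nonneg (abs_nonneg _) _

theorem powInt_le_of_abs_le (hL : 0 ≤ L) {p C : ℝ} (hp : 0 ≤ p) {u : L2 L}
    (h : ∀ᵐ x ∂om L, |u x| ≤ C) : powInt p u ≤ L * C ^ p := by
  rw [powInt]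
  have h1 : ∫ x in Ioo (0 : ℝ) L, |u x| ^ p ≤ ∫ x in Ioo (0 : ℝ) L, C ^ p := by
    refine integral_mono_of_nonneg (Eventually.of_forall fun x => by positivity)
      (integrable_const _) ?_
    filter_upwards [h] with x hx using Real.rpow_le_rpow (abs_nonneg _) hx hp
  simpa [hL] using h1

theorem integrable_rpow_of_abs_le {p C : ℝ} (hp : 0 ≤ p) {u : L2 L}
    (h : ∀ᵐ x ∂om L, |u x| ≤ C) : Integrable (fun x => |u x| ^ p) (om L) := by
  refine Integrable.of_bound (C := C ^ p) ?_ ?_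
  · exact ((Real.continuous_rpow_const hp).comp continuous_abs).comp_aestronglyMeasurable
      (Lp.aestronglyMeasurable u)
  · filter_upwards [h] with x hx
    rw [Real.norm_of_nonneg (by positivity)]
    exact Real.rpow_le_rpow (abs_nonneg _) hx hp

/-- The best constant is attained in the embedding inequality. -/
theorem powInt_le_poincare (hL : 0 < L) {p : ℝ} (hp : 2 ≤ p) (u : V L) :
    0 ≤ poincareConst L p ∧ powInt p (fnV u) ≤ poincareConst L p ^ p * ‖dxV u‖ ^ p := by
  have hp0 : 0 < p := by linarith
  set S := {C : ℝ | 0 ≤ C ∧ ∀ u : H10 L, powInt p u.1.1 ^ (1 / p) ≤ C * ‖u.1.2‖} with hS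
  have hne : S.Nonempty := by
    refine ⟨(L * √L ^ p) ^ (1 / p), by positivity, fun u => ?_⟩
    have h1 := powInt_le_of_abs_le hL.le hp0.le (fnV_abs_le hL.le (V.mk u.1 u.2))
    rw [fnV_mk, dxV_mk] at h1
    calc powInt p u.1.1 ^ (1 / p) ≤ (L * (√L * ‖u.1.2‖) ^ p) ^ (1 / p) :=
          Real.rpow_le_rpow (powInt_nonneg _ _) h1 (by positivity)
      _ = (L * √L ^ p) ^ (1 / p) * ‖u.1.2‖ := by
          rw [Real.mul_rpow (x := √L) (by positivity) (by positivity), ← mul_assoc,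
            Real.mul_rpow (x := L * √L ^ p) (by positivity) (by positivity),
            ← Real.rpow_mul (norm_nonneg _), mul_one_div_cancel hp0.ne', Real.rpow_one]
  have h0 : 0 ≤ poincareConst L p := Real.sInf_nonneg fun C hC => hC.1
  refine ⟨h0, ?_⟩
  have key : powInt p (fnV u) ^ (1 / p) ≤ poincareConst L p * ‖dxV u‖ := by
    -- When `u_x = 0` one cannot divide by its norm, but any admissible constant already forces the
    -- left side to vanish.
    rcases (norm_nonneg (dxV u)).eq_or_lt with h | h
    · obtain ⟨C, -, hC⟩ := hne
      have := hC ⟨_, V.pair_mem u⟩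
      simp only at this
      rw [← h, mul_zero] at this ⊢
      exact this
    · rw [← div_le_iff₀ h]
      refine le_csInf hne fun C hC => ?_
      rw [div_le_iff₀ h]
      exact hC.2 ⟨_, V.pair_mem u⟩
  have h2 := Real.rpow_le_rpow (Real.rpow_nonneg (powInt_nonneg _ _) _) key hp0.le
  rwa [← Real.rpow_mul (powInt_nonneg _ _), one_div_mul_cancel hp0.ne', Real.rpow_one,
    Real.mul_rpow h0 (norm_nonneg _)] at h2

section DampedTrunc

variable {p R : ℝ} {hp : 2 ≤ p} {hR : 0 ≤ R} {μ : ℝ → ℝ} {w : ℝ → L2 L} {u0 u1 : V L}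
  {Y Y1 Y2 : ℝ → V L}

theorem TruncSol.contY (S : TruncSol hp hR μ w u0 u1 Y Y1 Y2) : Continuous Y :=
  continuous_iff_continuousAt.2 fun t => (S.d0 t).continuousAt

theorem TruncSol.contY1 (S : TruncSol hp hR μ w u0 u1 Y Y1 Y2) : Continuous Y1 :=
  continuous_iff_continuousAt.2 fun t => (S.d1 t).continuousAt

theorem TruncSol.isPath2 (S : TruncSol hp hR μ w u0 u1 Y Y1 Y2) (hw : PastOf μ w (dxV u0)) :
    IsPath2 μ (glue w fun t => dxV (Y t)) :=
  hw.isPath2 (v := fun t => dxV (Y t)) (by rw [S.init0])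
    (dxV.continuous.comp S.contY).continuousOn

theorem TruncSol.glue_eq (S : TruncSol hp hR μ w u0 u1 Y Y1 Y2) (hw : PastOf μ w (dxV u0))
    {t : ℝ} (ht : 0 ≤ t) : glue w (fun t => dxV (Y t)) t = dxV (Y t) :=
  glue_of_nonneg (by rw [hw.zero, S.init0]) ht

theorem TruncSol.hasDerivAt_dx (S : TruncSol hp hR μ w u0 u1 Y Y1 Y2) (t : ℝ) :
    HasDerivAt (fun t => dxV (Y t)) (dxV (Y1 t)) t :=
  dxV.hasFDerivAt.comp_hasDerivAt t (S.d0 t)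

theorem TruncSol.hasDerivAt_dx1 (S : TruncSol hp hR μ w u0 u1 Y Y1 Y2) (t : ℝ) :
    HasDerivAt (fun t => dxV (Y1 t)) (dxV (Y2 t)) t :=
  dxV.hasFDerivAt.comp_hasDerivAt t (S.d1 t)

theorem TruncSol.hasDerivAt_fn (S : TruncSol hp hR μ w u0 u1 Y Y1 Y2) (t : ℝ) :
    HasDerivAt (fun t => fnV (Y t)) (fnV (Y1 t)) t :=
  fnV.hasFDerivAt.comp_hasDerivAt t (S.d0 t)

/-- The weak form of the truncated equation. -/
theorem TruncSol.weak (S : TruncSol hp hR μ w u0 u1 Y Y1 Y2) (hw : PastOf μ w (dxV u0))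
    (hμ : IsKernel μ) {l : ℝ} (hl : ∫ s in Ioi (0 : ℝ), μ s = 1 - l) {t : ℝ} (ht : 0 ≤ t)
    (φ : V L) :
    inner ℝ (Y2 t) φ + inner ℝ (dxV (Y1 t) + l • dxV (Y t)
        + memVec μ (glue w fun t => dxV (Y t)) t) (dxV φ)
      + (inner ℝ (nem hp hR (dxV (Y t))) (dxV φ) - inner ℝ (nem hp hR (fnV (Y t))) (fnV φ))
      = 0 := by
  rw [S.eq t ht, PV_inner, (S.isPath2 hw).memVec_eq hμ ht, S.glue_eq hw ht, hl, stress]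
  simp only [inner_neg_left, inner_add_left, inner_sub_left, real_inner_smul_left]
  ring

/-- The potential energy of the truncated nonlinearities. -/
def truncPot (p R : ℝ) (u : V L) : ℝ := nemInt p R (dxV u) - nemInt p R (fnV u)

/-- The nonlinear terms form the potential and there is no forcing. Writing the memory through
increments `ζ(t) - ζ(t-s)` turns the elastic coefficient `1` into `l`. -/
theorem TruncSol.damped (S : TruncSol hp hR μ w u0 u1 Y Y1 Y2) (hw : PastOf μ w (dxV u0))
    (hμ : IsKernel μ) {l : ℝ} (hl : ∫ s in Ioi (0 : ℝ), μ s = 1 - l) :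
    Damped μ l dxV (glue w fun t => dxV (Y t)) Y Y1 Y2 (fun _ => 0)
      (fun t => truncPot p R (Y t))
      (fun t => inner ℝ (nem hp hR (dxV (Y t))) (dxV (Y1 t))
        - inner ℝ (nem hp hR (fnV (Y t))) (fnV (Y1 t)))
      (fun t => inner ℝ (nem hp hR (dxV (Y t))) (dxV (Y t))
        - inner ℝ (nem hp hR (fnV (Y t))) (fnV (Y t))) where
  path := S.isPath2 hw
  eq t ht := S.glue_eq hw ht
  dz := S.d0
  dz1 := S.d1
  dΓ t := (hasDerivAt_nemInt hp hR (S.hasDerivAt_dx t)).sub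
    (hasDerivAt_nemInt hp hR (S.hasDerivAt_fn t))
  energy_eq t ht := by rw [S.weak hw hμ hl ht, inner_zero_left]
  virial_eq t ht := by rw [S.weak hw hμ hl ht, inner_zero_left]

end DampedTrunc

/-- The standing assumptions on the data. -/
structure Data (μ : ℝ → ℝ) (p : ℝ) (y₀ : ℝ → H10H2 L) (y₁ : H10H2 L) : Prop where
  pos : 0 < L
  two_le : 2 ≤ p
  ker : IsKernel μ
  ell_pos : 0 < ell μ
  meas : AEStronglyMeasurable y₀ (volume.restrict (Ioi 0))
  int : IntegrableOn (fun s => μ s * ‖y₀ s‖ ^ 2) (Ioi 0)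
  well : 0 ≤ I μ p (fun t => y₀ (-t)) 0
  small : poincareConst L p ^ p * ell μ ^ (1 - p / 2)
      * (2 * p / (p - 2) * energy μ p (fun t => y₀ (-t)) y₁ 0) ^ ((p - 2) / 2) < ell μ

section DataLemmas

variable {μ : ℝ → ℝ} {p : ℝ} {y₀ : ℝ → H10H2 L} {y₁ : H10H2 L}

theorem Data.integral_eq (_h : Data μ p y₀ y₁) : ∫ s in Ioi (0 : ℝ), μ s = 1 - ell μ := by
  simp [ell]

theorem Data.integral_le (h : Data μ p y₀ y₁) : ∫ s in Ioi (0 : ℝ), μ s ≤ 1 := by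
  linarith [h.integral_eq, h.ell_pos]

theorem Data.ell_le (h : Data μ p y₀ y₁) : ell μ ≤ 1 := by
  have : 0 ≤ ∫ s in Ioi (0 : ℝ), μ s := integral_nonneg_of_ae h.ker.ae_nonneg
  linarith [h.integral_eq]

theorem continuous_dx : Continuous (dx : H10H2 L → L2 L) :=
  continuous_fst.comp (continuous_snd.comp continuous_subtype_val)

theorem norm_dx_le (u : H10H2 L) : ‖dx u‖ ≤ ‖u‖ := (norm_fst_le u.1.2).trans (norm_snd_le u.1)

/-- The past of the derivative. -/
theorem Data.pastOf (h : Data μ p y₀ y₁) : PastOf μ (fun s => dx (y₀ s)) (dxV (toV (y₀ 0))) where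
  zero := rfl
  meas := continuous_dx.comp_aestronglyMeasurable h.meas
  int := by
    refine Integrable.mono h.int ?_ ?_
    · exact (h.ker.integrable.aestronglyMeasurable).mul
        ((continuous_dx.comp_aestronglyMeasurable h.meas).norm.pow 2)
    · filter_upwards [h.ker.ae_nonneg] with s hs
      rw [Real.norm_of_nonneg (by positivity), Real.norm_of_nonneg (by positivity)]
      gcongr
      exact norm_dx_le _

theorem memory_past_eq {v : ℝ → L2 L} (hv : dx (y₀ 0) = v 0) :
    memory μ (fun t => y₀ (-t)) 0 = mem μ (glue (fun s => dx (y₀ s)) v) 0 := by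
  rw [memory, mem]
  refine setIntegral_congr_fun measurableSet_Ioi fun s hs => ?_
  simp only [zero_sub, neg_neg, neg_zero, glue_neg hs, glue_of_nonneg (w := fun s => dx (y₀ s)) hv
    le_rfl, ← hv]

/-- The initial truncated energy is at most the energy of the data. -/
theorem Data.en_zero_le (h : Data μ p y₀ y₁) {R : ℝ} (hR : 0 ≤ R)
    (hR' : √L * ‖dx (y₀ 0)‖ ≤ R) {Y Y1 : ℝ → V L}
    (hY : Y 0 = toV (y₀ 0)) (hY1 : Y1 0 = toV y₁) :
    en μ (ell μ) dxV (glue (fun s => dx (y₀ s)) fun t => dxV (Y t)) Y Y1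
      (fun t => truncPot p R (Y t)) 0 ≤ energy μ p (fun t => y₀ (-t)) y₁ 0 := by
  have hp0 : 0 < p := by linarith [h.two_le]
  have hm := memory_past_eq (μ := μ) (y₀ := y₀) (v := fun t => dxV (Y t)) (by simp only [hY]; rfl)
  have b1 : nemInt p R (dx (y₀ 0)) ≤ 1 / p * powInt p (dx (y₀ 0)) := by
    rw [nemInt, powInt, ← integral_const_mul]
    refine integral_mono (integrable_truncPrim h.two_le hR _)
      ((integrable_rpow_of_abs_le hp0.le (dx_abs_le h.pos (y₀ 0))).const_mul _) fun x => ?_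
    have := truncPrim_le_rpow h.two_le hR (dx (y₀ 0) x)
    simp only
    rwa [one_div_mul_eq_div]
  -- This term enters the energy with a minus sign, so an upper bound would not do; the level `R`
  -- lies above the sup of the initial displacement, where the truncation is exact.
  have b2 : nemInt p R (fn (y₀ 0)) = 1 / p * powInt p (fn (y₀ 0)) := by
    rw [nemInt, powInt, ← integral_const_mul]
    refine integral_congr_ae ?_
    filter_upwards [fnV_abs_le h.pos.le (toV (y₀ 0))] with x hx
    rw [one_div_mul_eq_div, truncPrim_of_abs_le h.two_le]
    rw [fnV_toV, dxV_toV] at hx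
    exact hx.trans hR'
  have e1 : ‖Y1 0‖ ^ 2 = ‖fn y₁‖ ^ 2 + ‖dx y₁‖ ^ 2 := by rw [hY1, V.norm_sq_eq]; rfl
  have e2 : truncPot p R (Y 0) = nemInt p R (dx (y₀ 0)) - nemInt p R (fn (y₀ 0)) := by
    rw [truncPot, hY]; rfl
  have e3 : ‖dxV (Y 0)‖ = ‖dx (y₀ 0)‖ := by rw [hY]; rfl
  rw [en, kinPot, energy, J, hm, neg_zero, e1, e2, e3]
  linarith

/-- The small data assumption confines the solution to the potential well, uniformly in the
truncation parameter. -/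
theorem Data.exists_well (h : Data μ p y₀ y₁) : ∃ θ, 0 ≤ θ ∧ θ < 1 ∧
    ∀ (R : ℝ) (hR : 0 ≤ R), √L * ‖dx (y₀ 0)‖ ≤ R → ∀ Y Y1 Y2 : ℝ → V L,
      TruncSol h.two_le hR μ (fun s => dx (y₀ s)) (toV (y₀ 0)) (toV y₁) Y Y1 Y2 →
      ∀ t, 0 ≤ t → powInt p (fnV (Y t)) ≤ θ * (ell μ * ‖dxV (Y t)‖ ^ 2) ∧
        en μ (ell μ) dxV (glue (fun s => dx (y₀ s)) fun t => dxV (Y t)) Y Y1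
          (fun t => truncPot p R (Y t)) t ≤ energy μ p (fun t => y₀ (-t)) y₁ 0 := by
  have hp0 : 0 < p := by linarith [h.two_le]
  set l := ell μ with hl
  have hl0 : 0 < l := h.ell_pos
  set C := poincareConst L p with hC
  have hC0 : 0 ≤ C := (powInt_le_poincare h.pos h.two_le 0).1
  set E0 := energy μ p (fun t => y₀ (-t)) y₁ 0 with hE0
  -- The scalar well is used in the variable `x = √l ‖y_x‖`, for which the embedding inequality
  -- reads `∫ |y|^p ≤ b x^p` and the smallness condition is divided by `l`.
  set b := C ^ p * l ^ (-(p / 2)) with hb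
  have hb0 : 0 ≤ b := by positivity
  have hsmall : b * (2 * p / (p - 2) * E0) ^ ((p - 2) / 2) < 1 := by
    have h1 := h.small
    rw [show 1 - p / 2 = 1 + -(p / 2) by ring, Real.rpow_add hl0, Real.rpow_one] at h1
    have h2 : l * (b * (2 * p / (p - 2) * E0) ^ ((p - 2) / 2)) < l * 1 := by
      calc _ = C ^ p * (l * l ^ (-(p / 2))) * (2 * p / (p - 2) * E0) ^ ((p - 2) / 2) := by
            rw [hb]; ring
        _ < l := h1
        _ = l * 1 := (mul_one l).symm
    exact lt_of_mul_lt_mul_left h2 hl0.le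
  obtain ⟨θ, hθ0, hθ1, hθ⟩ := potential_well h.two_le hb0 hsmall
  refine ⟨θ, hθ0, hθ1, fun R hR hR' Y Y1 Y2 S => ?_⟩
  have hpow : ∀ u : V L, powInt p (fnV u) ≤ b * (√l * ‖dxV u‖) ^ p := fun u => by
    have h1 := (powInt_le_poincare h.pos h.two_le u).2
    have h2 : b * (√l * ‖dxV u‖) ^ p = C ^ p * ‖dxV u‖ ^ p := by
      rw [Real.mul_rpow (by positivity) (by positivity), Real.sqrt_eq_rpow,
        ← Real.rpow_mul hl0.le, hb]
      have : l ^ (-(p / 2)) * l ^ (1 / 2 * p) = 1 := by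
        rw [← Real.rpow_add hl0, show -(p / 2) + 1 / 2 * p = 0 by ring, Real.rpow_zero]
      calc _ = C ^ p * (l ^ (-(p / 2)) * l ^ (1 / 2 * p)) * ‖dxV u‖ ^ p := by ring
        _ = _ := by rw [this, mul_one]
    rw [h2]; exact h1
  have hsq : ∀ t, (√l * ‖dxV (Y t)‖) ^ 2 = l * ‖dxV (Y t)‖ ^ 2 := fun t => by
    rw [mul_pow, Real.sq_sqrt hl0.le]
  set ζ := glue (fun s => dx (y₀ s)) fun t => dxV (Y t) with hζ
  have hD := S.damped h.pastOf h.ker h.integral_eq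
  have hen : ∀ t, 0 ≤ t → en μ l dxV ζ Y Y1 (fun t => truncPot p R (Y t)) t ≤ E0 := fun t ht => by
    have h1 := hD.energy_le h.ker (K := 0) le_rfl ht (fun _ _ => by simp)
    have h2 := h.en_zero_le hR hR' (Y1 := Y1) S.init0 S.init1
    have h3 : 0 ≤ ∫ r in (0 : ℝ)..t, ‖dxV (Y1 r)‖ ^ 2 :=
      intervalIntegral.integral_nonneg ht fun _ _ => sq_nonneg _
    linarith
  have key := hθ (fun t => √l * ‖dxV (Y t)‖) ?_ (fun t _ => by positivity) ?_ ?_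
  · refine fun t ht => ⟨?_, hen t ht⟩
    have := key t ht
    simp only [hsq] at this
    exact (hpow _).trans this
  · exact (((dxV.continuous.comp S.contY).norm).const_mul _).continuousOn
  -- Subtracting `I / p ≥ 0` at time zero from the energy leaves `(1/2 - 1/p) l ‖y_x‖²` plus
  -- nonnegative terms: this is where membership in the stable set is used.
  · rw [hsq, S.init0, dxV_toV]
    have h1 := h.well
    simp only [I, neg_zero] at h1
    have h2 : 0 ≤ memory μ (fun t => y₀ (-t)) 0 :=
      setIntegral_nonneg measurableSet_Ioi fun s hs =>
        mul_nonneg (h.ker.nonneg s (le_of_lt hs)) (sq_nonneg _)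
    have h3 : E0 = 1 / 2 * ‖fn y₁‖ ^ 2 + 1 / 2 * ‖dx y₁‖ ^ 2 + (1 / 2 * (l * ‖dx (y₀ 0)‖ ^ 2)
      + 1 / 2 * memory μ (fun t => y₀ (-t)) 0 + 1 / p * powInt p (dx (y₀ 0))
      - 1 / p * powInt p (fn (y₀ 0))) := by simp only [hE0, energy, J, neg_zero, hl]
    have h4 : 1 / p ≤ 1 / 2 := one_div_le_one_div_of_le two_pos h.two_le
    have h5 : 0 ≤ 1 / p * (l * ‖dx (y₀ 0)‖ ^ 2 + memory μ (fun t => y₀ (-t)) 0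
      + powInt p (dx (y₀ 0)) - powInt p (fn (y₀ 0))) := mul_nonneg (by positivity) h1
    have h6 : 0 ≤ (1 / 2 - 1 / p) * memory μ (fun t => y₀ (-t)) 0 :=
      mul_nonneg (by linarith) h2
    nlinarith [sq_nonneg ‖fn y₁‖, sq_nonneg ‖dx y₁‖]
  · intro t ht
    have h1 := hen t ht
    have h2 := mem_nonneg (ζ := ζ) h.ker t
    have h3 : nemInt p R (fnV (Y t)) ≤ 1 / p * powInt p (fnV (Y t)) := by
      rw [nemInt, powInt, ← integral_const_mul]
      refine integral_mono (integrable_truncPrim h.two_le hR _)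
        ((integrable_rpow_of_abs_le hp0.le (fnV_abs_le h.pos.le _)).const_mul _) fun x => ?_
      have := truncPrim_le_rpow h.two_le hR (fnV (Y t) x)
      simp only
      rwa [one_div_mul_eq_div]
    have h4 : 1 / p * powInt p (fnV (Y t)) ≤ 1 / p * (b * (√l * ‖dxV (Y t)‖) ^ p) :=
      mul_le_mul_of_nonneg_left (hpow _) (by positivity)
    -- The stress potential has the good sign and is dropped, and the truncated source is at most
    -- the full power; this makes the well independent of `R`.
    have h5 := nemInt_nonneg (p := p) hR (dxV (Y t))
    simp only [en, kinPot, truncPot] at h1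
    simp only [hsq]
    have h6 : b / p * (√l * ‖dxV (Y t)‖) ^ p = 1 / p * (b * (√l * ‖dxV (Y t)‖) ^ p) := by ring
    rw [h6]
    nlinarith [sq_nonneg ‖Y1 t‖]

end DataLemmas

end Love

end

/-! ### Coercivity, decay of the energy, and the flux -/

noncomputable section

namespace Love

variable {L : ℝ} {μ : ℝ → ℝ} {p : ℝ} {y₀ : ℝ → H10H2 L} {y₁ : H10H2 L}

/-- Solutions of the truncated problem with given data. -/
abbrev Data.Sol (h : Data μ p y₀ y₁) {R : ℝ} (hR : 0 ≤ R) (Y Y1 Y2 : ℝ → V L) : Prop :=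
  TruncSol h.two_le hR μ (fun s => dx (y₀ s)) (toV (y₀ 0)) (toV y₁) Y Y1 Y2

/-- The trajectory of `y_x`, including the past. -/
def dxPath (y₀ : ℝ → H10H2 L) (Y : ℝ → V L) : ℝ → L2 L :=
  glue (fun s => dx (y₀ s)) fun t => dxV (Y t)

theorem truncPot_ge {R : ℝ} (hR : 0 ≤ R) (hL : 0 ≤ L) (hp : 2 ≤ p) {u : V L} {A : ℝ}
    (hu : powInt p (fnV u) ≤ A) : nemInt p R (dxV u) - 1 / 2 * A ≤ truncPot p R u := by
  have hp0 : 0 < p := by linarith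
  have h3 : nemInt p R (fnV u) ≤ 1 / p * powInt p (fnV u) := by
    rw [nemInt, powInt, ← integral_const_mul]
    refine integral_mono (integrable_truncPrim hp hR _)
      ((integrable_rpow_of_abs_le hp0.le (fnV_abs_le hL u)).const_mul _) fun x => ?_
    have := truncPrim_le_rpow hp hR (fnV u x)
    simp only
    rwa [one_div_mul_eq_div]
  have h4 : 1 / p ≤ 1 / 2 := one_div_le_one_div_of_le two_pos hp
  have h5 := mul_le_mul_of_nonneg_right h4 (powInt_nonneg p (fnV u))
  rw [truncPot]
  linarith

theorem inner_nem_self_le_powInt {R : ℝ} (hR : 0 ≤ R) (hL : 0 ≤ L) (hp : 2 ≤ p) (u : V L) :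
    inner ℝ (nem hp hR (fnV u)) (fnV u) ≤ powInt p (fnV u) := by
  rw [inner_nem, powInt]
  refine integral_mono (integrable_mul_nem hp hR _ _)
    (integrable_rpow_of_abs_le (by linarith) (fnV_abs_le hL u)) fun x => ?_
  simpa only [mul_comm] using mul_trunc_le hp hR (fnV u x)

theorem Data.damped (h : Data μ p y₀ y₁) {R : ℝ} {hR : 0 ≤ R} {Y Y1 Y2 : ℝ → V L}
    (S : h.Sol hR Y Y1 Y2) :
    Damped μ (ell μ) dxV (dxPath y₀ Y) Y Y1 Y2 (fun _ => 0)
      (fun t => truncPot p R (Y t))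
      (fun t => inner ℝ (nem h.two_le hR (dxV (Y t))) (dxV (Y1 t))
        - inner ℝ (nem h.two_le hR (fnV (Y t))) (fnV (Y1 t)))
      (fun t => inner ℝ (nem h.two_le hR (dxV (Y t))) (dxV (Y t))
        - inner ℝ (nem h.two_le hR (fnV (Y t))) (fnV (Y t))) :=
  S.damped h.pastOf h.ker h.integral_eq

/-- The energy of the truncated solution. -/
abbrev enV (μ : ℝ → ℝ) (p R : ℝ) (y₀ : ℝ → H10H2 L) (Y Y1 : ℝ → V L) : ℝ → ℝ :=
  en μ (ell μ) dxV (dxPath y₀ Y) Y Y1 (fun t => truncPot p R (Y t))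

/-- Coercivity and energy bound, uniform in the truncation parameter. -/
theorem Data.exists_coercive (h : Data μ p y₀ y₁) : ∃ c, 0 < c ∧ c ≤ 1 ∧ ∃ E, 0 ≤ E ∧
    ∀ (R : ℝ) (hR : 0 ≤ R), √L * ‖dx (y₀ 0)‖ ≤ R → ∀ Y Y1 Y2 : ℝ → V L, h.Sol hR Y Y1 Y2 →
      Coercive (ell μ) c dxV Y (fun t => truncPot p R (Y t))
        (fun t => inner ℝ (nem h.two_le hR (dxV (Y t))) (dxV (Y t))
          - inner ℝ (nem h.two_le hR (fnV (Y t))) (fnV (Y t))) ∧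
      ∀ t, 0 ≤ t → enV μ p R y₀ Y Y1 t ≤ E ∧ nemInt p R (dxV (Y t)) ≤ E := by
  obtain ⟨θ, hθ0, hθ1, hθ⟩ := h.exists_well
  have hl := h.ell_pos
  have hl1 := h.ell_le
  set l := ell μ with hldef
  set E0 := energy μ p (fun t => y₀ (-t)) y₁ 0 with hE0
  -- The source uses up at most the fraction `θ` of the elastic energy. The coercivity constant is
  -- the remaining part of `l / 2`; both conditions follow as `l ≤ 1`.
  refine ⟨(1 - θ) * (l / 2), by nlinarith, by nlinarith, max E0 0, le_max_right _ _,
    fun R hR hR' Y Y1 Y2 S => ?_⟩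
  have hw := hθ R hR hR' Y Y1 Y2 S
  have hlow : ∀ t, 0 ≤ t → nemInt p R (dxV (Y t)) - 1 / 2 * (θ * (l * ‖dxV (Y t)‖ ^ 2))
      ≤ truncPot p R (Y t) := fun t ht => truncPot_ge hR h.pos.le h.two_le (hw t ht).1
  refine ⟨⟨fun t ht => ?_, fun t ht => ?_⟩, fun t ht => ⟨(hw t ht).2.trans (le_max_left _ _), ?_⟩⟩
  · have h1 := hlow t ht
    have h2 := nemInt_nonneg (p := p) hR (dxV (Y t))
    linarith
  · have h1 : truncPot p R (Y t) ≤ nemInt p R (dxV (Y t)) := by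
      rw [truncPot]; linarith [nemInt_nonneg (p := p) hR (fnV (Y t))]
    have h2 := nemInt_le_inner h.two_le hR (dxV (Y t))
    have h3 := (inner_nem_self_le_powInt hR h.pos.le h.two_le (Y t)).trans (hw t ht).1
    have h4 := nemInt_nonneg (p := p) hR (dxV (Y t))
    set x := ‖dxV (Y t)‖ ^ 2 with hx
    have hx0 : 0 ≤ x := sq_nonneg _
    have hc1 : (1 - θ) * (l / 2) ≤ 1 := by nlinarith
    have hc2 : (1 - θ) * (l / 2) ≤ 1 - θ := by nlinarith
    have hlx : 0 ≤ l / 2 * x := by positivity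
    have e1 : (1 - θ) * (l / 2) * (l / 2 * x) ≤ (1 - θ) * (l / 2 * x) :=
      mul_le_mul_of_nonneg_right hc2 hlx
    have e2 : (1 - θ) * (l / 2) * truncPot p R (Y t) ≤ nemInt p R (dxV (Y t)) :=
      (mul_le_mul_of_nonneg_left h1 (by nlinarith)).trans (mul_le_of_le_one_left h4 hc1)
    have e3 : 0 ≤ (1 - θ) * (l / 2 * x) := by nlinarith
    nlinarith
  · have h1 := hlow t ht
    have h2 := (hw t ht).2
    have h3 := mem_nonneg (ζ := dxPath y₀ Y) h.ker t
    have h4 : enV μ p R y₀ Y Y1 t = 1 / 2 * ‖Y1 t‖ ^ 2 + (l / 2 * ‖dxV (Y t)‖ ^ 2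
      + truncPot p R (Y t)) + 1 / 2 * mem μ (dxPath y₀ Y) t := rfl
    have h5 : enV μ p R y₀ Y Y1 t ≤ E0 := h2
    refine le_trans ?_ (le_max_left _ _)
    have h6 : 0 ≤ (1 - θ) * (l * ‖dxV (Y t)‖ ^ 2) := mul_nonneg (by linarith) (by positivity)
    nlinarith [sq_nonneg ‖Y1 t‖]

theorem Data.poincare (h : Data μ p y₀ y₁) : 1 ≤ 1 + L ^ 2 ∧
    ∀ u : V L, ‖u‖ ^ 2 ≤ (1 + L ^ 2) * ‖dxV u‖ ^ 2 :=
  ⟨by nlinarith [sq_nonneg L], V.norm_sq_le h.pos.le⟩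

/-- A bounded energy that obeys the window estimate for every `ε` decays to zero. -/
theorem tendsto_zero_of_window {e k : ℝ → ℝ} {B : ℝ} (hB : 0 ≤ B) (he : ∀ t, 0 ≤ t → 0 ≤ e t)
    (hk : Tendsto k atTop (𝓝 0))
    (H : ∀ ε, 0 < ε → ∃ N C : ℝ, 0 ≤ C ∧ ∀ t, N ≤ t → e t ≤ ε * B + C * k (t - N)) :
    Tendsto e atTop (𝓝 0) := by
  rw [Metric.tendsto_atTop]
  intro ε hε
  obtain ⟨N, C, hC, hN⟩ := H (ε / (2 * (B + 1))) (by positivity)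
  have h1 : Tendsto (fun t => C * k (t - N)) atTop (𝓝 0) := by
    have := (hk.comp (tendsto_atTop_add_const_right _ (-N) tendsto_id)).const_mul C
    simpa [Function.comp_def, sub_eq_add_neg] using this
  obtain ⟨t0, ht0⟩ := (h1.eventually (gt_mem_nhds (half_pos hε))).exists_forall_of_atTop
  refine ⟨max (max N t0) 0, fun t ht => ?_⟩
  have a1 : N ≤ t := (le_max_left N t0).trans ((le_max_left _ _).trans ht)
  have a2 : t0 ≤ t := (le_max_right N t0).trans ((le_max_left _ _).trans ht)
  have a3 : 0 ≤ t := (le_max_right _ _).trans ht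
  rw [Real.dist_eq, sub_zero, abs_of_nonneg (he t a3)]
  have h2 := hN t a1
  have h3 := ht0 t a2
  have h4 : ε / (2 * (B + 1)) * B ≤ ε / 2 := by
    rw [div_mul_eq_mul_div, div_le_div_iff₀ (by positivity) two_pos]
    nlinarith
  linarith

/-- The energy of the truncated solution tends to zero. -/
theorem Data.tendsto_en (h : Data μ p y₀ y₁) {R : ℝ} {hR : 0 ≤ R} (hR' : √L * ‖dx (y₀ 0)‖ ≤ R)
    {Y Y1 Y2 : ℝ → V L} (S : h.Sol hR Y Y1 Y2) :
    Tendsto (enV μ p R y₀ Y Y1) atTop (𝓝 0) := by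
  obtain ⟨c, hc, hc1, E, hE, H⟩ := h.exists_coercive
  obtain ⟨hco, hen⟩ := H R hR hR' Y Y1 Y2 S
  refine tendsto_zero_of_window (k := fun t => hist μ (dxPath y₀ Y) t) (B := E) hE
    (fun t ht => hco.en_nonneg hc h.ker ht) ((h.damped S).path.tendsto_hist h.ker) fun ε hε => ?_
  obtain ⟨N, hN, C, hC, hwin⟩ := Damped.window (l := ell μ) (D := dxV (L := L)) h.ker h.integral_le
    hc hc1 h.poincare.1 h.poincare.2 hε
  refine ⟨N, C, hC, fun t ht => ?_⟩
  have := hwin _ _ _ _ _ _ _ _ (h.damped S) hco t E 0 ht (fun τ hτ => (hen τ hτ.1).1)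
    (fun τ _ => by simp)
  simpa using this

/-- The flux `y''_x + y_x + y'_x - ∫ μ(s) y_x(t-s) ds + g(y_x)`. -/
def flux {R : ℝ} (hp : 2 ≤ p) (hR : 0 ≤ R) (μ : ℝ → ℝ) (y₀ : ℝ → H10H2 L) (Y Y1 Y2 : ℝ → V L)
    (t : ℝ) : L2 L :=
  dxV (Y2 t) + stress hp hR μ (fun s => dx (y₀ s)) Y Y1 t

/-- Integrating the equation once in space: the flux is more regular than its individual terms. -/
theorem Data.flux_isWD (h : Data μ p y₀ y₁) {R : ℝ} {hR : 0 ≤ R} {Y Y1 Y2 : ℝ → V L}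
    (S : h.Sol hR Y Y1 Y2) {t : ℝ} (ht : 0 ≤ t) :
    IsWD (flux h.two_le hR μ y₀ Y Y1 Y2 t) (fnV (Y2 t) - nem h.two_le hR (fnV (Y t))) := by
  have := isWD_PV (nem h.two_le hR (fnV (Y t))) (-stress h.two_le hR μ (fun s => dx (y₀ s)) Y Y1 t)
  rwa [← S.eq t ht, sub_neg_eq_add] at this

theorem Data.stress_eq (h : Data μ p y₀ y₁) {R : ℝ} {hR : 0 ≤ R} {Y Y1 Y2 : ℝ → V L}
    (S : h.Sol hR Y Y1 Y2) {t : ℝ} (ht : 0 ≤ t) :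
    stress h.two_le hR μ (fun s => dx (y₀ s)) Y Y1 t
      = dxV (Y1 t) + ell μ • dxV (Y t) + memVec μ (dxPath y₀ Y) t
        + nem h.two_le hR (dxV (Y t)) := by
  rw [dxPath, (S.isPath2 h.pastOf).memVec_eq h.ker ht, S.glue_eq h.pastOf ht, h.integral_eq, stress,
    sub_smul, one_smul]
  abel

/-- Sup bound of the flux by the `H¹` energy. -/
theorem Data.flux_abs_le (h : Data μ p y₀ y₁) {R : ℝ} {hR : 0 ≤ R} {Y Y1 Y2 : ℝ → V L}
    (S : h.Sol hR Y Y1 Y2) {t : ℝ} (ht : 0 ≤ t) :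
    ∀ᵐ x ∂om L, |flux h.two_le hR μ y₀ Y Y1 Y2 t x| ≤
      (1 / L + 8 * L) * (√L * (‖Y1 t‖ + ‖dxV (Y t)‖ + √(mem μ (dxPath y₀ Y) t))
        + ∫ x in Ioo (0 : ℝ) L, |nem h.two_le hR (dxV (Y t)) x|)
      + 4 * √L * ‖nem h.two_le hR (fnV (Y t))‖ := by
  have hL := h.pos
  set a := dxV (Y1 t) + ell μ • dxV (Y t) + memVec μ (dxPath y₀ Y) t with ha
  set g := nem h.two_le hR (dxV (Y t)) with hg
  have hs := h.stress_eq S ht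
  have e1 : ‖a‖ ≤ ‖Y1 t‖ + ‖dxV (Y t)‖ + √(mem μ (dxPath y₀ Y) t) := by
    have h1 := norm_add_le (dxV (Y1 t) + ell μ • dxV (Y t)) (memVec μ (dxPath y₀ Y) t)
    have h2 := norm_add_le (dxV (Y1 t)) (ell μ • dxV (Y t))
    have h3 : ‖ell μ • dxV (Y t)‖ ≤ ‖dxV (Y t)‖ := by
      rw [norm_smul, Real.norm_of_nonneg h.ell_pos.le]
      exact mul_le_of_le_one_left (norm_nonneg _) h.ell_le
    have h4 : ‖memVec μ (dxPath y₀ Y) t‖ ≤ √(mem μ (dxPath y₀ Y) t) :=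
      Real.le_sqrt_of_sq_le ((h.damped S).path.norm_memVec_sq_le h.ker h.integral_le ht)
    linarith [norm_dxV_le (Y1 t)]
  have e2 : ∫ x in Ioo (0 : ℝ) L, |(-(a + g)) x| ≤ √L * ‖a‖ + ∫ x in Ioo (0 : ℝ) L, |g x| := by
    refine le_trans ?_ (add_le_add_left (L2.integral_abs_le hL.le a) _)
    rw [← integral_add (integrable_abs a) (integrable_abs g)]
    refine integral_mono_ae (integrable_abs _) ((integrable_abs a).add (integrable_abs g)) ?_
    filter_upwards [Lp.coeFn_neg (a + g), Lp.coeFn_add a g] with x h1 h2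
    rw [h1, Pi.neg_apply, h2, Pi.add_apply, abs_neg]
    exact abs_add_le _ _
  have key := Love.flux_abs_le hL (nem h.two_le hR (fnV (Y t)))
    (-stress h.two_le hR μ (fun s => dx (y₀ s)) Y Y1 t)
  rw [← S.eq t ht, sub_neg_eq_add] at key
  filter_upwards [key] with x hx
  refine hx.trans ?_
  rw [hs]
  gcongr
  exact e2.trans (by gcongr)

end Love

end

/-! ### Localization, and images of the equation under linear operators on `L²` -/

noncomputable section

namespace Love

variable {L : ℝ}

/-- A bounded linear operator on `L²(0,L)` from an action on functions. -/
def opL2 (F : L2 L → ℝ → ℝ) (hF : ∀ u, MemLp (F u) 2 (om L))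
    (hadd : ∀ u v, ∀ᵐ x ∂om L, F (u + v) x = F u x + F v x)
    (hsmul : ∀ (c : ℝ) u, ∀ᵐ x ∂om L, F (c • u) x = c * F u x) (C : ℝ)
    (hC : ∀ u, ‖(hF u).toLp‖ ≤ C * ‖u‖) : L2 L →L[ℝ] L2 L :=
  LinearMap.mkContinuous
    { toFun := fun u => (hF u).toLp
      map_add' := fun u v => L2.eq_of_ae (by
        filter_upwards [hadd u v, (hF u).coeFn_toLp, (hF v).coeFn_toLp, (hF (u + v)).coeFn_toLp,
          Lp.coeFn_add (hF u).toLp (hF v).toLp] with x h1 h2 h3 h4 h5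
        rw [h5, Pi.add_apply, h2, h3, h4, h1])
      map_smul' := fun c u => L2.eq_of_ae (by
        filter_upwards [hsmul c u, (hF u).coeFn_toLp, (hF (c • u)).coeFn_toLp,
          Lp.coeFn_smul c (hF u).toLp] with x h1 h2 h3 h4
        rw [RingHom.id_apply, h4, Pi.smul_apply, h2, h3, h1, smul_eq_mul]) } C hC

theorem coeFn_opL2 {F : L2 L → ℝ → ℝ} {hF : ∀ u, MemLp (F u) 2 (om L)}
    {hadd : ∀ u v, ∀ᵐ x ∂om L, F (u + v) x = F u x + F v x}
    {hsmul : ∀ (c : ℝ) u, ∀ᵐ x ∂om L, F (c • u) x = c * F u x} {C : ℝ}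
    {hC : ∀ u, ‖(hF u).toLp‖ ≤ C * ‖u‖} (u : L2 L) :
    ∀ᵐ x ∂om L, opL2 F hF hadd hsmul C hC u x = F u x :=
  (hF u).coeFn_toLp

/-- Multiplication by the indicator function of `K`. -/
def indL2 (K : Set ℝ) (hK : MeasurableSet K) : L2 L →L[ℝ] L2 L :=
  opL2 (fun u => K.indicator u) (fun u => (Lp.memLp u).indicator hK)
    (fun u v => by
      filter_upwards [Lp.coeFn_add u v] with x hx
      by_cases h : x ∈ K
      · rw [indicator_of_mem h, indicator_of_mem h, indicator_of_mem h, hx, Pi.add_apply]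
      · simp [h])
    (fun c u => by
      filter_upwards [Lp.coeFn_smul c u] with x hx
      by_cases h : x ∈ K
      · rw [indicator_of_mem h, indicator_of_mem h, hx, Pi.smul_apply, smul_eq_mul]
      · simp [h]) 1
    (fun u => by
      refine Lp.norm_le_mul_norm_of_ae_le_mul ?_
      filter_upwards [((Lp.memLp u).indicator hK).coeFn_toLp] with x hx
      rw [hx, one_mul]
      exact norm_indicator_le_norm_self _ _)

theorem coeFn_indL2 {K : Set ℝ} (hK : MeasurableSet K) (u : L2 L) :
    ∀ᵐ x ∂om L, indL2 K hK u x = K.indicator u x := coeFn_opL2 u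

theorem norm_indL2_sq {K : Set ℝ} (hK : MeasurableSet K) (u : L2 L) :
    ‖indL2 K hK u‖ ^ 2 = ∫ x in K, u x ^ 2 ∂om L := by
  rw [L2.norm_sq_eq, ← integral_indicator hK]
  refine integral_congr_ae ?_
  filter_upwards [coeFn_indL2 hK u] with x hx
  by_cases h : x ∈ K <;> simp [hx, h]

theorem norm_indL2_sq_le {K : Set ℝ} (hK : MeasurableSet K) {u : L2 L} {C : ℝ}
    (hC : ∀ᵐ x ∂om L, |u x| ≤ C) : ‖indL2 K hK u‖ ^ 2 ≤ C ^ 2 * (om L).real K := by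
  rw [norm_indL2_sq]
  have h1 : ∫ x in K, u x ^ 2 ∂om L ≤ ∫ x in K, C ^ 2 ∂om L := by
    refine integral_mono_ae (L2.integrable_sq u).integrableOn (integrable_const _) ?_
    refine ae_restrict_of_ae ?_
    filter_upwards [hC] with x hx
    rw [← sq_abs]
    exact pow_le_pow_left₀ (abs_nonneg _) hx 2
  rw [integral_const, smul_eq_mul, measureReal_restrict_apply_univ, mul_comm] at h1
  exact h1

theorem norm_indL2_le {K : Set ℝ} (hK : MeasurableSet K) {u : L2 L} {C : ℝ} (hC0 : 0 ≤ C)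
    (hC : ∀ᵐ x ∂om L, |u x| ≤ C) : ‖indL2 K hK u‖ ≤ C * √((om L).real K) := by
  have := norm_indL2_sq_le hK hC
  refine (sq_le_sq₀ (norm_nonneg _) (by positivity)).1 ?_
  rwa [mul_pow, Real.sq_sqrt measureReal_nonneg]

/-- Bounds of localized norms give pointwise bounds. -/
theorem abs_le_of_norm_indL2_sq_le {u : L2 L} {A : ℝ}
    (h : ∀ (K : Set ℝ) (hK : MeasurableSet K), ‖indL2 K hK u‖ ^ 2 ≤ A * (om L).real K) :
    ∀ᵐ x ∂om L, |u x| ≤ √A := by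
  have h1 : (fun x => u x ^ 2) ≤ᵐ[om L] fun _ => A := by
    refine ae_le_of_forall_setIntegral_le (L2.integrable_sq u) (integrable_const _) ?_
    intro K hK _
    rw [← norm_indL2_sq hK, integral_const, smul_eq_mul, measureReal_restrict_apply_univ, mul_comm]
    exact h K hK
  filter_upwards [h1] with x hx
  exact Real.abs_le_sqrt hx

/-- Superposition acts pointwise and fixes zero, so it commutes with localization. -/
theorem indL2_nem {p R : ℝ} (hp : 2 ≤ p) (hR : 0 ≤ R) {K : Set ℝ} (hK : MeasurableSet K)
    (u : L2 L) : indL2 K hK (nem hp hR u) = nem hp hR (indL2 K hK u) :=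
  L2.eq_of_ae (by
    filter_upwards [coeFn_indL2 hK (nem hp hR u), coeFn_indL2 hK u, coeFn_nem hp hR u,
      coeFn_nem hp hR (indL2 K hK u)] with x h1 h2 h3 h4
    rw [h1, h4, h2]
    by_cases h : x ∈ K <;> simp [h, h3])

section Transform

variable {μ : ℝ → ℝ} {p : ℝ} {y₀ : ℝ → H10H2 L} {y₁ : H10H2 L}

theorem IsPath2.map {F G : Type*} [NormedAddCommGroup F] [NormedSpace ℝ F] [NormedAddCommGroup G]
    [NormedSpace ℝ G] {μ : ℝ → ℝ} {φ : ℝ → F} (hμ : IsKernel μ) (h : IsPath2 μ φ) (T : F →L[ℝ] G) :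
    IsPath2 μ (fun t => T (φ t)) where
  cont := T.continuous.comp_continuousOn h.cont
  meas := T.continuous.comp_aestronglyMeasurable h.meas
  int := by
    refine (h.int.const_mul (‖T‖ ^ 2)).mono ?_ ?_
    · exact hμ.integrable.aestronglyMeasurable.mul
        ((T.continuous.comp_aestronglyMeasurable h.meas).norm.pow 2)
    · filter_upwards [hμ.ae_nonneg] with s hs
      rw [Real.norm_of_nonneg (by positivity), Real.norm_of_nonneg (by positivity)]
      have h1 := pow_le_pow_left₀ (norm_nonneg _) (T.le_opNorm (φ (-s))) 2
      rw [mul_pow] at h1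
      nlinarith

theorem conv_map {F G : Type*} [NormedAddCommGroup F] [NormedSpace ℝ F] [CompleteSpace F]
    [NormedAddCommGroup G] [NormedSpace ℝ G] [CompleteSpace G] {μ : ℝ → ℝ} {φ : ℝ → F}
    (hμ : IsKernel μ) (h : IsPath μ φ) (T : F →L[ℝ] G) {t : ℝ} (ht : 0 ≤ t) :
    conv μ (fun t => T (φ t)) t = T (conv μ φ t) := by
  rw [conv, conv, ← T.integral_comp_comm (h.integrable hμ ht)]
  simp only [map_smul]

theorem memVec_map {F G : Type*} [NormedAddCommGroup F] [InnerProductSpace ℝ F] [CompleteSpace F]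
    [NormedAddCommGroup G] [InnerProductSpace ℝ G] [CompleteSpace G] {μ : ℝ → ℝ} {φ : ℝ → F}
    (hμ : IsKernel μ) (h : IsPath2 μ φ) (T : F →L[ℝ] G) {t : ℝ} (ht : 0 ≤ t) :
    memVec μ (fun t => T (φ t)) t = T (memVec μ φ t) := by
  rw [(h.map hμ T).memVec_eq hμ ht, h.memVec_eq hμ ht, conv_map hμ (h.isPath hμ) T ht]
  simp only [map_sub, map_smul]

/-- The equation in `L²`. -/
theorem Data.eq_L2 (h : Data μ p y₀ y₁) {R : ℝ} {hR : 0 ≤ R} {Y Y1 Y2 : ℝ → V L}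
    (S : h.Sol hR Y Y1 Y2) {t : ℝ} (ht : 0 ≤ t) :
    dxV (Y2 t) + (dxV (Y1 t) + ell μ • dxV (Y t) + memVec μ (dxPath y₀ Y) t)
      = flux h.two_le hR μ y₀ Y Y1 Y2 t - nem h.two_le hR (dxV (Y t)) := by
  rw [flux, h.stress_eq S ht]
  abel

/-- A linear operator on `L²` maps the equation to a damped equation. -/
theorem Data.damped_map (h : Data μ p y₀ y₁) {R : ℝ} {hR : 0 ≤ R} {Y Y1 Y2 : ℝ → V L}
    (S : h.Sol hR Y Y1 Y2) (T : L2 L →L[ℝ] L2 L) {f : ℝ → L2 L} {Γ Γ' ν : ℝ → ℝ}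
    (dΓ : ∀ t, HasDerivAt Γ (Γ' t) t)
    (hf : ∀ t, 0 ≤ t → ∀ φ ∈ ({(T (dxV (Y1 t)), Γ' t), (T (dxV (Y t)), ν t)} : Set (L2 L × ℝ)),
      inner ℝ (T (nem h.two_le hR (dxV (Y t)))) φ.1 - φ.2
        = inner ℝ (T (flux h.two_le hR μ y₀ Y Y1 Y2 t) - f t) φ.1) :
    Damped μ (ell μ) (ContinuousLinearMap.id ℝ (L2 L)) (fun t => T (dxPath y₀ Y t))
      (fun t => T (dxV (Y t))) (fun t => T (dxV (Y1 t))) (fun t => T (dxV (Y2 t))) f Γ Γ' ν := by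
  have hP := (h.damped S).path
  have key : ∀ t, 0 ≤ t → T (dxV (Y2 t)) + (T (dxV (Y1 t)) + ell μ • T (dxV (Y t))
      + memVec μ (fun t => T (dxPath y₀ Y t)) t)
      = T (flux h.two_le hR μ y₀ Y Y1 Y2 t) - T (nem h.two_le hR (dxV (Y t))) := fun t ht => by
    rw [memVec_map h.ker hP T ht, ← map_sub, ← h.eq_L2 S ht]
    simp only [map_add, map_smul]
  -- Both tests of a damped equation have this shape: the first component is the test function
  -- (velocity or position), the second the corresponding pairing with the potential force.
  have main : ∀ t, 0 ≤ t → ∀ φ : L2 L × ℝ,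
      inner ℝ (T (nem h.two_le hR (dxV (Y t)))) φ.1 - φ.2
        = inner ℝ (T (flux h.two_le hR μ y₀ Y Y1 Y2 t) - f t) φ.1 →
      inner ℝ (T (dxV (Y2 t))) φ.1 + inner ℝ (T (dxV (Y1 t)) + ell μ • T (dxV (Y t))
        + memVec μ (fun t => T (dxPath y₀ Y t)) t) φ.1 + φ.2 = inner ℝ (f t) φ.1 := by
    intro t ht φ hφ
    rw [← inner_add_left, key t ht]
    rw [inner_sub_left] at hφ ⊢
    linarith
  exact
    { path := hP.map h.ker T
      eq := fun t ht => by
        have := (h.damped S).eq t ht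
        simp only [this, ContinuousLinearMap.id_apply]
      dz := fun t => T.hasFDerivAt.comp_hasDerivAt t (S.hasDerivAt_dx t)
      dz1 := fun t => T.hasFDerivAt.comp_hasDerivAt t (S.hasDerivAt_dx1 t)
      dΓ := dΓ
      energy_eq := fun t ht => main t ht (T (dxV (Y1 t)), Γ' t) (hf t ht _ (by simp))
      virial_eq := fun t ht => main t ht (T (dxV (Y t)), ν t) (hf t ht _ (by simp)) }

/-- The norms of the past as a path. -/
def pastNorm (y₀ : ℝ → H10H2 L) : ℝ → ℝ := glue (fun s => ‖y₀ s‖) fun _ => ‖y₀ 0‖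

theorem Data.isPath2_pastNorm (h : Data μ p y₀ y₁) : IsPath2 μ (pastNorm y₀) :=
  isPath2_glue rfl continuousOn_const h.meas.norm (by simpa using h.int)

theorem hist_pastNorm (t : ℝ) :
    hist μ (pastNorm y₀) t = ∫ s in Ioi (0 : ℝ), μ (t + s) * ‖y₀ s‖ ^ 2 :=
  setIntegral_congr_fun measurableSet_Ioi fun s hs => by
    simp only [pastNorm, glue_neg hs, norm_norm]

theorem Data.hist_map_le (h : Data μ p y₀ y₁) {Y : ℝ → V L} {T : L2 L →L[ℝ] L2 L} {a : ℝ}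
    (hT : ∀ u : H10H2 L, ‖T (dx u)‖ ≤ a * ‖u‖) {t : ℝ} (ht : 0 ≤ t) :
    hist μ (fun t => T (dxPath y₀ Y t)) t ≤ a ^ 2 * hist μ (pastNorm y₀) t := by
  rw [hist, hist_pastNorm, ← integral_const_mul]
  have i2 : IntegrableOn (fun s => μ (t + s) * ‖y₀ s‖ ^ 2) (Ioi 0) := by
    have := (h.isPath2_pastNorm.isPath_sq).shift_integrable h.ker ht
    refine this.congr_fun (fun s hs => ?_) measurableSet_Ioi
    simp [pastNorm, glue_neg hs]
  refine integral_mono_of_nonneg ?_ (i2.const_mul _) ?_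
  · filter_upwards [ae_restrict_mem measurableSet_Ioi] with s hs
    have hs' : (0 : ℝ) < s := hs
    exact mul_nonneg (h.ker.nonneg _ (by linarith)) (sq_nonneg _)
  · filter_upwards [ae_restrict_mem measurableSet_Ioi] with s hs
    have hs' : (0 : ℝ) < s := hs
    simp only [dxPath, glue_neg hs']
    have h1 := pow_le_pow_left₀ (norm_nonneg _) (hT (y₀ s)) 2
    have h2 := mul_le_mul_of_nonneg_left h1 (h.ker.nonneg (t + s) (by linarith))
    linarith

/-- The square of the operator constant `a` factors out of the initial memory energy: it is
proportional to the measure of `K` for localizations and to `r²` for differences. -/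
theorem Data.mem_map_zero_le (h : Data μ p y₀ y₁) {Y : ℝ → V L} (hY : Y 0 = toV (y₀ 0))
    {T : L2 L →L[ℝ] L2 L} {a : ℝ} (hT : ∀ u : H10H2 L, ‖T (dx u)‖ ≤ a * ‖u‖) :
    mem μ (fun t => T (dxPath y₀ Y t)) 0
      ≤ a ^ 2 * (2 * ‖y₀ 0‖ ^ 2 + 2 * hist μ (pastNorm y₀) 0) := by
  have e0 : dxPath y₀ Y 0 = dx (y₀ 0) := glue_of_nonneg (by simp only [hY]; rfl) le_rfl |>.trans (by
    simp only [hY]; rfl)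
  have i1 : IntegrableOn (fun s => a ^ 2 * (2 * (μ s * ‖y₀ 0‖ ^ 2) + 2 * (μ s * ‖y₀ s‖ ^ 2)))
      (Ioi 0) :=
    (((h.ker.integrable.mul_const _).const_mul 2).add (h.int.const_mul 2)).const_mul _
  have h1 : mem μ (fun t => T (dxPath y₀ Y t)) 0 ≤ ∫ s in Ioi (0 : ℝ),
      a ^ 2 * (2 * (μ s * ‖y₀ 0‖ ^ 2) + 2 * (μ s * ‖y₀ s‖ ^ 2)) := by
    refine integral_mono_of_nonneg ?_ i1 ?_
    · filter_upwards [h.ker.ae_nonneg] with s hs using mul_nonneg hs (sq_nonneg _)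
    · filter_upwards [h.ker.ae_nonneg, ae_restrict_mem measurableSet_Ioi] with s hs hs'
      simp only [zero_sub]
      rw [e0, show dxPath y₀ Y (-s) = dx (y₀ s) from glue_neg hs']
      have n1 := norm_sub_le (T (dx (y₀ 0))) (T (dx (y₀ s)))
      have n2 := hT (y₀ 0)
      have n3 := hT (y₀ s)
      have n4 : ‖T (dx (y₀ 0)) - T (dx (y₀ s))‖ ^ 2 ≤ (a * ‖y₀ 0‖ + a * ‖y₀ s‖) ^ 2 :=
        pow_le_pow_left₀ (norm_nonneg _) (by linarith) 2
      have n5 : (a * ‖y₀ 0‖ + a * ‖y₀ s‖) ^ 2 ≤ a ^ 2 * (2 * ‖y₀ 0‖ ^ 2 + 2 * ‖y₀ s‖ ^ 2) := by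
        nlinarith [sq_nonneg (a * ‖y₀ 0‖ - a * ‖y₀ s‖)]
      have n6 := mul_le_mul_of_nonneg_left (n4.trans n5) hs
      linarith
  refine h1.trans ?_
  rw [integral_const_mul, integral_add ((h.ker.integrable.mul_const _).const_mul 2)
    (h.int.const_mul 2), integral_const_mul, integral_const_mul, integral_mul_const,
    hist_pastNorm]
  simp only [zero_add]
  have h2 := mul_le_mul_of_nonneg_right h.integral_le (sq_nonneg ‖y₀ 0‖)
  refine mul_le_mul_of_nonneg_left ?_ (sq_nonneg a)
  linarith

end Transform

end Love

end

/-! ### Pointwise bounds and pointwise decay of `y_x` -/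

noncomputable section

namespace Love

variable {L : ℝ} {μ : ℝ → ℝ} {p : ℝ} {y₀ : ℝ → H10H2 L} {y₁ : H10H2 L}

theorem integral_abs_nem_le {R : ℝ} (hp : 2 ≤ p) (hR : 0 ≤ R) (hL : 0 ≤ L) (u : L2 L) :
    ∫ x in Ioo (0 : ℝ) L, |nem hp hR u x| ≤ L + 2 ^ p * nemInt p R u := by
  have e : L + 2 ^ p * nemInt p R u
      = ∫ x in Ioo (0 : ℝ) L, (1 + 2 ^ p * truncPrim p R (u x)) := by
    rw [integral_add (integrable_const _) ((integrable_truncPrim hp hR u).const_mul _),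
      integral_const_mul, nemInt]
    simp [hL]
  rw [e]
  refine integral_mono_ae (integrable_abs _)
    ((integrable_const _).add ((integrable_truncPrim hp hR u).const_mul _)) ?_
  filter_upwards [coeFn_nem hp hR u] with x hx
  rw [hx]
  exact abs_trunc_le_truncPrim hp hR (u x)

theorem norm_nem_le_of_abs_le {R C : ℝ} (hp : 2 ≤ p) (hR : 0 ≤ R) (hL : 0 ≤ L) {u : L2 L}
    (hu : ∀ᵐ x ∂om L, |u x| ≤ C) : ‖nem hp hR u‖ ≤ √L * C ^ (p - 1) := by
  refine L2.norm_le_of_abs_le hL ?_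
  filter_upwards [hu, coeFn_nem hp hR u] with x hx h2
  rw [h2]
  exact (abs_trunc_le hp hR _).trans (Real.rpow_le_rpow (abs_nonneg _) hx (by linarith))

/-- The flux is bounded in `L^∞`, uniformly in time and in the truncation parameter. -/
theorem Data.exists_flux_bound (h : Data μ p y₀ y₁) : ∃ Q, 0 ≤ Q ∧
    ∀ (R : ℝ) (hR : 0 ≤ R), √L * ‖dx (y₀ 0)‖ ≤ R → ∀ Y Y1 Y2 : ℝ → V L, h.Sol hR Y Y1 Y2 →
      ∀ t, 0 ≤ t → ∀ᵐ x ∂om L, |flux h.two_le hR μ y₀ Y Y1 Y2 t x| ≤ Q := by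
  obtain ⟨c, hc, -, E, hE, H⟩ := h.exists_coercive
  have hL := h.pos
  set A := √(2 * E) with hA
  set B := √(E / c) with hB
  refine ⟨(1 / L + 8 * L) * (√L * (A + B + A) + (L + 2 ^ p * E))
    + 4 * √L * (√L * (√L * B) ^ (p - 1)), by positivity, fun R hR hR' Y Y1 Y2 S t ht => ?_⟩
  obtain ⟨hco, hen⟩ := H R hR hR' Y Y1 Y2 S
  have h1 := hco.norm_sq_le (z1 := Y1) (μ := μ) (ζ := dxPath y₀ Y) ht
  have h2 := (hen t ht).1
  have h3 := mem_nonneg (ζ := dxPath y₀ Y) h.ker t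
  have h4 : 0 ≤ c * ‖dxV (Y t)‖ ^ 2 := by positivity
  have b1 : ‖Y1 t‖ ≤ A := Real.le_sqrt_of_sq_le (by linarith)
  have b2 : ‖dxV (Y t)‖ ≤ B := Real.le_sqrt_of_sq_le (by
    rw [le_div_iff₀ hc]; nlinarith [sq_nonneg ‖Y1 t‖])
  have b3 : √(mem μ (dxPath y₀ Y) t) ≤ A := Real.sqrt_le_sqrt (by nlinarith [sq_nonneg ‖Y1 t‖])
  -- Only the energy enters here, not the Lipschitz constant of the truncated power, so the bound
  -- does not depend on `R`.
  have b4 := (integral_abs_nem_le h.two_le hR hL.le (dxV (Y t))).trans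
    (add_le_add_right (mul_le_mul_of_nonneg_left (hen t ht).2 (by positivity)) L)
  have b5 : ‖nem h.two_le hR (fnV (Y t))‖ ≤ √L * (√L * B) ^ (p - 1) := by
    refine norm_nem_le_of_abs_le h.two_le hR hL.le ?_
    filter_upwards [fnV_abs_le hL.le (Y t)] with x hx
    exact hx.trans (by gcongr)
  filter_upwards [h.flux_abs_le S ht] with x hx
  refine hx.trans ?_
  gcongr

/-- The energy of the solution localized to `K`. -/
abbrev enK (μ : ℝ → ℝ) (p R : ℝ) (y₀ : ℝ → H10H2 L) (Y Y1 : ℝ → V L) (K : Set ℝ)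
    (hK : MeasurableSet K) : ℝ → ℝ :=
  en μ (ell μ) (ContinuousLinearMap.id ℝ (L2 L)) (fun t => indL2 K hK (dxPath y₀ Y t))
    (fun t => indL2 K hK (dxV (Y t))) (fun t => indL2 K hK (dxV (Y1 t)))
    (fun t => nemInt p R (indL2 K hK (dxV (Y t))))

/-- Multiplication by an indicator commutes with the power, so the nonlinear stress remains a
potential force and the localized flux is the only forcing. -/
theorem Data.damped_ind (h : Data μ p y₀ y₁) {R : ℝ} {hR : 0 ≤ R} {Y Y1 Y2 : ℝ → V L}
    (S : h.Sol hR Y Y1 Y2) (K : Set ℝ) (hK : MeasurableSet K) :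
    Damped μ (ell μ) (ContinuousLinearMap.id ℝ (L2 L)) (fun t => indL2 K hK (dxPath y₀ Y t))
      (fun t => indL2 K hK (dxV (Y t))) (fun t => indL2 K hK (dxV (Y1 t)))
      (fun t => indL2 K hK (dxV (Y2 t))) (fun t => indL2 K hK (flux h.two_le hR μ y₀ Y Y1 Y2 t))
      (fun t => nemInt p R (indL2 K hK (dxV (Y t))))
      (fun t => inner ℝ (nem h.two_le hR (indL2 K hK (dxV (Y t)))) (indL2 K hK (dxV (Y1 t))))
      (fun t => inner ℝ (nem h.two_le hR (indL2 K hK (dxV (Y t)))) (indL2 K hK (dxV (Y t)))) := by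
  refine h.damped_map S (indL2 K hK) (fun t => hasDerivAt_nemInt h.two_le hR
    ((indL2 K hK).hasFDerivAt.comp_hasDerivAt t (S.hasDerivAt_dx t))) fun t ht φ hφ => ?_
  rw [indL2_nem, sub_self, inner_zero_left]
  simp only [mem_insert_iff, mem_singleton_iff] at hφ
  rcases hφ with rfl | rfl <;> simp

/-- With the source hidden in the flux, only the stress potential is left. It has the good sign, so
no smallness is needed. -/
theorem Data.coercive_ind (h : Data μ p y₀ y₁) {R : ℝ} (hR : 0 ≤ R) (Y : ℝ → V L) (K : Set ℝ)
    (hK : MeasurableSet K) :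
    Coercive (ell μ) (ell μ / 2) (ContinuousLinearMap.id ℝ (L2 L))
      (fun t => indL2 K hK (dxV (Y t))) (fun t => nemInt p R (indL2 K hK (dxV (Y t))))
      (fun t => inner ℝ (nem h.two_le hR (indL2 K hK (dxV (Y t)))) (indL2 K hK (dxV (Y t)))) where
  lower t _ := by linarith [nemInt_nonneg (p := p) hR (indL2 K hK (dxV (Y t)))]
  virial t _ := by
    have h1 := nemInt_nonneg (p := p) hR (indL2 K hK (dxV (Y t)))
    have h2 := nemInt_le_inner h.two_le hR (indL2 K hK (dxV (Y t)))
    have h3 := h.ell_pos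
    have h4 := h.ell_le
    have h5 : 0 ≤ ell μ / 2 * ‖(ContinuousLinearMap.id ℝ (L2 L)) (indL2 K hK (dxV (Y t)))‖ ^ 2 := by
      positivity
    nlinarith

theorem norm_indL2_dx_le (hL : 0 < L) (K : Set ℝ) (hK : MeasurableSet K) (u : H10H2 L) :
    ‖indL2 K hK (dx u)‖ ≤ 2 * √L * √((om L).real K) * ‖u‖ := by
  have := norm_indL2_le hK (by positivity) (dx_abs_le hL u)
  linarith

theorem nemInt_indL2_le {R : ℝ} (hp : 2 ≤ p) (hR : 0 ≤ R) (K : Set ℝ) (hK : MeasurableSet K)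
    {u : L2 L} {C : ℝ} (hu : ∀ᵐ x ∂om L, |u x| ≤ C) :
    nemInt p R (indL2 K hK u) ≤ C ^ p * (om L).real K := by
  have e : C ^ p * (om L).real K = ∫ x in Ioo (0 : ℝ) L, K.indicator (fun _ => C ^ p) x := by
    rw [integral_indicator hK, integral_const, smul_eq_mul, measureReal_restrict_apply_univ,
      mul_comm]
  rw [e]
  refine integral_mono_ae (integrable_truncPrim hp hR _) ((integrable_const _).indicator hK) ?_
  filter_upwards [hu, coeFn_indL2 hK u] with x hx h2
  rw [h2]
  by_cases h : x ∈ K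
  · rw [indicator_of_mem h, indicator_of_mem h]
    have h1 := truncPrim_le_rpow hp hR (u x)
    have h3 : |u x| ^ p ≤ C ^ p := Real.rpow_le_rpow (abs_nonneg _) hx (by linarith)
    have h4 : |u x| ^ p / p ≤ |u x| ^ p := div_le_self (by positivity) (by linarith)
    linarith
  · rw [indicator_of_notMem h, indicator_of_notMem h]
    simp [truncPrim]

/-- Localized energy bounds, proportional to the measure of the set. -/
theorem Data.exists_enK_bound (h : Data μ p y₀ y₁) : ∃ A, 0 ≤ A ∧
    ∀ (R : ℝ) (hR : 0 ≤ R), √L * ‖dx (y₀ 0)‖ ≤ R → ∀ Y Y1 Y2 : ℝ → V L, h.Sol hR Y Y1 Y2 →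
      ∀ K hK t, 0 ≤ t → enK μ p R y₀ Y Y1 K hK t ≤ A * (om L).real K := by
  have hL := h.pos
  have hl := h.ell_pos
  have hl1 := h.ell_le
  obtain ⟨Q, hQ, hflux⟩ := h.exists_flux_bound
  obtain ⟨C, hC, η, hη, H⟩ := Damped.bounded (l := ell μ) (D := ContinuousLinearMap.id ℝ (L2 L))
    h.ker h.integral_le (c := ell μ / 2) (P := 1) (by positivity) (by linarith) le_rfl (by simp)
  set h0 := hist μ (pastNorm y₀) 0 with hh0
  have hh00 : 0 ≤ h0 := hist_nonneg h.ker le_rfl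
  set M := 2 * √L * ‖y₀ 0‖ with hM
  refine ⟨C * ((2 * L * ‖y₁‖ ^ 2 + 2 * L * ‖y₀ 0‖ ^ 2 + M ^ p
    + 4 * L * (‖y₀ 0‖ ^ 2 + h0)) + 4 * L * h0 + Q ^ 2), by positivity,
    fun R hR hR' Y Y1 Y2 S K hK t ht => ?_⟩
  set k := (om L).real K with hk
  have hk0 : 0 ≤ k := measureReal_nonneg
  set a := 2 * √L * √k with ha
  have ha2 : a ^ 2 = 4 * L * k := by
    rw [ha, mul_pow, mul_pow, Real.sq_sqrt hL.le, Real.sq_sqrt hk0]; ring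
  have hT : ∀ u : H10H2 L, ‖indL2 K hK (dx u)‖ ≤ a * ‖u‖ := norm_indL2_dx_le hL K hK
  -- A pointwise bound `Q` on the flux localizes to an `L²` bound `Q √k`, with `k` the measure of
  -- `K`; every contribution to the energy is then proportional to `k`.
  have h1 := H _ _ _ _ _ _ _ _ (h.damped_ind S K hK) (h.coercive_ind hR Y K hK) (Q * √k)
    (by positivity) (fun τ hτ => (norm_indL2_le hK hQ (hflux R hR hR' Y Y1 Y2 S τ hτ)).trans
      (le_add_of_nonneg_right (by positivity))) t ht
  refine h1.trans ?_
  rw [mul_assoc]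
  refine mul_le_mul_of_nonneg_left ?_ hC
  have b1 := h.hist_map_le (Y := Y) hT le_rfl
  have b2 := h.mem_map_zero_le (Y := Y) S.init0 hT
  have b3 : ‖indL2 K hK (dxV (Y 0))‖ ^ 2 ≤ a ^ 2 * ‖y₀ 0‖ ^ 2 := by
    rw [S.init0, dxV_toV, ← mul_pow]; exact pow_le_pow_left₀ (norm_nonneg _) (hT _) 2
  have b4 : ‖indL2 K hK (dxV (Y1 0))‖ ^ 2 ≤ a ^ 2 * ‖y₁‖ ^ 2 := by
    rw [S.init1, dxV_toV, ← mul_pow]; exact pow_le_pow_left₀ (norm_nonneg _) (hT _) 2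
  have b5 : nemInt p R (indL2 K hK (dxV (Y 0))) ≤ M ^ p * k := by
    rw [S.init0, dxV_toV]; exact nemInt_indL2_le h.two_le hR K hK (dx_abs_le hL (y₀ 0))
  have b6 : (Q * √k) ^ 2 = Q ^ 2 * k := by rw [mul_pow, Real.sq_sqrt hk0]
  rw [ha2] at b1 b2 b3 b4
  rw [b6, en, kinPot, ContinuousLinearMap.id_apply]
  have b7 : ell μ / 2 * ‖indL2 K hK (dxV (Y 0))‖ ^ 2 ≤ 1 / 2 * ‖indL2 K hK (dxV (Y 0))‖ ^ 2 :=
    mul_le_mul_of_nonneg_right (by linarith) (sq_nonneg _)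
  linarith

theorem Data.norm_indL2_sq_le_enK (h : Data μ p y₀ y₁) {R : ℝ} (hR : 0 ≤ R) (Y Y1 : ℝ → V L)
    (K : Set ℝ) (hK : MeasurableSet K) {t : ℝ} (ht : 0 ≤ t) :
    ell μ / 2 * ‖indL2 K hK (dxV (Y t))‖ ^ 2 ≤ enK μ p R y₀ Y Y1 K hK t := by
  have h1 := (h.coercive_ind hR Y K hK).norm_sq_le (μ := μ)
    (ζ := fun t => indL2 K hK (dxPath y₀ Y t)) (z1 := fun t => indL2 K hK (dxV (Y1 t))) ht
  have h2 := mem_nonneg (ζ := fun t => indL2 K hK (dxPath y₀ Y t)) h.ker t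
  simp only [ContinuousLinearMap.id_apply] at h1
  nlinarith [sq_nonneg ‖indL2 K hK (dxV (Y1 t))‖]

/-- A bound for the integral of `y_x²` over every `K` by a multiple of the measure of `K` is a bound
almost everywhere. -/
theorem Data.abs_le_of_enK (h : Data μ p y₀ y₁) {R : ℝ} (hR : 0 ≤ R) {Y Y1 : ℝ → V L} {A t : ℝ}
    (ht : 0 ≤ t) (H : ∀ K hK, enK μ p R y₀ Y Y1 K hK t ≤ A * (om L).real K) :
    ∀ᵐ x ∂om L, |dxV (Y t) x| ≤ √(2 / ell μ * A) := by
  have hl := h.ell_pos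
  refine abs_le_of_norm_indL2_sq_le fun K hK => ?_
  have h1 := (h.norm_indL2_sq_le_enK hR Y Y1 K hK ht).trans (H K hK)
  calc ‖indL2 K hK (dxV (Y t))‖ ^ 2 = 2 / ell μ * (ell μ / 2 * ‖indL2 K hK (dxV (Y t))‖ ^ 2) := by
        field_simp
    _ ≤ 2 / ell μ * (A * (om L).real K) := mul_le_mul_of_nonneg_left h1 (by positivity)
    _ = _ := by ring

/-- `y_x` is bounded, uniformly in time and in the truncation parameter. -/
theorem Data.exists_sup_bound (h : Data μ p y₀ y₁) : ∃ M, 0 ≤ M ∧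
    ∀ (R : ℝ) (hR : 0 ≤ R), √L * ‖dx (y₀ 0)‖ ≤ R → ∀ Y Y1 Y2 : ℝ → V L, h.Sol hR Y Y1 Y2 →
      ∀ t, 0 ≤ t → ∀ᵐ x ∂om L, |dxV (Y t) x| ≤ M := by
  obtain ⟨A, -, H⟩ := h.exists_enK_bound
  exact ⟨√(2 / ell μ * A), Real.sqrt_nonneg _, fun R hR hR' Y Y1 Y2 S t ht =>
    h.abs_le_of_enK hR ht fun K hK => H R hR hR' Y Y1 Y2 S K hK t ht⟩

/-- The flux tends to zero in `L^∞`. -/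
theorem Data.flux_small (h : Data μ p y₀ y₁) {R : ℝ} {hR : 0 ≤ R} (hR' : √L * ‖dx (y₀ 0)‖ ≤ R)
    {Y Y1 Y2 : ℝ → V L} (S : h.Sol hR Y Y1 Y2) {ρ : ℝ} (hρ : 0 < ρ) :
    ∃ t0, ∀ t, t0 ≤ t → ∀ᵐ x ∂om L, |flux h.two_le hR μ y₀ Y Y1 Y2 t x| ≤ ρ := by
  obtain ⟨c, hc, hc1, E, hE, H⟩ := h.exists_coercive
  obtain ⟨hco, -⟩ := H R hR hR' Y Y1 Y2 S
  have hL := h.pos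
  set Λ := (p - 1) * R ^ (p - 2) with hΛ
  have hΛ0 : 0 ≤ Λ := mul_nonneg (by linarith [h.two_le]) (Real.rpow_nonneg hR _)
  -- Since `R` is fixed here, the Lipschitz bound of the truncated power may be used, and every term
  -- in the flux bound is at most linear in the square root of the energy.
  set s : ℝ → ℝ := fun t => √(2 / c * enV μ p R y₀ Y Y1 t) with hs
  set D := (1 / L + 8 * L) * (√L * 3 + √L * Λ) + 4 * √L * (Λ * L) with hD
  have hlim : Tendsto (fun t => D * s t) atTop (𝓝 0) := by
    have h1 : Tendsto s atTop (𝓝 (√(2 / c * 0))) :=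
      (Real.continuous_sqrt.tendsto _).comp ((h.tendsto_en hR' S).const_mul _)
    have h2 := h1.const_mul D
    simpa using h2
  obtain ⟨t0, ht0⟩ := (hlim.eventually (gt_mem_nhds hρ)).exists_forall_of_atTop
  refine ⟨max t0 0, fun t ht => ?_⟩
  have ht' : 0 ≤ t := (le_max_right _ _).trans ht
  have h1 := hco.norm_sq_le (z1 := Y1) (μ := μ) (ζ := dxPath y₀ Y) ht'
  have h3 := mem_nonneg (ζ := dxPath y₀ Y) h.ker t
  have h4 : 0 ≤ c * ‖dxV (Y t)‖ ^ 2 := by positivity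
  set e := enV μ p R y₀ Y Y1 t with he
  have he0 : 0 ≤ e := by nlinarith [sq_nonneg ‖Y1 t‖]
  have h5 : 2 * e ≤ 2 / c * e := by
    refine mul_le_mul_of_nonneg_right ?_ he0
    rw [le_div_iff₀ hc]; linarith
  have b1 : ‖Y1 t‖ ≤ s t := Real.le_sqrt_of_sq_le (by linarith)
  have b2 : ‖dxV (Y t)‖ ≤ s t := Real.le_sqrt_of_sq_le (by
    rw [div_mul_eq_mul_div, le_div_iff₀ hc]; nlinarith [sq_nonneg ‖Y1 t‖])
  have b3 : √(mem μ (dxPath y₀ Y) t) ≤ s t := Real.sqrt_le_sqrt (by nlinarith [sq_nonneg ‖Y1 t‖])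
  have hs0 : 0 ≤ s t := Real.sqrt_nonneg _
  have b4 : ∫ x in Ioo (0 : ℝ) L, |nem h.two_le hR (dxV (Y t)) x| ≤ √L * (Λ * s t) :=
    (L2.integral_abs_le hL.le _).trans (by
      gcongr; exact (norm_nem_le h.two_le hR _).trans (by gcongr))
  have b5 : ‖nem h.two_le hR (fnV (Y t))‖ ≤ Λ * (L * s t) :=
    (norm_nem_le h.two_le hR _).trans (by
      rw [← hΛ]; gcongr; exact (norm_fnV_le_dxV hL.le _).trans (by gcongr))
  filter_upwards [h.flux_abs_le S ht'] with x hx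
  refine (hx.trans ?_).trans (ht0 t ((le_max_left _ _).trans ht)).le
  calc _ ≤ (1 / L + 8 * L) * (√L * (s t + s t + s t) + √L * (Λ * s t))
        + 4 * √L * (Λ * (L * s t)) := by gcongr
    _ = D * s t := by rw [hD]; ring

/-- `y_x` tends to zero in `L^∞`. -/
theorem Data.dx_small (h : Data μ p y₀ y₁) {R : ℝ} {hR : 0 ≤ R} (hR' : √L * ‖dx (y₀ 0)‖ ≤ R)
    {Y Y1 Y2 : ℝ → V L} (S : h.Sol hR Y Y1 Y2) {r : ℝ} (hr : 0 < r) :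
    ∃ t0, ∀ t, t0 ≤ t → ∀ᵐ x ∂om L, |dxV (Y t) x| ≤ r := by
  have hL := h.pos
  have hl := h.ell_pos
  have hl1 := h.ell_le
  obtain ⟨A, hA, H⟩ := h.exists_enK_bound
  -- The localized energy per unit measure that corresponds to `|y_x| ≤ r`. One third each goes to
  -- the previous energy bound, the history and the flux, and the threshold in time is the same for
  -- all `K`.
  set δ := ell μ / 2 * r ^ 2 with hδ
  have hδ0 : 0 < δ := by positivity
  obtain ⟨N, hN, C, hC, hwin⟩ := Damped.window (l := ell μ) (D := ContinuousLinearMap.id ℝ (L2 L))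
    h.ker h.integral_le (c := ell μ / 2) (P := 1) (by positivity) (by linarith) le_rfl (by simp)
    (ε := δ / (3 * (A + 1))) (by positivity)
  set ρ := √(δ / (3 * (C + 1))) with hρ
  have hρ0 : 0 < ρ := Real.sqrt_pos.2 (by positivity)
  have hρ2 : ρ ^ 2 = δ / (3 * (C + 1)) := Real.sq_sqrt (by positivity)
  obtain ⟨t1, ht1⟩ := h.flux_small hR' S hρ0
  have hlim : Tendsto (fun t => C * (4 * L * hist μ (pastNorm y₀) (t - N))) atTop (𝓝 0) := by
    have h1 := (((h.isPath2_pastNorm.tendsto_hist h.ker).comp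
      (tendsto_atTop_add_const_right _ (-N) tendsto_id)).const_mul (4 * L)).const_mul C
    simpa [Function.comp_def, sub_eq_add_neg] using h1
  obtain ⟨t2, ht2⟩ := (hlim.eventually (gt_mem_nhds (show 0 < δ / 3 by positivity))).exists_forall_of_atTop
  refine ⟨max (max (t1 + N) t2) N, fun t ht => ?_⟩
  have a1 : t1 + N ≤ t := (le_max_left _ t2).trans ((le_max_left _ _).trans ht)
  have a2 : t2 ≤ t := (le_max_right (t1 + N) _).trans ((le_max_left _ _).trans ht)
  have a3 : N ≤ t := (le_max_right _ _).trans ht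
  have a4 : 0 ≤ t := hN.le.trans a3
  have key := h.abs_le_of_enK hR (Y := Y) (Y1 := Y1) (A := δ) a4 fun K hK => by
    set k := (om L).real K with hk
    have hk0 : 0 ≤ k := measureReal_nonneg
    have h1 := hwin _ _ _ _ _ _ _ _ (h.damped_ind S K hK) (h.coercive_ind hR Y K hK) t (A * k)
      (ρ * √k) a3 (fun τ hτ => H R hR hR' Y Y1 Y2 S K hK τ hτ.1)
      (fun τ hτ => norm_indL2_le hK hρ0.le (ht1 τ (by linarith [hτ.1])))
    have h2 := h.hist_map_le (Y := Y) (norm_indL2_dx_le hL K hK) (sub_nonneg.2 a3)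
    have ha2 : (2 * √L * √k) ^ 2 = 4 * L * k := by
      rw [mul_pow, mul_pow, Real.sq_sqrt hL.le, Real.sq_sqrt hk0]; ring
    rw [ha2] at h2
    have h3 := mul_le_mul_of_nonneg_right (ht2 t a2).le hk0
    have h4 := mul_le_mul_of_nonneg_left h2 hC
    have h5 : (ρ * √k) ^ 2 = δ / (3 * (C + 1)) * k := by
      rw [mul_pow, Real.sq_sqrt hk0, hρ2]
    rw [h5] at h1
    have h6 : δ / (3 * (A + 1)) * A ≤ δ / 3 := by
      rw [div_mul_eq_mul_div, div_le_div_iff₀ (by positivity) (by norm_num)]; nlinarith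
    have h7 : C * (δ / (3 * (C + 1))) ≤ δ / 3 := by
      rw [mul_div_assoc', div_le_div_iff₀ (by positivity) (by norm_num)]; nlinarith
    have h8 := mul_le_mul_of_nonneg_right h6 hk0
    have h9 := mul_le_mul_of_nonneg_right h7 hk0
    refine h1.trans ?_
    linarith
  have e : √(2 / ell μ * δ) = r := by
    rw [hδ, show 2 / ell μ * (ell μ / 2 * r ^ 2) = r ^ 2 by field_simp, Real.sqrt_sq hr.le]
  rwa [e] at key

end Love

end

/-! ### Difference operators and weak derivatives -/

noncomputable section

namespace Love

variable {L : ℝ}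

/-- Extension by zero. -/
def ext0 (u : L2 L) : ℝ → ℝ := (Ioo (0 : ℝ) L).indicator u

theorem ext0_of_mem (u : L2 L) {x : ℝ} (hx : x ∈ Ioo 0 L) : ext0 u x = u x := indicator_of_mem hx _

theorem memLp_ext0 (u : L2 L) : MemLp (ext0 u) 2 volume :=
  (memLp_indicator_iff_restrict measurableSet_Ioo).2 (Lp.memLp u)

theorem integrable_ext0 (u : L2 L) : Integrable (ext0 u) := L2.integrable_indicator u

theorem integral_ext0_sq (u : L2 L) : ∫ x, ext0 u x ^ 2 = ‖u‖ ^ 2 := by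
  rw [L2.norm_sq_eq, ← integral_indicator measurableSet_Ioo]
  congr 1; ext x
  by_cases hx : x ∈ Ioo 0 L <;> simp [ext0, hx]

theorem integrable_ext0_sq (u : L2 L) : Integrable fun x => ext0 u x ^ 2 := (memLp_ext0 u).integrable_sq

/-- The points of `(0,L)` that stay in `(0,L)` when translated by `h`. -/
def core (L h : ℝ) : Set ℝ := Ioo 0 L ∩ (fun x => x + h) ⁻¹' Ioo 0 L

theorem measurableSet_core (h : ℝ) : MeasurableSet (core L h) :=
  measurableSet_Ioo.inter ((measurable_id.add_const h) measurableSet_Ioo)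

theorem ae_shift {P : ℝ → Prop} (hP : ∀ᵐ x ∂om L, P x) (h : ℝ) :
    ∀ᵐ x ∂om L, x ∈ core L h → P (x + h) := by
  have h1 := (measurePreserving_add_right volume h).quasiMeasurePreserving.ae
    ((ae_restrict_iff' measurableSet_Ioo).1 hP)
  refine ae_restrict_of_ae ?_
  filter_upwards [h1] with x hx hm using hx hm.2

/-- The difference `u(x+h) - u(x)`, cut off to where it makes sense. -/
def diffFun (h : ℝ) (u : L2 L) : ℝ → ℝ :=
  (core L h).indicator fun x => ext0 u (x + h) - ext0 u x

theorem diffFun_of_mem {h : ℝ} (u : L2 L) {x : ℝ} (hx : x ∈ core L h) :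
    diffFun h u x = u (x + h) - u x := by
  rw [diffFun, indicator_of_mem hx, ext0_of_mem u hx.1, ext0_of_mem u hx.2]

theorem memLp_diffFun (h : ℝ) (u : L2 L) : MemLp (diffFun h u) 2 (om L) := by
  have h1 : MemLp (fun x => ext0 u (x + h)) 2 volume :=
    (memLp_ext0 u).comp_measurePreserving (measurePreserving_add_right volume h)
  exact ((h1.sub (memLp_ext0 u)).indicator (measurableSet_core h)).mono_measure
    Measure.restrict_le_self

theorem integral_diffFun_sq_le (h : ℝ) (u : L2 L) :
    ∫ x in Ioo (0 : ℝ) L, diffFun h u x ^ 2 ≤ (2 * ‖u‖) ^ 2 := by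
  have i1 : Integrable fun x => ext0 u (x + h) ^ 2 := (integrable_ext0_sq u).comp_add_right h
  have e1 : ∫ x, ext0 u (x + h) ^ 2 = ‖u‖ ^ 2 := by
    rw [integral_add_right_eq_self (fun x => ext0 u x ^ 2), integral_ext0_sq]
  have i2 : Integrable fun x => 2 * ext0 u (x + h) ^ 2 + 2 * ext0 u x ^ 2 :=
    (i1.const_mul 2).add ((integrable_ext0_sq u).const_mul 2)
  calc ∫ x in Ioo (0 : ℝ) L, diffFun h u x ^ 2
      ≤ ∫ x in Ioo (0 : ℝ) L, (2 * ext0 u (x + h) ^ 2 + 2 * ext0 u x ^ 2) := by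
        refine integral_mono (memLp_diffFun h u).integrable_sq i2.integrableOn fun x => ?_
        simp only [diffFun]
        by_cases hx : x ∈ core L h
        · rw [indicator_of_mem hx]; nlinarith [sq_nonneg (ext0 u (x + h) + ext0 u x)]
        · rw [indicator_of_notMem hx]
          nlinarith [sq_nonneg (ext0 u (x + h)), sq_nonneg (ext0 u x)]
    _ ≤ ∫ x, (2 * ext0 u (x + h) ^ 2 + 2 * ext0 u x ^ 2) :=
        setIntegral_le_integral i2 (Eventually.of_forall fun x => by
          simp only [Pi.zero_apply]; positivity)
    _ = (2 * ‖u‖) ^ 2 := by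
        rw [integral_add (i1.const_mul 2) ((integrable_ext0_sq u).const_mul 2), integral_const_mul,
          integral_const_mul, e1, integral_ext0_sq]
        ring

theorem norm_toLp_sq {F : ℝ → ℝ} (hF : MemLp F 2 (om L)) :
    ‖hF.toLp‖ ^ 2 = ∫ x in Ioo (0 : ℝ) L, F x ^ 2 := by
  rw [L2.norm_sq_eq]
  refine integral_congr_ae ?_
  filter_upwards [hF.coeFn_toLp] with x hx
  rw [hx]

/-- The difference operator on `L²(0,L)`. -/
def diffL2 (h : ℝ) : L2 L →L[ℝ] L2 L :=
  opL2 (diffFun h) (memLp_diffFun h)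
    (fun u v => by
      filter_upwards [Lp.coeFn_add u v, ae_shift (Lp.coeFn_add u v) h] with x h1 h2
      by_cases hx : x ∈ core L h
      · rw [diffFun_of_mem _ hx, diffFun_of_mem _ hx, diffFun_of_mem _ hx, h1, h2 hx, Pi.add_apply,
          Pi.add_apply]
        ring
      · simp [diffFun, hx])
    (fun c u => by
      filter_upwards [Lp.coeFn_smul c u, ae_shift (Lp.coeFn_smul c u) h] with x h1 h2
      by_cases hx : x ∈ core L h
      · rw [diffFun_of_mem _ hx, diffFun_of_mem _ hx, h1, h2 hx, Pi.smul_apply, Pi.smul_apply,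
          smul_eq_mul, smul_eq_mul]
        ring
      · simp [diffFun, hx]) 2
    (fun u => (sq_le_sq₀ (norm_nonneg _) (by positivity)).1 (by
      rw [norm_toLp_sq]; exact integral_diffFun_sq_le h u))

theorem coeFn_diffL2 (h : ℝ) (u : L2 L) : ∀ᵐ x ∂om L, diffL2 h u x = diffFun h u x := coeFn_opL2 u

theorem norm_diffL2_sq (h : ℝ) (u : L2 L) :
    ‖diffL2 h u‖ ^ 2 = ∫ x in Ioo (0 : ℝ) L, diffFun h u x ^ 2 :=
  norm_toLp_sq (memLp_diffFun h u)

/-- The predicate `P` lets the same estimate serve for the global Lipschitz bound and for the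
near-linear regime of small arguments. -/
theorem norm_diffL2_nem_le {p R : ℝ} (hp : 2 ≤ p) (hR : 0 ≤ R) {P : ℝ → Prop} {γ η : ℝ}
    (hP : ∀ a b, P a → P b → |trunc p R b - trunc p R a - γ * (b - a)| ≤ η * |b - a|)
    {u : L2 L} (hu : ∀ᵐ x ∂om L, P (u x)) (h : ℝ) :
    ‖diffL2 h (nem hp hR u) - γ • diffL2 h u‖ ≤ η * ‖diffL2 h u‖ := by
  refine Lp.norm_le_mul_norm_of_ae_le_mul ?_
  filter_upwards [coeFn_diffL2 h u, coeFn_diffL2 h (nem hp hR u), hu, ae_shift hu h,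
    coeFn_nem hp hR u, ae_shift (coeFn_nem hp hR u) h,
    Lp.coeFn_sub (diffL2 h (nem hp hR u)) (γ • diffL2 h u), Lp.coeFn_smul γ (diffL2 h u)]
    with x h1 h2 h3 h4 h5 h6 h7 h8
  rw [h7, Pi.sub_apply, h8, Pi.smul_apply, h1, h2, smul_eq_mul, Real.norm_eq_abs, Real.norm_eq_abs]
  by_cases hx : x ∈ core L h
  · rw [diffFun_of_mem _ hx, diffFun_of_mem _ hx, h5, h6 hx]
    exact hP _ _ h3 (h4 hx)
  · simp [diffFun, hx]

theorem sq_intervalIntegral_le_of_integrable {f : ℝ → ℝ} {a h : ℝ} (hh : 0 < h)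
    (h1 : IntervalIntegrable f volume a (a + h))
    (h2 : IntervalIntegrable (fun s => f s ^ 2) volume a (a + h)) :
    (∫ s in a..(a + h), f s) ^ 2 ≤ h * ∫ s in a..(a + h), f s ^ 2 := by
  set I := ∫ s in a..(a + h), f s with hI
  have h3 : 0 ≤ ∫ s in a..(a + h), (f s - I / h) ^ 2 :=
    intervalIntegral.integral_nonneg (by linarith) fun _ _ => sq_nonneg _
  have h4 : ∫ s in a..(a + h), (f s - I / h) ^ 2
      = (∫ s in a..(a + h), f s ^ 2) - I ^ 2 / h := by
    have e : ∀ s, (f s - I / h) ^ 2 = f s ^ 2 - 2 * (I / h) * f s + (I / h) ^ 2 := fun s => by ring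
    simp only [e]
    rw [intervalIntegral.integral_add (h2.sub (h1.const_mul _)) intervalIntegrable_const,
      intervalIntegral.integral_sub h2 (h1.const_mul _), intervalIntegral.integral_const_mul,
      intervalIntegral.integral_const, ← hI, smul_eq_mul]
    field_simp
    ring
  rw [h4] at h3
  have h5 : I ^ 2 / h ≤ ∫ s in a..(a + h), f s ^ 2 := by linarith
  rwa [div_le_iff₀ hh, mul_comm] at h5

/-- Differences of a function are controlled by its weak derivative. -/
theorem IsWD.norm_diffL2_le (hL : 0 < L) {q q' : L2 L} (hq : IsWD q q') {h : ℝ} (hh : 0 < h) :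
    ‖diffL2 h q‖ ≤ h * ‖q'‖ := by
  refine (sq_le_sq₀ (norm_nonneg _) (by positivity)).1 ?_
  obtain ⟨c, hc⟩ := hq.ae_eq hL
  set f : ℝ → ℝ := fun x => ext0 q' x ^ 2 with hf
  have if' : Integrable f := integrable_ext0_sq q'
  -- By Cauchy–Schwarz the squared difference is at most `h ∫ₓ^{x+h} q'²`, which is `h` times a
  -- convolution of `q'²` with this indicator. The integral of a convolution is the product of the
  -- integrals, giving a second factor `h`.
  set χ : ℝ → ℝ := (Ioc (-h) 0).indicator fun _ => 1 with hχ
  have iχ : Integrable χ := (integrable_indicator_iff measurableSet_Ioc).2 (by simp)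
  set B := ContinuousLinearMap.mul ℝ ℝ with hB
  have conv_eq : ∀ x, MeasureTheory.convolution χ f B volume x = ∫ s in x..(x + h), f s := fun x => by
    rw [MeasureTheory.convolution]
    have e1 : ∀ t, B (χ t) (f (x - t)) = (Ioc (-h) 0).indicator (fun t => f (x - t)) t := fun t => by
      by_cases ht : t ∈ Ioc (-h) 0 <;> simp [hχ, hB, ht]
    simp only [e1]
    rw [integral_indicator measurableSet_Ioc,
      ← intervalIntegral.integral_of_le (by linarith), intervalIntegral.integral_comp_sub_left f x]
    simp
  have hae : ∀ᵐ x ∂om L, diffFun h q x ^ 2 ≤ h * MeasureTheory.convolution χ f B volume x := by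
    filter_upwards [hc, ae_shift hc h] with x h1 h2
    rw [conv_eq]
    by_cases hx : x ∈ core L h
    · rw [diffFun_of_mem _ hx, h1, h2 hx, add_sub_add_left_eq_sub, primFun, primFun,
        intervalIntegral.integral_interval_sub_left
          (L2.integrable_indicator q').intervalIntegrable
          (L2.integrable_indicator q').intervalIntegrable]
      exact sq_intervalIntegral_le_of_integrable hh (L2.integrable_indicator q').intervalIntegrable
        if'.intervalIntegrable
    · have : 0 ≤ ∫ s in x..(x + h), f s :=
        intervalIntegral.integral_nonneg (by linarith) fun _ _ => sq_nonneg _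
      rw [diffFun, indicator_of_notMem hx]
      nlinarith
  have ic : Integrable (MeasureTheory.convolution χ f B volume) :=
    MeasureTheory.Integrable.integrable_convolution B iχ if'
  rw [norm_diffL2_sq]
  calc ∫ x in Ioo (0 : ℝ) L, diffFun h q x ^ 2
      ≤ ∫ x in Ioo (0 : ℝ) L, h * MeasureTheory.convolution χ f B volume x :=
        integral_mono_ae (memLp_diffFun h q).integrable_sq (ic.const_mul h).integrableOn hae
    _ ≤ ∫ x, h * MeasureTheory.convolution χ f B volume x := by
        refine setIntegral_le_integral (ic.const_mul h) (Eventually.of_forall fun x => ?_)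
        have : 0 ≤ ∫ s in x..(x + h), f s :=
          intervalIntegral.integral_nonneg (by linarith) fun _ _ => sq_nonneg _
        simp only [conv_eq, Pi.zero_apply]
        positivity
    _ = (h * ‖q'‖) ^ 2 := by
        rw [integral_const_mul, MeasureTheory.integral_convolution B iχ if', hB,
          ContinuousLinearMap.mul_apply', hf, integral_ext0_sq, hχ,
          integral_indicator measurableSet_Ioc]
        simp [hh.le]
        ring

/-- Summation by parts for differences: a translation of the integration variable moves the
difference onto the test function. The cutoff is harmless because the test function vanishes outside
the core. -/
theorem inner_diffL2_test {φ : ℝ → ℝ} (hs : tsupport φ ⊆ Ioo 0 L) {u r : L2 L}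
    (hr : ∀ᵐ x ∂om L, r x = φ x) {h : ℝ} (hφ : ∀ x, x ∉ core L h → φ x = 0)
    (hcont : Continuous φ) (hcs : HasCompactSupport φ) :
    inner ℝ (diffL2 h u) r = ∫ x, ext0 u x * (φ (x - h) - φ x) := by
  have hz : ∀ x, x ∉ Ioo 0 L → φ x = 0 := fun x hx =>
    image_eq_zero_of_notMem_tsupport fun hm => hx (hs hm)
  have mφ : MemLp φ 2 volume := hcont.memLp_of_hasCompactSupport hcs
  have mφ' : MemLp (fun x => φ (x - h)) 2 volume :=
    mφ.comp_measurePreserving (measurePreserving_sub_right volume h)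
  have mu' : MemLp (fun x => ext0 u (x + h)) 2 volume :=
    (memLp_ext0 u).comp_measurePreserving (measurePreserving_add_right volume h)
  have i1 : Integrable fun x => ext0 u (x + h) * φ x := mu'.integrable_mul mφ
  have i2 : Integrable fun x => ext0 u x * φ x := (memLp_ext0 u).integrable_mul mφ
  have i3 : Integrable fun x => ext0 u x * φ (x - h) := (memLp_ext0 u).integrable_mul mφ'
  rw [L2.inner_eq]
  have e1 : ∫ x in Ioo (0 : ℝ) L, diffL2 h u x * r x
      = ∫ x in Ioo (0 : ℝ) L, (ext0 u (x + h) - ext0 u x) * φ x := by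
    refine integral_congr_ae ?_
    filter_upwards [coeFn_diffL2 h u, hr] with x h1 h2
    rw [h1, h2]
    by_cases hx : x ∈ core L h
    · rw [diffFun, indicator_of_mem hx]
    · rw [hφ x hx, mul_zero, mul_zero]
  rw [e1, setIntegral_eq_integral_of_forall_compl_eq_zero fun x hx => by rw [hz x hx, mul_zero]]
  simp only [sub_mul, mul_sub]
  rw [integral_sub i1 i2, integral_sub i3 i2]
  congr 1
  rw [← integral_sub_right_eq_self (fun x => ext0 u (x + h) * φ x) h]
  simp only [sub_add_cancel]

/-- Difference quotients converge weakly to minus the adjoint derivative. -/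
theorem tendsto_inner_diffL2 {φ : ℝ → ℝ} (h1 : ContDiff ℝ (⊤ : ℕ∞) φ) (h2 : HasCompactSupport φ)
    (h3 : tsupport φ ⊆ Ioo 0 L) {u r r' : L2 L} (hr : ∀ᵐ x ∂om L, r x = φ x)
    (hr' : ∀ᵐ x ∂om L, r' x = deriv φ x) :
    Tendsto (fun h : ℝ => inner ℝ (h⁻¹ • diffL2 h u) r) (𝓝[>] 0) (𝓝 (-inner ℝ u r')) := by
  -- The support of `φ` is compact in `(0,L)`, so small translations keep it inside and it lies in
  -- the core.
  obtain ⟨ε, hε, hε'⟩ : ∃ ε > 0, ∀ h ∈ Ioo (0 : ℝ) ε, ∀ x, x ∉ core L h → φ x = 0 := by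
    obtain ⟨δ, hδ, hsub⟩ := h2.isCompact.exists_thickening_subset_open isOpen_Ioo h3
    refine ⟨δ, hδ, fun h hh x hx => image_eq_zero_of_notMem_tsupport fun hm => hx ⟨h3 hm, ?_⟩⟩
    refine hsub (Metric.mem_thickening_iff.2 ⟨x, hm, ?_⟩)
    rw [Real.dist_eq, add_sub_cancel_left, abs_of_pos hh.1]
    exact hh.2
  obtain ⟨C, hC⟩ := h1.lipschitzWith_of_hasCompactSupport h2 (by simp)
  have e2 : -inner ℝ u r' = ∫ x, ext0 u x * (-deriv φ x) := by
    have hz : ∀ x, x ∉ Ioo 0 L → ext0 u x = 0 := fun x hx => indicator_of_notMem hx _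
    rw [L2.inner_eq, ← integral_neg]
    refine Eq.trans ?_ (setIntegral_eq_integral_of_forall_compl_eq_zero
      (s := Ioo (0 : ℝ) L) fun x hx => by rw [hz x hx, zero_mul])
    refine integral_congr_ae ?_
    filter_upwards [hr', ae_restrict_mem measurableSet_Ioo] with x hx hm
    rw [ext0_of_mem u hm, hx]; ring
  have e1 : ∀ᶠ h in 𝓝[>] (0 : ℝ), ∫ x, ext0 u x * (h⁻¹ * (φ (x - h) - φ x))
      = inner ℝ (h⁻¹ • diffL2 h u) r := by
    filter_upwards [Ioo_mem_nhdsGT hε] with h hh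
    rw [real_inner_smul_left, inner_diffL2_test h3 hr (hε' h hh) h1.continuous h2,
      ← integral_const_mul]
    congr 1; ext x; ring
  rw [e2]
  refine Tendsto.congr' e1 ?_
  refine tendsto_integral_filter_of_dominated_convergence (fun x => |ext0 u x| * C) ?_ ?_
    ((integrable_ext0 u).abs.mul_const _) ?_
  · refine Eventually.of_forall fun h => (memLp_ext0 u).aestronglyMeasurable.mul ?_
    have := h1.continuous
    exact (by fun_prop : Continuous fun x => h⁻¹ * (φ (x - h) - φ x)).aestronglyMeasurable
  · filter_upwards [self_mem_nhdsWithin] with h hh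
    have hh' : 0 < h := hh
    refine Eventually.of_forall fun x => ?_
    rw [norm_mul, norm_mul, Real.norm_eq_abs, norm_inv, Real.norm_of_nonneg hh'.le]
    refine mul_le_mul_of_nonneg_left ?_ (abs_nonneg _)
    rw [inv_mul_le_iff₀ hh']
    have := hC.dist_le_mul (x - h) x
    rw [dist_eq_norm, dist_eq_norm, show x - h - x = -h by ring, norm_neg,
      Real.norm_of_nonneg hh'.le] at this
    linarith
  · refine Eventually.of_forall fun x => Tendsto.const_mul _ ?_
    have hd : HasDerivAt (fun h => φ (x - h)) (-deriv φ x) 0 := by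
      have h5 : HasDerivAt φ (deriv φ x) (x - 0) := by
        rw [sub_zero]; exact ((h1.differentiable (by simp)) x).hasDerivAt
      simpa using h5.comp_const_sub x 0
    have := hd.tendsto_slope_zero_right
    simpa using this

/-- A function whose difference quotients are bounded has a weak derivative. -/
theorem exists_isWD_of_norm_diffL2_le {u : L2 L} {C : ℝ}
    (H : ∀ h, 0 < h → ‖diffL2 h u‖ ≤ C * h) : ∃ u' : L2 L, IsWD u u' ∧ ‖u'‖ ≤ C := by
  let e := InnerProductSpace.toDual ℝ (L2 L)
  let G : ℝ → WeakDual ℝ (L2 L) := fun h => StrongDual.toWeakDual (e (h⁻¹ • diffL2 h u))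
  have hK := WeakDual.isCompact_closedBall (0 : StrongDual ℝ (L2 L)) C
  set 𝒰 : Ultrafilter ℝ := Ultrafilter.of (𝓝[>] (0 : ℝ)) with hU
  have hle : (𝒰 : Filter ℝ) ≤ 𝓝[>] 0 := Ultrafilter.of_le _
  -- The difference quotients stay in a ball, which is weak-* compact by Banach–Alaoglu. An
  -- ultrafilter finer than `h → 0+` picks a limit without extraction of a sequence.
  have hmem : ∀ᶠ h in (𝒰 : Filter ℝ), G h ∈
      WeakDual.toStrongDual ⁻¹' Metric.closedBall (0 : StrongDual ℝ (L2 L)) C := by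
    filter_upwards [hle self_mem_nhdsWithin] with h hh
    have hh' : 0 < h := hh
    rw [mem_preimage, mem_closedBall_zero_iff]
    change ‖e (h⁻¹ • diffL2 h u)‖ ≤ C
    rw [LinearIsometryEquiv.norm_map, norm_smul, norm_inv, Real.norm_of_nonneg hh'.le,
      inv_mul_le_iff₀ hh', mul_comm]
    exact H h hh'
  obtain ⟨g, hg, hlim⟩ := hK.ultrafilter_le_nhds (𝒰.map G) (by
    rw [le_principal_iff]; exact hmem)
  have hlim' : Tendsto G 𝒰 (𝓝 g) := hlim
  refine ⟨e.symm (WeakDual.toStrongDual g), ?_, ?_⟩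
  · rintro r ⟨φ, h1, h2, h3, h4, h5⟩
    have t1 : Tendsto (fun h => G h r.1) 𝒰 (𝓝 (g r.1)) :=
      ((WeakDual.eval_continuous r.1).tendsto g).comp hlim'
    have t2 := (tendsto_inner_diffL2 (u := u) h1 h2 h3 h4 h5).mono_left hle
    have e3 := tendsto_nhds_unique t1 t2
    have e4 : inner ℝ (e.symm (WeakDual.toStrongDual g)) r.1 = g r.1 :=
      InnerProductSpace.toDual_symm_apply
    rw [e4, e3, neg_neg]
  · rw [LinearIsometryEquiv.norm_map]
    exact mem_closedBall_zero_iff.1 hg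

theorem IsWD.unique {q q' q'' : L2 L} (h : IsWD q q') (h' : IsWD q q'') : q' = q'' := by
  set d := q' - q'' with hd
  have hz := isOpen_Ioo.ae_eq_zero_of_integral_contDiff_smul_eq_zero (μ := volume)
    (U := Ioo (0 : ℝ) L) (f := d) (IntegrableOn.locallyIntegrableOn (L2.integrable d)) ?_
  · have h0 : d = 0 := L2.eq_of_ae (by
      filter_upwards [(ae_restrict_iff' measurableSet_Ioo).2 hz, Lp.coeFn_zero ℝ 2 (om L)]
        with x h1 h2
      rw [h1, h2]; rfl)
    exact sub_eq_zero.1 h0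
  · intro ψ g1 g2 g3
    obtain ⟨r, hr, r1, r2⟩ := exists_testPair g1 g2 g3
    have e1 := h r hr
    have e2 := h' r hr
    have e3 : inner ℝ d r.1 = 0 := by rw [hd, inner_sub_left]; linarith
    rw [inner_test r1] at e3
    refine Eq.trans ?_ e3
    refine (setIntegral_eq_integral_of_forall_compl_eq_zero (s := Ioo (0 : ℝ) L) fun x hx => by
      rw [image_eq_zero_of_notMem_tsupport fun h' => hx (g3 h'), zero_smul]).symm.trans ?_
    refine integral_congr_ae (Eventually.of_forall fun x => ?_)
    simp [mul_comm]

end Love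

end

/-! ### First-order bounds for space differences, uniformly in time -/

noncomputable section

namespace Love

variable {L : ℝ} {μ : ℝ → ℝ} {p : ℝ} {y₀ : ℝ → H10H2 L} {y₁ : H10H2 L}

theorem norm_diffL2_dx_le (hL : 0 < L) {r : ℝ} (hr : 0 < r) (u : H10H2 L) :
    ‖diffL2 r (dx u)‖ ≤ r * ‖u‖ := by
  have : ‖u.1.2.2‖ ≤ ‖u‖ := (norm_snd_le u.1.2).trans (norm_snd_le u.1)
  exact ((isWD_dx u).norm_diffL2_le hL hr).trans (mul_le_mul_of_nonneg_left this hr.le)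

/-- Differences of the flux, uniformly in time. -/
theorem Data.exists_diff_flux_bound (h : Data μ p y₀ y₁) {R : ℝ} {hR : 0 ≤ R}
    (hR' : √L * ‖dx (y₀ 0)‖ ≤ R) {Y Y1 Y2 : ℝ → V L} (S : h.Sol hR Y Y1 Y2) :
    ∃ W, 0 ≤ W ∧ ∀ t, 0 ≤ t → ∀ r, 0 < r →
      ‖diffL2 r (flux h.two_le hR μ y₀ Y Y1 Y2 t)‖ ≤ W * r := by
  obtain ⟨c, hc, -, E, hE, H⟩ := h.exists_coercive
  obtain ⟨hco, hen⟩ := H R hR hR' Y Y1 Y2 S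
  set A := √(2 * E) with hA
  set B := √(E / c) with hB
  set Λ := (p - 1) * R ^ (p - 2) with hΛ
  have hΛ0 : 0 ≤ Λ := mul_nonneg (by linarith [h.two_le]) (Real.rpow_nonneg hR _)
  have hL := h.pos
  refine ⟨2 * (Λ * (L * B)) + (A + B + A + Λ * B), by positivity, fun t ht r hr => ?_⟩
  have h1 := hco.norm_sq_le (z1 := Y1) (μ := μ) (ζ := dxPath y₀ Y) ht
  have h2 := (hen t ht).1
  have h3 := mem_nonneg (ζ := dxPath y₀ Y) h.ker t
  have h4 : 0 ≤ c * ‖dxV (Y t)‖ ^ 2 := by positivity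
  have b1 : ‖Y1 t‖ ≤ A := Real.le_sqrt_of_sq_le (by linarith)
  have b2 : ‖dxV (Y t)‖ ≤ B := Real.le_sqrt_of_sq_le (by
    rw [le_div_iff₀ hc]; nlinarith [sq_nonneg ‖Y1 t‖])
  have b3 : ‖memVec μ (dxPath y₀ Y) t‖ ≤ A := (Real.le_sqrt_of_sq_le
    ((h.damped S).path.norm_memVec_sq_le h.ker h.integral_le ht)).trans
      (Real.sqrt_le_sqrt (by nlinarith [sq_nonneg ‖Y1 t‖]))
  have b4 : ‖nem h.two_le hR (dxV (Y t))‖ ≤ Λ * B :=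
    (norm_nem_le h.two_le hR _).trans (by rw [← hΛ]; gcongr)
  have b5 : ‖nem h.two_le hR (fnV (Y t))‖ ≤ Λ * (L * B) :=
    (norm_nem_le h.two_le hR _).trans (by
      rw [← hΛ]; gcongr; exact (norm_fnV_le_dxV hL.le _).trans (by gcongr))
  -- The equation itself bounds the acceleration in `H¹₀`, hence the weak derivative of the flux in
  -- `L²`.
  have b6 : ‖Y2 t‖ ≤ Λ * (L * B) + (A + B + A + Λ * B) := by
    rw [S.eq t ht]
    refine (norm_PV_le _ _).trans (add_le_add b5 ?_)
    rw [norm_neg, h.stress_eq S ht]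
    have n1 := norm_add_le (dxV (Y1 t) + ell μ • dxV (Y t) + memVec μ (dxPath y₀ Y) t)
      (nem h.two_le hR (dxV (Y t)))
    have n2 := norm_add_le (dxV (Y1 t) + ell μ • dxV (Y t)) (memVec μ (dxPath y₀ Y) t)
    have n3 := norm_add_le (dxV (Y1 t)) (ell μ • dxV (Y t))
    have n4 : ‖ell μ • dxV (Y t)‖ ≤ ‖dxV (Y t)‖ := by
      rw [norm_smul, Real.norm_of_nonneg h.ell_pos.le]
      exact mul_le_of_le_one_left (norm_nonneg _) h.ell_le
    linarith [norm_dxV_le (Y1 t)]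
  refine ((h.flux_isWD S ht).norm_diffL2_le hL hr).trans ?_
  rw [mul_comm]
  refine mul_le_mul_of_nonneg_right ?_ hr.le
  refine (norm_sub_le _ _).trans ?_
  linarith [norm_fnV_le (Y2 t)]

/-- Integrating an exponential bound of the second derivative twice. -/
theorem norm_le_exp_of_deriv2 {X : Type*} [NormedAddCommGroup X] [NormedSpace ℝ X]
    [CompleteSpace X] {z z1 z2 : ℝ → X} (d0 : ∀ t, HasDerivAt z (z1 t) t)
    (d1 : ∀ t, HasDerivAt z1 (z2 t) t) (hz2 : Continuous z2) {a M B T : ℝ} (ha : 1 ≤ a)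
    (hM : 0 ≤ M) (hB : 0 ≤ B) (hz0 : ‖z 0‖ ≤ B) (hz1 : ‖z1 0‖ ≤ B)
    (h : ∀ s ∈ Icc 0 T, ‖z2 s‖ ≤ M * Real.exp (a * s)) :
    ∀ t ∈ Icc 0 T, ‖z t‖ ≤ (2 * B + M / a) * Real.exp (a * t) ∧
      ‖z1 t‖ ≤ (2 * B + M / a) * Real.exp (a * t) := by
  have ha0 : 0 < a := by linarith
  have hexp : ∀ t : ℝ, 0 ≤ t → 1 ≤ Real.exp (a * t) := fun t ht =>
    Real.one_le_exp (mul_nonneg ha0.le ht)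
  have c1 : Continuous z1 := continuous_iff_continuousAt.2 fun t => (d1 t).continuousAt
  have hMa : 0 ≤ M / a := by positivity
  have k1 : ∀ t ∈ Icc 0 T, ‖z1 t‖ ≤ (B + M / a) * Real.exp (a * t) := fun t ht => by
    have e := intervalIntegral.integral_eq_sub_of_hasDerivAt (fun x _ => d1 x)
      (hz2.intervalIntegrable 0 t)
    have h1 : ‖∫ s in (0 : ℝ)..t, z2 s‖ ≤ M / a * Real.exp (a * t) := by
      refine norm_integral_le_exp ha0 hM ht.1 ?_
      filter_upwards [ae_restrict_mem measurableSet_Ioc] with s hs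
      exact h s ⟨hs.1.le, hs.2.trans ht.2⟩
    rw [e] at h1
    have h2 := norm_le_norm_add_norm_sub (z1 0) (z1 t)
    rw [norm_sub_rev] at h2
    nlinarith [hexp t ht.1]
  intro t ht
  refine ⟨?_, (k1 t ht).trans (mul_le_mul_of_nonneg_right (by linarith) (Real.exp_pos _).le)⟩
  have e := intervalIntegral.integral_eq_sub_of_hasDerivAt (fun x _ => d0 x)
    (c1.intervalIntegrable 0 t)
  have h1 : ‖∫ s in (0 : ℝ)..t, z1 s‖ ≤ (B + M / a) / a * Real.exp (a * t) := by
    refine norm_integral_le_exp ha0 (by positivity) ht.1 ?_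
    filter_upwards [ae_restrict_mem measurableSet_Ioc] with s hs
    exact k1 s ⟨hs.1.le, hs.2.trans ht.2⟩
  rw [e] at h1
  have h2 := norm_le_norm_add_norm_sub (z 0) (z t)
  rw [norm_sub_rev] at h2
  have h3 : (B + M / a) / a * Real.exp (a * t) ≤ (B + M / a) * Real.exp (a * t) :=
    mul_le_mul_of_nonneg_right (div_le_self (by positivity) ha) (Real.exp_pos _).le
  nlinarith [hexp t ht.1]

/-- Differences of the solution in space are of first order, locally in time. -/
theorem Data.exists_local_diff_bound (h : Data μ p y₀ y₁) {R : ℝ} {hR : 0 ≤ R}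
    (hR' : √L * ‖dx (y₀ 0)‖ ≤ R) {Y Y1 Y2 : ℝ → V L} (S : h.Sol hR Y Y1 Y2) (T : ℝ) :
    ∃ C, 0 ≤ C ∧ ∀ r, 0 < r → ∀ t ∈ Icc 0 T, ‖diffL2 r (dxV (Y t))‖ ≤ C * r ∧
      ‖diffL2 r (dxV (Y1 t))‖ ≤ C * r ∧ ‖diffL2 r (dxV (Y2 t))‖ ≤ C * r := by
  obtain ⟨W, hW, hflux⟩ := h.exists_diff_flux_bound hR' S
  set Λ := (p - 1) * R ^ (p - 2) with hΛ
  have hΛ0 : 0 ≤ Λ := mul_nonneg (by linarith [h.two_le]) (Real.rpow_nonneg hR _)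
  set A := ‖y₀ 0‖ + ‖y₁‖ with hA
  set m := ∫ s in Ioi (0 : ℝ), μ s * ‖y₀ s‖ with hm
  have hm0 : 0 ≤ m := setIntegral_nonneg measurableSet_Ioi fun s hs =>
    mul_nonneg (h.ker.nonneg s (le_of_lt hs)) (norm_nonneg _)
  -- The elastic, damping and memory terms each have Lipschitz constant at most one and the power
  -- has `Λ`; this weight makes the feedback of the acceleration on itself equal to one half.
  set a := 2 * (3 + Λ) with ha
  have ha1 : 1 ≤ a := by linarith
  have ha0 : 0 < a := by linarith
  set K0 := W + m + 2 * A * (3 + Λ) with hK0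
  have hA0 : 0 ≤ A := by positivity
  have hK00 : 0 ≤ K0 := by positivity
  have main : ∀ r, 0 < r → ∀ t ∈ Icc 0 T,
      ‖diffL2 r (dxV (Y2 t))‖ ≤ 2 * (K0 * r) * Real.exp (a * t) ∧
      ‖diffL2 r (dxV (Y t))‖ ≤ (2 * (A * r) + 2 * (K0 * r) / a) * Real.exp (a * t) ∧
      ‖diffL2 r (dxV (Y1 t))‖ ≤ (2 * (A * r) + 2 * (K0 * r) / a) * Real.exp (a * t) := by
    intro r hr
    set D := diffL2 (L := L) r with hD
    have d0 : ∀ t, HasDerivAt (fun t => D (dxV (Y t))) (D (dxV (Y1 t))) t := fun t =>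
      D.hasFDerivAt.comp_hasDerivAt t (S.hasDerivAt_dx t)
    have d1 : ∀ t, HasDerivAt (fun t => D (dxV (Y1 t))) (D (dxV (Y2 t))) t := fun t =>
      D.hasFDerivAt.comp_hasDerivAt t (S.hasDerivAt_dx1 t)
    have c2 : Continuous fun t => D (dxV (Y2 t)) :=
      D.continuous.comp (dxV.continuous.comp S.cont)
    have i0 : ‖D (dxV (Y 0))‖ ≤ A * r := by
      rw [S.init0, dxV_toV]
      have := norm_diffL2_dx_le h.pos hr (y₀ 0)
      nlinarith [norm_nonneg y₁]
    have i1 : ‖D (dxV (Y1 0))‖ ≤ A * r := by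
      rw [S.init1, dxV_toV]
      have := norm_diffL2_dx_le h.pos hr y₁
      nlinarith [norm_nonneg (y₀ 0)]
    have hpath := (h.damped S).path
    have past : ∫ s in Ioi (0 : ℝ), μ s * ‖D (dxPath y₀ Y (-s))‖ ≤ m * r := by
      have im : IntegrableOn (fun s => μ s * ‖y₀ s‖) (Ioi 0) := by
        have := (h.isPath2_pastNorm.isPath h.ker).int
        refine this.congr_fun (fun s hs => ?_) measurableSet_Ioi
        simp [pastNorm, glue_neg hs]
      rw [hm, ← integral_mul_const]
      refine integral_mono_of_nonneg ?_ (im.mul_const r) ?_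
      · filter_upwards [h.ker.ae_nonneg] with s hs using mul_nonneg hs (norm_nonneg _)
      · filter_upwards [h.ker.ae_nonneg, ae_restrict_mem measurableSet_Ioi] with s hs hs'
        rw [show dxPath y₀ Y (-s) = dx (y₀ s) from glue_neg hs']
        have := mul_le_mul_of_nonneg_left (norm_diffL2_dx_le h.pos hr (y₀ s)) hs
        linarith
    have φb : ∀ t ∈ Icc 0 T, ‖D (dxV (Y2 t))‖ ≤ 2 * (K0 * r) * Real.exp (a * t) := by
      refine weighted_gronwall (isCompact_Icc.bddAbove_image c2.norm.continuousOn)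
        (fun t _ => norm_nonneg _) ha0.le fun M hM hφ t ht => ?_
      have hX := norm_le_exp_of_deriv2 d0 d1 c2 ha1 hM (by positivity) i0 i1 hφ
      set X := 2 * (A * r) + M / a with hXd
      have hX0 : 0 ≤ X := by positivity
      have hexp : 1 ≤ Real.exp (a * t) := Real.one_le_exp (mul_nonneg ha0.le ht.1)
      have hconv : ‖D (conv μ (dxPath y₀ Y) t)‖ ≤ X * Real.exp (a * t) + m * r := by
        rw [← conv_map h.ker (hpath.isPath h.ker) D ht.1]
        refine (((hpath.map h.ker D).isPath h.ker).norm_conv_le h.ker h.integral_le ht.1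
          (B := X * Real.exp (a * t)) (by positivity) fun s hs => ?_).trans
          (add_le_add_right past _)
        rw [show dxPath y₀ Y s = dxV (Y s) from (h.damped S).eq s hs.1]
        refine (hX s ⟨hs.1, hs.2.trans ht.2⟩).1.trans ?_
        have : Real.exp (a * s) ≤ Real.exp (a * t) :=
          Real.exp_le_exp.2 (mul_le_mul_of_nonneg_left hs.2 ha0.le)
        exact mul_le_mul_of_nonneg_left this hX0
      have hnem : ‖D (nem h.two_le hR (dxV (Y t)))‖ ≤ Λ * (X * Real.exp (a * t)) := by
        have h1 := norm_diffL2_nem_le h.two_le hR (P := fun _ => True) (γ := 0) (η := Λ)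
          (fun a b _ _ => by simpa using abs_trunc_sub_le h.two_le hR a b)
          (u := dxV (Y t)) (Eventually.of_forall fun _ => trivial) r
        rw [zero_smul, sub_zero] at h1
        exact h1.trans (mul_le_mul_of_nonneg_left (hX t ht).1 hΛ0)
      have e : D (dxV (Y2 t)) = D (flux h.two_le hR μ y₀ Y Y1 Y2 t) - (D (dxV (Y t))
          + D (dxV (Y1 t)) - D (conv μ (dxPath y₀ Y) t) + D (nem h.two_le hR (dxV (Y t)))) := by
        rw [← map_add, ← map_sub, ← map_add, ← map_sub]
        congr 1
        rw [flux, stress, dxPath]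
        abel
      rw [e]
      have n1 := norm_sub_le (D (flux h.two_le hR μ y₀ Y Y1 Y2 t)) (D (dxV (Y t))
          + D (dxV (Y1 t)) - D (conv μ (dxPath y₀ Y) t) + D (nem h.two_le hR (dxV (Y t))))
      have n2 := norm_add_le (D (dxV (Y t)) + D (dxV (Y1 t)) - D (conv μ (dxPath y₀ Y) t))
        (D (nem h.two_le hR (dxV (Y t))))
      have n3 := norm_sub_le (D (dxV (Y t)) + D (dxV (Y1 t))) (D (conv μ (dxPath y₀ Y) t))
      have n4 := norm_add_le (D (dxV (Y t))) (D (dxV (Y1 t)))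
      have n5 := hflux t ht.1 r hr
      have n6 := hX t ht
      have n7 : (W + m) * r ≤ (W + m) * r * Real.exp (a * t) :=
        le_mul_of_one_le_right (by positivity) hexp
      have n8 : (3 + Λ) * X = 2 * A * (3 + Λ) * r + M / 2 := by
        rw [hXd, ha]; field_simp
      have n9 : (K0 * r + M / 2) * Real.exp (a * t)
          = (W + m) * r * Real.exp (a * t) + (3 + Λ) * X * Real.exp (a * t) := by
        rw [n8, hK0]; ring
      rw [n9]
      linarith
    intro t ht
    exact ⟨φb t ht, norm_le_exp_of_deriv2 d0 d1 c2 ha1 (by positivity) (by positivity) i0 i1 φb t ht⟩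
  set X := Real.exp (a * T) with hX
  refine ⟨2 * K0 * X + (2 * A + 2 * K0 / a) * X, by positivity, fun r hr t ht => ?_⟩
  obtain ⟨m2, m0, m1⟩ := main r hr t ht
  have hle : Real.exp (a * t) ≤ X := Real.exp_le_exp.2 (mul_le_mul_of_nonneg_left ht.2 ha0.le)
  have q1 : 2 * (K0 * r) * Real.exp (a * t) ≤ 2 * K0 * X * r := by
    calc _ ≤ 2 * (K0 * r) * X := by gcongr
      _ = _ := by ring
  have q2 : (2 * (A * r) + 2 * (K0 * r) / a) * Real.exp (a * t)
      ≤ (2 * A + 2 * K0 / a) * X * r := by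
    calc _ ≤ (2 * (A * r) + 2 * (K0 * r) / a) * X := by gcongr
      _ = _ := by ring
  have q3 : 0 ≤ 2 * K0 * X * r := by positivity
  have q4 : 0 ≤ (2 * A + 2 * K0 / a) * X * r := by positivity
  rw [add_mul]
  exact ⟨by linarith, by linarith, by linarith⟩

/-- Small arguments: the power is linear for `p = 2` and small to first order for `p > 2`. -/
theorem exists_trunc_linear {R : ℝ} (hp : 2 ≤ p) (hR : 0 < R) : ∃ γ : ℝ, 0 ≤ γ ∧ γ ≤ 1 ∧
    ∀ η, 0 < η → ∃ r, 0 < r ∧ ∀ a b, |a| ≤ r → |b| ≤ r →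
      |trunc p R b - trunc p R a - γ * (b - a)| ≤ η * |b - a| := by
  rcases hp.eq_or_lt with rfl | hp2
  · refine ⟨1, zero_le_one, le_rfl, fun η hη => ⟨1, one_pos, fun a b _ _ => ?_⟩⟩
    rw [trunc_two, trunc_two, one_mul, sub_self, abs_zero]
    positivity
  · refine ⟨0, le_rfl, zero_le_one, fun η hη => ?_⟩
    have hq : 0 < p - 2 := by linarith
    have hp1 : 0 < p - 1 := by linarith
    -- On `|s| ≤ ρ` the truncation at `R` may be replaced by that at `ρ`, whose Lipschitz constant
    -- is `(p - 1) ρ^(p-2) = η`.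
    set ρ := (η / (p - 1)) ^ (1 / (p - 2)) with hρ
    have hρ0 : 0 < ρ := by positivity
    have hρ1 : ρ ^ (p - 2) = η / (p - 1) := by
      rw [hρ, ← Real.rpow_mul (by positivity), one_div_mul_cancel hq.ne', Real.rpow_one]
    refine ⟨min R ρ, lt_min hR hρ0, fun a b ha hb => ?_⟩
    rw [trunc_eq_trunc (ha.trans (min_le_left _ _)) (ha.trans (min_le_right _ _)),
      trunc_eq_trunc (hb.trans (min_le_left _ _)) (hb.trans (min_le_right _ _)), zero_mul, sub_zero]
    refine (abs_trunc_sub_le hp hρ0.le a b).trans (le_of_eq ?_)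
    rw [hρ1, mul_div_cancel₀ _ hp1.ne']

/-- The energy of spatial differences, with a linear restoring force `γ`. -/
abbrev enDiff (μ : ℝ → ℝ) (γ : ℝ) (y₀ : ℝ → H10H2 L) (Y Y1 : ℝ → V L) (r : ℝ) : ℝ → ℝ :=
  en μ (ell μ) (ContinuousLinearMap.id ℝ (L2 L)) (fun t => diffL2 r (dxPath y₀ Y t))
    (fun t => diffL2 r (dxV (Y t))) (fun t => diffL2 r (dxV (Y1 t)))
    (fun t => γ / 2 * ‖diffL2 r (dxV (Y t))‖ ^ 2)

/-- Differences do not commute with the power. Its linear part `γ` is kept as a quadratic potential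
and the rest is moved into the forcing. -/
theorem Data.damped_diff (h : Data μ p y₀ y₁) {R : ℝ} {hR : 0 ≤ R} {Y Y1 Y2 : ℝ → V L}
    (S : h.Sol hR Y Y1 Y2) (γ r : ℝ) :
    Damped μ (ell μ) (ContinuousLinearMap.id ℝ (L2 L)) (fun t => diffL2 r (dxPath y₀ Y t))
      (fun t => diffL2 r (dxV (Y t))) (fun t => diffL2 r (dxV (Y1 t)))
      (fun t => diffL2 r (dxV (Y2 t)))
      (fun t => diffL2 r (flux h.two_le hR μ y₀ Y Y1 Y2 t)
        - (diffL2 r (nem h.two_le hR (dxV (Y t))) - γ • diffL2 r (dxV (Y t))))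
      (fun t => γ / 2 * ‖diffL2 r (dxV (Y t))‖ ^ 2)
      (fun t => γ * inner ℝ (diffL2 r (dxV (Y t))) (diffL2 r (dxV (Y1 t))))
      (fun t => γ * ‖diffL2 r (dxV (Y t))‖ ^ 2) := by
  refine h.damped_map S (diffL2 r) (fun t => ?_) fun t ht φ hφ => ?_
  · have h1 := (((diffL2 r).hasFDerivAt.comp_hasDerivAt t
      (S.hasDerivAt_dx t)).norm_sq).const_mul (γ / 2)
    have e : γ / 2 * (2 * inner ℝ (diffL2 r (dxV (Y t))) (diffL2 r (dxV (Y1 t))))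
        = γ * inner ℝ (diffL2 r (dxV (Y t))) (diffL2 r (dxV (Y1 t))) := by ring
    rw [← e]
    exact h1
  · rw [sub_sub_cancel, inner_sub_left, real_inner_smul_left]
    simp only [mem_insert_iff, mem_singleton_iff] at hφ
    rcases hφ with rfl | rfl
    · rfl
    · simp only [real_inner_self_eq_norm_sq]

theorem Data.coercive_diff (h : Data μ p y₀ y₁) {γ : ℝ} (hγ : 0 ≤ γ) (Y : ℝ → V L) (r : ℝ) :
    Coercive (ell μ) (ell μ / 2) (ContinuousLinearMap.id ℝ (L2 L))
      (fun t => diffL2 r (dxV (Y t))) (fun t => γ / 2 * ‖diffL2 r (dxV (Y t))‖ ^ 2)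
      (fun t => γ * ‖diffL2 r (dxV (Y t))‖ ^ 2) := by
  have hl := h.ell_pos
  have hl1 := h.ell_le
  refine ⟨fun t _ => ?_, fun t _ => ?_⟩
  · simp only [ContinuousLinearMap.id_apply]
    have : 0 ≤ γ / 2 * ‖diffL2 r (dxV (Y t))‖ ^ 2 := by positivity
    linarith
  · simp only [ContinuousLinearMap.id_apply]
    have h2 : ell μ / 2 * (ell μ / 2 + γ / 2) ≤ ell μ + γ := by nlinarith
    have h3 := mul_le_mul_of_nonneg_right h2 (sq_nonneg ‖diffL2 r (dxV (Y t))‖)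
    linarith

theorem Data.enDiff_zero_le (h : Data μ p y₀ y₁) {γ : ℝ} (hγ1 : γ ≤ 1) {Y Y1 : ℝ → V L}
    (hY : Y 0 = toV (y₀ 0)) (hY1 : Y1 0 = toV y₁) {r : ℝ} (hr : 0 < r) :
    enDiff μ γ y₀ Y Y1 r 0 ≤ (‖y₁‖ ^ 2 + 2 * ‖y₀ 0‖ ^ 2
      + (2 * ‖y₀ 0‖ ^ 2 + 2 * hist μ (pastNorm y₀) 0)) * r ^ 2 := by
  have hl1 := h.ell_le
  have hT : ∀ u : H10H2 L, ‖diffL2 r (dx u)‖ ≤ r * ‖u‖ := norm_diffL2_dx_le h.pos hr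
  have hh0 : 0 ≤ hist μ (pastNorm y₀) 0 := hist_nonneg h.ker le_rfl
  have b2 := h.mem_map_zero_le (Y := Y) hY hT
  have b3 : ‖diffL2 r (dxV (Y 0))‖ ^ 2 ≤ r ^ 2 * ‖y₀ 0‖ ^ 2 := by
    rw [hY, dxV_toV, ← mul_pow]; exact pow_le_pow_left₀ (norm_nonneg _) (hT _) 2
  have b4 : ‖diffL2 r (dxV (Y1 0))‖ ^ 2 ≤ r ^ 2 * ‖y₁‖ ^ 2 := by
    rw [hY1, dxV_toV, ← mul_pow]; exact pow_le_pow_left₀ (norm_nonneg _) (hT _) 2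
  have b5 : (ell μ / 2) * ‖diffL2 r (dxV (Y 0))‖ ^ 2 ≤ 1 * ‖diffL2 r (dxV (Y 0))‖ ^ 2 :=
    mul_le_mul_of_nonneg_right (by linarith) (sq_nonneg _)
  have b6 : (γ / 2) * ‖diffL2 r (dxV (Y 0))‖ ^ 2 ≤ 1 * ‖diffL2 r (dxV (Y 0))‖ ^ 2 :=
    mul_le_mul_of_nonneg_right (by linarith) (sq_nonneg _)
  have b7 : 0 ≤ r ^ 2 * ‖y₁‖ ^ 2 := by positivity
  have b8 : 0 ≤ r ^ 2 * (2 * ‖y₀ 0‖ ^ 2 + 2 * hist μ (pastNorm y₀) 0) := by positivity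
  rw [enDiff, en, kinPot, ContinuousLinearMap.id_apply]
  linarith

/-- The two alternatives correspond to late times, when `y_x` is small and the power nearly linear,
and to early times, when the local bound on the differences is at hand. -/
theorem Data.norm_diffForce_le (h : Data μ p y₀ y₁) {R : ℝ} (hR : 0 ≤ R) {γ η W C1 r : ℝ}
    (hγ0 : 0 ≤ γ) (hγ1 : γ ≤ 1) (hη : 0 ≤ η) (hC1 : 0 ≤ C1) (hr : 0 < r) {ρ : ℝ}
    (hlin : ∀ a b, |a| ≤ ρ → |b| ≤ ρ →
      |trunc p R b - trunc p R a - γ * (b - a)| ≤ η * |b - a|)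
    {u q : L2 L} (hq : ‖diffL2 r q‖ ≤ W * r)
    (hu : (∀ᵐ x ∂om L, |u x| ≤ ρ) ∨ ‖diffL2 r u‖ ≤ C1 * r) :
    ‖diffL2 r q - (diffL2 r (nem h.two_le hR u) - γ • diffL2 r u)‖
      ≤ (W + ((p - 1) * R ^ (p - 2) + 1) * C1) * r + η * ‖diffL2 r u‖ := by
  set Λ := (p - 1) * R ^ (p - 2) with hΛ
  have hΛ0 : 0 ≤ Λ := mul_nonneg (by linarith [h.two_le]) (Real.rpow_nonneg hR _)
  have n1 := norm_sub_le (diffL2 r q) (diffL2 r (nem h.two_le hR u) - γ • diffL2 r u)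
  rcases hu with hu | hu
  · have n3 := norm_diffL2_nem_le h.two_le hR hlin hu r
    have n4 : 0 ≤ (Λ + 1) * C1 * r := by positivity
    linarith
  · have n3 := norm_diffL2_nem_le h.two_le hR (P := fun _ => True) (γ := γ) (η := Λ + 1)
      (fun a b _ _ => by
        have q1 := abs_trunc_sub_le h.two_le hR a b
        have q2 := abs_sub (trunc p R b - trunc p R a) (γ * (b - a))
        rw [abs_mul, abs_of_nonneg hγ0] at q2
        have q3 := mul_le_mul_of_nonneg_right hγ1 (abs_nonneg (b - a))
        linarith) (u := u) (Eventually.of_forall fun _ => trivial) r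
    have n4 := mul_le_mul_of_nonneg_left hu (by positivity : 0 ≤ Λ + 1)
    have n5 : 0 ≤ η * ‖diffL2 r u‖ := by positivity
    linarith

/-- Differences of the solution in space are of first order, uniformly in time. -/
theorem Data.exists_diff_bound (h : Data μ p y₀ y₁) {R : ℝ} {hR : 0 ≤ R} (hRpos : 0 < R)
    (hR' : √L * ‖dx (y₀ 0)‖ ≤ R) {Y Y1 Y2 : ℝ → V L} (S : h.Sol hR Y Y1 Y2) :
    ∃ C, 0 ≤ C ∧ ∀ r, 0 < r → ∀ t, 0 ≤ t → ‖diffL2 r (dxV (Y t))‖ ≤ C * r := by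
  have hl := h.ell_pos
  have hl1 := h.ell_le
  obtain ⟨W, hW, hflux⟩ := h.exists_diff_flux_bound hR' S
  obtain ⟨γ, hγ0, hγ1, hγ⟩ := exists_trunc_linear h.two_le hRpos
  obtain ⟨C, hC, η, hη, H⟩ := Damped.bounded (l := ell μ) (D := ContinuousLinearMap.id ℝ (L2 L))
    h.ker h.integral_le (c := ell μ / 2) (P := 1) (by positivity) (by linarith) le_rfl (by simp)
  -- The tolerance `η` is the one that the boundedness theorem can absorb. It fixes how small `y_x`
  -- must be, hence the time `t0`, and only then the local constant `C1`.
  obtain ⟨ρ, hρ, hlin⟩ := hγ η hη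
  obtain ⟨t0, ht0⟩ := h.dx_small hR' S hρ
  obtain ⟨C1, hC1, hloc⟩ := h.exists_local_diff_bound hR' S t0
  set h0 := hist μ (pastNorm y₀) 0 with hh0
  have hh00 : 0 ≤ h0 := hist_nonneg h.ker le_rfl
  set K := W + ((p - 1) * R ^ (p - 2) + 1) * C1 with hK
  have hK0 : 0 ≤ K := by
    have : 0 ≤ (p - 1) * R ^ (p - 2) :=
      mul_nonneg (by linarith [h.two_le]) (Real.rpow_nonneg hR _)
    positivity
  set A := C * ((‖y₁‖ ^ 2 + 2 * ‖y₀ 0‖ ^ 2 + (2 * ‖y₀ 0‖ ^ 2 + 2 * h0)) + h0 + K ^ 2) with hA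
  have hA0 : 0 ≤ A := by positivity
  refine ⟨√(2 / ell μ * A), Real.sqrt_nonneg _, fun r hr t ht => ?_⟩
  have hco := h.coercive_diff hγ0 Y r
  have key : enDiff μ γ y₀ Y Y1 r t ≤ C * (enDiff μ γ y₀ Y Y1 r 0
      + hist μ (fun t => diffL2 r (dxPath y₀ Y t)) 0 + (K * r) ^ 2) :=
    H _ _ _ _ _ _ _ _ (h.damped_diff S γ r) hco (K * r) (by positivity)
      (fun τ hτ => h.norm_diffForce_le hR hγ0 hγ1 hη.le hC1 hr hlin (hflux τ hτ r hr)
        ((le_total t0 τ).imp (ht0 τ) fun hle => (hloc r hr τ ⟨hτ, hle⟩).1)) t ht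
  have low := hco.norm_sq_le (μ := μ) (ζ := fun t => diffL2 r (dxPath y₀ Y t))
    (z1 := fun t => diffL2 r (dxV (Y1 t))) ht
  have hmem := mem_nonneg (ζ := fun t => diffL2 r (dxPath y₀ Y t)) h.ker t
  have b1 := h.hist_map_le (Y := Y) (norm_diffL2_dx_le h.pos hr) le_rfl
  have b2 := h.enDiff_zero_le hγ1 S.init0 S.init1 hr
  have up : enDiff μ γ y₀ Y Y1 r t ≤ A * r ^ 2 := by
    refine key.trans ?_
    rw [hA, mul_assoc]
    refine mul_le_mul_of_nonneg_left ?_ hC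
    rw [mul_pow]
    linarith
  simp only [ContinuousLinearMap.id_apply] at low
  have fin : ell μ / 2 * ‖diffL2 r (dxV (Y t))‖ ^ 2 ≤ A * r ^ 2 := by
    have h1 := sq_nonneg ‖diffL2 r (dxV (Y1 t))‖
    linarith
  refine (sq_le_sq₀ (norm_nonneg _) (by positivity)).1 ?_
  rw [mul_pow, Real.sq_sqrt (by positivity)]
  calc ‖diffL2 r (dxV (Y t))‖ ^ 2
      = 2 / ell μ * (ell μ / 2 * ‖diffL2 r (dxV (Y t))‖ ^ 2) := by field_simp
    _ ≤ 2 / ell μ * (A * r ^ 2) := mul_le_mul_of_nonneg_left fin (by positivity)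
    _ = _ := by ring

end Love

end

/-! ### Passage between the `H¹₀` formulation and `H¹₀ ∩ H²` -/

noncomputable section

namespace Love

variable {L : ℝ} {μ : ℝ → ℝ} {p : ℝ} {y₀ : ℝ → H10H2 L} {y₁ : H10H2 L}

/-- The third component is determined by the second because weak derivatives are unique. -/
theorem toV_injective : Function.Injective (toV (L := L)) := fun u w h => by
  have h1 : fn u = fn w := by rw [← fnV_toV, h, fnV_toV]
  have h2 : dx u = dx w := by rw [← dxV_toV, h, dxV_toV]
  have h3 : u.1.2.2 = w.1.2.2 := (isWD_dx u).unique (h2 ▸ isWD_dx w)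
  exact Subtype.ext (Prod.ext h1 (Prod.ext h2 h3))

/-- Needed for the separability of `L²`. -/
instance : Fact ((2 : ℝ≥0∞) ≠ ⊤) := ⟨by simp⟩

/-- A path in `H¹₀ ∩ H²` that is continuous in `H¹₀` is strongly measurable. -/
theorem stronglyMeasurable_of_continuous_toV {y : ℝ → H10H2 L}
    (h : Continuous fun t => toV (y t)) : StronglyMeasurable y := by
  borelize ↥(H10H2 L)
  borelize (V L)
  have hs : SecondCountableTopology (L2 L) := inferInstance
  have : SecondCountableTopology (H10H2 L) :=
    TopologicalSpace.Subtype.secondCountableTopology ((H10H2 L : Set (L2 L × L2 L × L2 L)))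
  -- Lusin–Souslin: a continuous injection between Polish spaces is a measurable embedding, so
  -- measurability in `H¹₀` lifts to `H²`.
  have he := toV.continuous.measurableEmbedding (toV_injective (L := L))
  exact (he.measurable_comp_iff.1 h.measurable).stronglyMeasurable

/-- A function in `H¹₀` whose difference quotients are bounded in `L²` is in `H²`. -/
theorem exists_toV_eq {u : V L} {C : ℝ} (H : ∀ r, 0 < r → ‖diffL2 r (dxV u)‖ ≤ C * r) :
    ∃ q : H10H2 L, toV q = u ∧ ‖q‖ ≤ max ‖u‖ C := by
  obtain ⟨q', hq, hC⟩ := exists_isWD_of_norm_diffL2_le H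
  refine ⟨⟨(fnV u, dxV u, q'), u.pair_mem, hq⟩, rfl, ?_⟩
  exact max_le ((norm_fnV_le u).trans (le_max_left _ _))
    (max_le ((norm_dxV_le u).trans (le_max_left _ _)) (hC.trans (le_max_right _ _)))

theorem inner_nem_of_abs_le {R : ℝ} (hp : 2 ≤ p) (hR : 0 ≤ R) {u : L2 L}
    (hu : ∀ᵐ x ∂om L, |u x| ≤ R) (w : L2 L) :
    inner ℝ (nem hp hR u) w = ∫ x in Ioo (0 : ℝ) L, |u x| ^ (p - 2) * u x * w x := by
  rw [inner_nem]
  refine integral_congr_ae ?_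
  filter_upwards [hu] with x hx
  rw [trunc_of_abs_le hx]

theorem nem_eq_nem {R R' : ℝ} (hp : 2 ≤ p) (hR : 0 ≤ R) (hR' : 0 ≤ R') {u : L2 L}
    (hu : ∀ᵐ x ∂om L, |u x| ≤ R) (hu' : ∀ᵐ x ∂om L, |u x| ≤ R') : nem hp hR u = nem hp hR' u :=
  L2.eq_of_ae (by
    filter_upwards [coeFn_nem hp hR u, coeFn_nem hp hR' u, hu, hu'] with x h1 h2 h3 h4
    rw [h1, h2, trunc_eq_trunc h3 h4])

/-- The weak form of the equation at one time, as an equation in `H¹₀`. -/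
theorem weak_iff {R : ℝ} (hp : 2 ≤ p) (hR : 0 ≤ R) {u v a : H10H2 L} {F : L2 L}
    (h1 : ∀ᵐ x ∂om L, |fn u x| ≤ R) (h2 : ∀ᵐ x ∂om L, |dx u x| ≤ R) :
    (∀ w : H10 L, inner ℝ (fn a) w.1.1 + inner ℝ (dx u + dx v + dx a) w.1.2 - inner ℝ F w.1.2
      = (∫ x in Ioo (0 : ℝ) L, |fn u x| ^ (p - 2) * fn u x * w.1.1 x)
        - ∫ x in Ioo (0 : ℝ) L, |dx u x| ^ (p - 2) * dx u x * w.1.2 x) ↔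
    toV a = PV (nem hp hR (fn u)) (-(dx u + dx v - F + nem hp hR (dx u))) := by
  simp only [← inner_nem_of_abs_le hp hR h1, ← inner_nem_of_abs_le hp hR h2]
  constructor
  · refine fun H => eq_PV fun w => ?_
    have := H ⟨(fnV w, dxV w), w.pair_mem⟩
    rw [V.inner_eq, fnV_toV, dxV_toV]
    simp only [inner_neg_left, inner_add_left, inner_sub_left] at this ⊢
    linarith
  · intro H w
    have := congrArg (fun q => inner ℝ q (V.mk w.1 w.2)) H
    simp only [PV_inner] at this
    simp only [V.inner_eq, fnV_toV, dxV_toV, fnV_mk, dxV_mk] at this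
    simp only [inner_neg_left, inner_add_left, inner_sub_left] at this ⊢
    linarith

/-- The memory term of the equation is a convolution. -/
theorem integral_withPast_eq {y : ℝ → H10H2 L} {Y : ℝ → V L} {t : ℝ}
    (h : ∀ s ∈ Ioo 0 t, toV (y s) = Y s) :
    ∫ s in Ioi (0 : ℝ), μ s • dx (withPast y₀ y (t - s))
      = conv μ (glue (fun s => dx (y₀ s)) fun t => dxV (Y t)) t := by
  refine setIntegral_congr_fun measurableSet_Ioi fun s hs => ?_
  have hs : 0 < s := hs
  simp only [withPast, glue]
  split_ifs with h0
  · rfl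
  · rw [← dxV_toV, h (t - s) ⟨not_le.1 h0, by linarith⟩]

/-- The fundamental theorem of calculus in `H¹₀ ∩ H²`, from that in `H¹₀`. -/
theorem eq_add_integral_of_toV {y v : ℝ → H10H2 L} {t : ℝ}
    (hv : IntervalIntegrable v volume 0 t)
    (h : toV (y t) = toV (y 0) + ∫ s in (0 : ℝ)..t, toV (v s)) :
    y t = y 0 + ∫ s in (0 : ℝ)..t, v s := by
  apply toV_injective
  rw [map_add, h, ContinuousLinearMap.intervalIntegral_comp_comm _ hv]

end Love

end

/-! ### Weak solutions agree with solutions of truncated problems -/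

noncomputable section

namespace Love

variable {L : ℝ} {μ : ℝ → ℝ} {p : ℝ} {y₀ : ℝ → H10H2 L} {y₁ : H10H2 L}

/-- A solution of the problem with truncated nonlinearities that stays below the truncation
level also solves the problem truncated at another such level. -/
theorem Data.Sol.change {h : Data μ p y₀ y₁} {R R' : ℝ} {hR : 0 ≤ R} {Y Y1 Y2 : ℝ → V L}
    (S : h.Sol hR Y Y1 Y2) (hR' : 0 ≤ R')
    (hb : ∀ t, 0 ≤ t → ∀ C ∈ ({R, R'} : Set ℝ),
      (∀ᵐ x ∂om L, |fnV (Y t) x| ≤ C) ∧ ∀ᵐ x ∂om L, |dxV (Y t) x| ≤ C) :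
    h.Sol hR' Y Y1 Y2 where
  cont := S.cont
  d0 := S.d0
  d1 := S.d1
  init0 := S.init0
  init1 := S.init1
  eq t ht := by
    obtain ⟨a1, a2⟩ := hb t ht R (by simp)
    obtain ⟨b1, b2⟩ := hb t ht R' (by simp)
    rw [S.eq t ht, stress, stress, nem_eq_nem h.two_le hR hR' a1 b1,
      nem_eq_nem h.two_le hR hR' a2 b2]

theorem MemLp.intervalIntegrable_of_Ioo {X : Type*} [NormedAddCommGroup X] {u : ℝ → X} {T : ℝ}
    (hu : MemLp u ∞ (volume.restrict (Ioo 0 T))) {t : ℝ} (ht : t ∈ Icc 0 T) :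
    IntervalIntegrable u volume 0 t := by
  have hfin : IsFiniteMeasure (volume.restrict (Ioo 0 T)) := ⟨by simp⟩
  rw [intervalIntegrable_iff_integrableOn_Ioo_of_le ht.1]
  exact IntegrableOn.mono_set (hu.integrable le_top) (Ioo_subset_Ioo_right ht.2)

theorem continuousOn_of_eq_add_integral {X : Type*} [NormedAddCommGroup X] [NormedSpace ℝ X]
    {u v : ℝ → X} {x : X} {T : ℝ} (hT : 0 < T) (hu : MemLp u ∞ (volume.restrict (Ioo 0 T)))
    (hv : ∀ t ∈ Icc 0 T, v t = x + ∫ s in (0 : ℝ)..t, u s) : ContinuousOn v (Icc 0 T) := by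
  have hfin : IsFiniteMeasure (volume.restrict (Ioo 0 T)) := ⟨by simp⟩
  have hi : IntegrableOn u (uIcc 0 T) := by
    rw [uIcc_of_le hT.le]
    exact (integrableOn_Icc_iff_integrableOn_Ioo).2 (hu.integrable le_top)
  have := intervalIntegral.continuousOn_primitive_interval hi
  rw [uIcc_of_le hT.le] at this
  exact (continuousOn_const.add this).congr hv

section WeakSolution

variable {T : ℝ} {z zt ztt : ℝ → H10H2 L}

theorem IsWeakSolution.continuousOn (hz : IsWeakSolution μ p y₀ y₁ T z zt ztt) (hT : 0 < T) :
    ContinuousOn z (Icc 0 T) := continuousOn_of_eq_add_integral hT hz.memLp_yt hz.y_eq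

theorem IsWeakSolution.continuousOn_velocity (hz : IsWeakSolution μ p y₀ y₁ T z zt ztt)
    (hT : 0 < T) : ContinuousOn zt (Icc 0 T) :=
  continuousOn_of_eq_add_integral hT hz.memLp_ytt hz.yt_eq

end WeakSolution

theorem intervalIntegrable_toV {u : ℝ → H10H2 L} {a b : ℝ} (hu : IntervalIntegrable u volume a b) :
    IntervalIntegrable (fun s => toV (u s)) volume a b :=
  ⟨toV.integrable_comp hu.1, toV.integrable_comp hu.2⟩

/-- A weak solution coincides in `H¹₀` with the solution of a truncated problem. -/
theorem Data.weak_unique (h : Data μ p y₀ y₁) {R : ℝ} {hR : 0 ≤ R} {Y Y1 Y2 : ℝ → V L}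
    (S : h.Sol hR Y Y1 Y2) {T : ℝ} (hT : 0 < T) {z zt ztt : ℝ → H10H2 L}
    (hz : IsWeakSolution μ p y₀ y₁ T z zt ztt)
    (hb : ∀ t ∈ Icc 0 T, (∀ᵐ x ∂om L, |fn (z t) x| ≤ R) ∧ ∀ᵐ x ∂om L, |dx (z t) x| ≤ R) :
    ∀ t ∈ Icc 0 T, toV (z t) = Y t := by
  have cz := hz.continuousOn hT
  have cz1 := hz.continuousOn_velocity hT
  have i1 : ∀ t ∈ Icc 0 T, IntervalIntegrable zt volume 0 t := fun t ht =>
    MemLp.intervalIntegrable_of_Ioo hz.memLp_yt ht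
  have i2 : ∀ t ∈ Icc 0 T, IntervalIntegrable ztt volume 0 t := fun t ht =>
    MemLp.intervalIntegrable_of_Ioo hz.memLp_ytt ht
  -- extension of the path beyond `T`
  set Z : ℝ → V L := fun t => toV (z (min t T)) with hZ
  have hZeq : ∀ t ∈ Icc 0 T, Z t = toV (z t) := fun t ht => by simp only [hZ, min_eq_left ht.2]
  have cZ : ContinuousOn Z (Ici 0) := by
    refine toV.continuous.comp_continuousOn (cz.comp (by fun_prop) fun t ht => ?_)
    exact ⟨le_min ht hT.le, min_le_right _ _⟩
  have hz0 : z 0 = y₀ 0 := by rw [hz.y_eq 0 (left_mem_Icc.2 hT.le)]; simp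
  have hZ0 : Z 0 = toV (y₀ 0) := by rw [hZeq 0 (left_mem_Icc.2 hT.le), hz0]
  set Λ := 3 + 2 * ((p - 1) * R ^ (p - 2)) with hΛ
  have hΛ1 : 1 ≤ Λ := by
    have : 0 ≤ (p - 1) * R ^ (p - 2) :=
      mul_nonneg (by linarith [h.two_le]) (Real.rpow_nonneg hR _)
    linarith
  -- The right-hand side has Lipschitz constant `Λ`, so integration against this weight returns half
  -- of the assumed bound.
  set a := 2 * Λ with ha
  have ha1 : 1 ≤ a := by linarith
  have ha0 : 0 < a := by linarith
  have hwe := hz.weak_eq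
  have hsub : ∀ {t}, t ∈ Icc 0 T → ∀ {P : ℝ → Prop}, (∀ᵐ s ∂volume.restrict (Ioo 0 T), P s) →
      ∀ᵐ s ∂volume.restrict (Ioc 0 t), P s := fun {t} ht P hP => by
    rw [← restrict_Ioo_eq_restrict_Ioc]
    exact ae_restrict_of_ae_restrict_of_subset (Ioo_subset_Ioo_right ht.2) hP
  have e1 : ∀ t ∈ Icc 0 T, toV (z t) - Y t = ∫ s in (0 : ℝ)..t, (toV (zt s) - Y1 s) :=
    fun t ht => by
      have k1 : ∫ s in (0 : ℝ)..t, Y1 s = Y t - toV (y₀ 0) := by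
        rw [intervalIntegral.integral_eq_sub_of_hasDerivAt (fun s _ => S.d0 s)
          (S.contY1.intervalIntegrable _ _), S.init0]
      rw [intervalIntegral.integral_sub
        (intervalIntegrable_toV (i1 t ht)) (S.contY1.intervalIntegrable _ _),
        ContinuousLinearMap.intervalIntegral_comp_comm _ (i1 t ht), k1, hz.y_eq t ht, map_add]
      abel
  have e2 : ∀ t ∈ Icc 0 T, toV (zt t) - Y1 t = ∫ s in (0 : ℝ)..t, (toV (ztt s) - Y2 s) :=
    fun t ht => by
      have k1 : ∫ s in (0 : ℝ)..t, Y2 s = Y1 t - toV y₁ := by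
        rw [intervalIntegral.integral_eq_sub_of_hasDerivAt (fun s _ => S.d1 s)
          (S.cont.intervalIntegrable _ _), S.init1]
      rw [intervalIntegral.integral_sub
        (intervalIntegrable_toV (i2 t ht)) (S.cont.intervalIntegrable _ _),
        ContinuousLinearMap.intervalIntegral_comp_comm _ (i2 t ht), k1, hz.yt_eq t ht, map_add]
      abel
  have e3 : ∀ᵐ t ∂volume.restrict (Ioo 0 T), toV (ztt t)
      = PV (nem h.two_le hR (fnV (Z t)))
        (-stress h.two_le hR μ (fun s => dx (y₀ s)) Z (fun t => toV (zt t)) t) := by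
    filter_upwards [hwe, ae_restrict_mem measurableSet_Ioo] with t h1 ht
    have ht' : t ∈ Icc 0 T := Ioo_subset_Icc_self ht
    have := (weak_iff h.two_le hR (hb t ht').1 (hb t ht').2).1 h1
    rw [this, stress, hZeq t ht', integral_withPast_eq (Y := Z) fun s hs =>
      (hZeq s ⟨hs.1.le, hs.2.le.trans ht'.2⟩).symm]
    rfl
  -- Gronwall is applied to the difference of the velocities. The data agree, so there is no
  -- inhomogeneous term and the difference vanishes.
  have key := weighted_gronwall (T := T) (K := 0) (a := a) (φ := fun t => ‖toV (zt t) - Y1 t‖)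
    ?_ (fun _ _ => norm_nonneg _) ha0.le fun M hM hφ t ht => ?_
  · intro t ht
    have hz1 : ∀ s ∈ Icc 0 T, toV (zt s) - Y1 s = 0 := fun s hs => by
      have := key s hs
      rw [mul_zero, zero_mul] at this
      exact norm_le_zero_iff.1 this
    rw [← sub_eq_zero, e1 t ht, intervalIntegral.integral_congr (g := fun _ => 0) fun s hs => ?_]
    · simp
    · rw [uIcc_of_le ht.1] at hs
      exact hz1 s ⟨hs.1, hs.2.trans ht.2⟩
  · exact isCompact_Icc.bddAbove_image
      ((toV.continuous.comp_continuousOn cz1).sub S.contY1.continuousOn).norm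
  · have k0 : ∀ s ∈ Icc 0 T, ‖Z s - Y s‖ ≤ M * Real.exp (a * s) := fun s hs => by
      rw [hZeq s hs, e1 s hs]
      refine (norm_integral_le_exp ha0 hM hs.1 ?_).trans
        (mul_le_mul_of_nonneg_right (div_le_self hM ha1) (Real.exp_pos _).le)
      filter_upwards [ae_restrict_mem measurableSet_Ioc] with r hr
      exact hφ r ⟨hr.1.le, hr.2.trans hs.2⟩
    rw [e2 t ht]
    refine (norm_integral_le_exp (M := Λ * M) ha0 (by positivity) ht.1 ?_).trans (le_of_eq ?_)
    · filter_upwards [hsub ht e3, ae_restrict_mem measurableSet_Ioc] with s hs hs'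
      have hsT : s ∈ Icc 0 T := ⟨hs'.1.le, hs'.2.trans ht.2⟩
      rw [hs, S.eq s hsT.1, mul_assoc]
      refine norm_rhs_sub_le h.two_le hR h.ker h.integral_le h.pastOf cZ S.contY.continuousOn hZ0
        S.init0 hsT.1 (fun r hr => (k0 r ⟨hr.1, hr.2.trans hsT.2⟩).trans ?_) (hφ s hsT)
      exact mul_le_mul_of_nonneg_left
        (Real.exp_le_exp.2 (mul_le_mul_of_nonneg_left hr.2 ha0.le)) hM
    · rw [ha]; field_simp; ring

end Love

end

/-! ### Choice of the truncation level, and conclusion -/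

noncomputable section

namespace Love

variable {L : ℝ} {μ : ℝ → ℝ} {p : ℝ} {y₀ : ℝ → H10H2 L} {y₁ : H10H2 L}

theorem norm_le_of_diff {q : H10H2 L} {C : ℝ} (H : ∀ r, 0 < r → ‖diffL2 r (dx q)‖ ≤ C * r) :
    ‖q‖ ≤ max ‖toV q‖ C := by
  obtain ⟨q', h1, h2⟩ := exists_toV_eq (u := toV q) H
  rwa [toV_injective h1] at h2

/-- First-order bounds on the differences bound the `H²` norm pointwise in time; strong
measurability in `H²` comes from continuity in `H¹₀`. -/
theorem memLp_top_of_diff {u : ℝ → H10H2 L} {W : ℝ → V L} (hW : Continuous W)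
    (hu : ∀ t, toV (u t) = W (max t 0)) {s : Set ℝ} (hs : MeasurableSet s) (hs0 : s ⊆ Ici 0)
    {B C : ℝ} (hB : ∀ t ∈ s, ‖W t‖ ≤ B)
    (H : ∀ r, 0 < r → ∀ t ∈ s, ‖diffL2 r (dxV (W t))‖ ≤ C * r) :
    MemLp u ∞ (volume.restrict s) := by
  have hm : StronglyMeasurable u := stronglyMeasurable_of_continuous_toV (by
    simp only [hu]; fun_prop)
  refine memLp_top_of_bound hm.aestronglyMeasurable (max B C) ?_
  filter_upwards [ae_restrict_mem hs] with t ht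
  have e : toV (u t) = W t := by rw [hu, max_eq_left (hs0 ht)]
  refine (norm_le_of_diff (C := C) fun r hr => ?_).trans (max_le_max (by rw [e]; exact hB t ht) le_rfl)
  rw [← dxV_toV, e]
  exact H r hr t ht

/-- Uniform bounds for the solution, and a truncation level that it does not reach. -/
theorem Data.exists_sol (h : Data μ p y₀ y₁) : ∃ (R : ℝ) (hR : 0 ≤ R) (B : ℝ), 0 < R ∧
    √L * ‖dx (y₀ 0)‖ ≤ R ∧ ∃ Y Y1 Y2 : ℝ → V L, h.Sol hR Y Y1 Y2 ∧
    ∀ t, 0 ≤ t → (∀ᵐ x ∂om L, |fnV (Y t) x| ≤ R) ∧ (∀ᵐ x ∂om L, |dxV (Y t) x| ≤ R) ∧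
      ‖Y t‖ ≤ B ∧ ‖Y1 t‖ ≤ B := by
  obtain ⟨M, hM, hsup⟩ := h.exists_sup_bound
  obtain ⟨c, hc, -, E, hE, hco⟩ := h.exists_coercive
  set N := √(E / c) with hN
  set a := √L * ‖dx (y₀ 0)‖ with ha
  have ha0 : 0 ≤ a := by positivity
  have hN0 : 0 ≤ √L * N := by positivity
  -- `M` and `N` bound `y_x` pointwise and in `L²`, independently of the level, so the level can be
  -- placed above them; `√L N` dominates `|y|`.
  set R := 1 + a + M + √L * N with hRdef
  have hR : 0 ≤ R := by linarith
  have haR : a ≤ R := by linarith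
  obtain ⟨Y, Y1, Y2, S⟩ := exists_truncSol h.two_le hR h.ker h.integral_le h.pastOf (toV y₁)
  have S : h.Sol hR Y Y1 Y2 := S
  obtain ⟨hc1, hc2⟩ := hco R hR haR Y Y1 Y2 S
  refine ⟨R, hR, max (√(1 + L ^ 2) * N) (√(2 * E)), by linarith, haR, Y, Y1, Y2, S, fun t ht => ?_⟩
  have hen := hc1.norm_sq_le (z1 := Y1) (μ := μ) (ζ := dxPath y₀ Y) ht
  have hE' := (hc2 t ht).1
  have hm := mem_nonneg (ζ := dxPath y₀ Y) h.ker t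
  have hen : 1 / 2 * ‖Y1 t‖ ^ 2 + c * ‖dxV (Y t)‖ ^ 2 ≤ E := by
    have := hen.trans hE'
    linarith
  have hd : ‖dxV (Y t)‖ ≤ N := Real.le_sqrt_of_sq_le (by
    rw [le_div_iff₀ hc]; nlinarith [sq_nonneg ‖Y1 t‖])
  refine ⟨?_, ?_, ?_, ?_⟩
  · filter_upwards [fnV_abs_le h.pos.le (Y t)] with x hx
    have := mul_le_mul_of_nonneg_left hd (Real.sqrt_nonneg L)
    linarith
  · filter_upwards [hsup R hR haR Y Y1 Y2 S t ht] with x hx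
    linarith
  · refine le_trans ?_ (le_max_left _ _)
    have h1 : ‖Y t‖ ≤ √(1 + L ^ 2) * ‖dxV (Y t)‖ := by
      rw [← Real.sqrt_sq (norm_nonneg (dxV (Y t))), ← Real.sqrt_mul (by positivity)]
      exact Real.le_sqrt_of_sq_le (V.norm_sq_le h.pos.le _)
    exact h1.trans (mul_le_mul_of_nonneg_left hd (Real.sqrt_nonneg _))
  · refine le_trans ?_ (le_max_right _ _)
    exact Real.le_sqrt_of_sq_le (by nlinarith [mul_nonneg hc.le (sq_nonneg ‖dxV (Y t)‖)])

/-- Below the level the truncated equation is the original one. Local-in-time difference bounds put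
`y`, `y'` and `y''` in `H²` on each `[0,T]`; the uniform bounds give the global statements, for `y`
in `H²` and for `y'` in `H¹₀` only. -/
theorem Data.exists_solution (h : Data μ p y₀ y₁) : ∃ y yt ytt : ℝ → H10H2 L,
    (∀ T : ℝ, 0 < T → IsWeakSolution μ p y₀ y₁ T y yt ytt) ∧
    (∀ T : ℝ, 0 < T → ∀ z zt ztt : ℝ → H10H2 L,
      IsWeakSolution μ p y₀ y₁ T z zt ztt → ∀ t ∈ Icc 0 T, z t = y t) ∧
    MemLp y ∞ (volume.restrict (Ioi 0)) ∧
    MemLp (fun t => toH10 (yt t)) ∞ (volume.restrict (Ioi 0)) := by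
  obtain ⟨R, hR, B, hRpos, hR', Y, Y1, Y2, S, hb⟩ := h.exists_sol
  obtain ⟨C, -, hC⟩ := h.exists_diff_bound hRpos hR' S
  choose K hK0 hK using h.exists_local_diff_bound hR' S
  have ht0 : ∀ t : ℝ, max t 0 ∈ Icc 0 (max t 0) := fun t => ⟨le_max_right _ _, le_rfl⟩
  -- The lift to `H²` at time `t` uses the difference bound on `[0, t]`. Negative times are sent to
  -- zero, and the values there play no role.
  choose y hy _ using fun t : ℝ => exists_toV_eq fun r hr => (hK (max t 0) r hr _ (ht0 t)).1
  choose yt hyt _ using fun t : ℝ => exists_toV_eq fun r hr => (hK (max t 0) r hr _ (ht0 t)).2.1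
  choose ytt hytt _ using fun t : ℝ => exists_toV_eq fun r hr => (hK (max t 0) r hr _ (ht0 t)).2.2
  have ey : ∀ t, 0 ≤ t → toV (y t) = Y t := fun t ht => by rw [hy, max_eq_left ht]
  have eyt : ∀ t, 0 ≤ t → toV (yt t) = Y1 t := fun t ht => by rw [hyt, max_eq_left ht]
  have eytt : ∀ t, 0 ≤ t → toV (ytt t) = Y2 t := fun t ht => by rw [hytt, max_eq_left ht]
  have y0 : y 0 = y₀ 0 := toV_injective (by rw [ey 0 le_rfl, S.init0])
  have yt0 : yt 0 = y₁ := toV_injective (by rw [eyt 0 le_rfl, S.init1])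
  have loc : ∀ (T : ℝ) {u : ℝ → H10H2 L} {W : ℝ → V L}, Continuous W →
      (∀ t, toV (u t) = W (max t 0)) →
      (∀ r, 0 < r → ∀ t ∈ Ioo 0 T, ‖diffL2 r (dxV (W t))‖ ≤ K T * r) →
      MemLp u ∞ (volume.restrict (Ioo 0 T)) := fun T u W hW hu H => by
    obtain ⟨A, hA⟩ := isCompact_Icc.exists_bound_of_continuousOn (hW.continuousOn (s := Icc 0 T))
    exact memLp_top_of_diff hW hu measurableSet_Ioo (fun t ht => ht.1.le)
      (fun t ht => hA t (Ioo_subset_Icc_self ht)) H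
  have m0 : ∀ T, MemLp y ∞ (volume.restrict (Ioo 0 T)) := fun T =>
    loc T S.contY hy fun r hr t ht => (hK T r hr t (Ioo_subset_Icc_self ht)).1
  have m1 : ∀ T, MemLp yt ∞ (volume.restrict (Ioo 0 T)) := fun T =>
    loc T S.contY1 hyt fun r hr t ht => (hK T r hr t (Ioo_subset_Icc_self ht)).2.1
  have m2 : ∀ T, MemLp ytt ∞ (volume.restrict (Ioo 0 T)) := fun T =>
    loc T S.cont hytt fun r hr t ht => (hK T r hr t (Ioo_subset_Icc_self ht)).2.2
  have ftc : ∀ {W W' : ℝ → V L} {u : ℝ → H10H2 L}, (∀ t, HasDerivAt W (W' t) t) → Continuous W' →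
      (∀ t, 0 ≤ t → toV (u t) = W' t) → ∀ t, 0 ≤ t →
      W t = W 0 + ∫ s in (0 : ℝ)..t, toV (u s) := fun {W W' u} hd hc hu t ht => by
    have e : ∫ s in (0 : ℝ)..t, toV (u s) = ∫ s in (0 : ℝ)..t, W' s :=
      intervalIntegral.integral_congr fun s hs => hu s (by rw [uIcc_of_le ht] at hs; exact hs.1)
    rw [e, intervalIntegral.integral_eq_sub_of_hasDerivAt (fun s _ => hd s)
      (hc.intervalIntegrable _ _), add_sub_cancel]
  refine ⟨y, yt, ytt, fun T hT => ⟨m0 T, m1 T, m2 T, fun t ht => ?_, fun t ht => ?_, ?_⟩,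
    fun T hT z zt ztt hz t ht => ?_, ?_, ?_⟩
  · rw [← y0]
    refine eq_add_integral_of_toV (MemLp.intervalIntegrable_of_Ioo (m1 T) ht) ?_
    rw [ey t ht.1, ey 0 le_rfl]
    exact ftc S.d0 S.contY1 eyt t ht.1
  · rw [← yt0]
    refine eq_add_integral_of_toV (MemLp.intervalIntegrable_of_Ioo (m2 T) ht) ?_
    rw [eyt t ht.1, eyt 0 le_rfl]
    exact ftc S.d1 S.cont eytt t ht.1
  · filter_upwards [ae_restrict_mem measurableSet_Ioo] with t ht
    have ht' := ht.1.le
    obtain ⟨b1, b2, -, -⟩ := hb t ht'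
    rw [← ey t ht'] at b1 b2
    refine (weak_iff h.two_le hR b1 b2).2 ?_
    rw [eytt t ht', S.eq t ht', stress, integral_withPast_eq (Y := Y) fun s hs => ey s hs.1.le,
      ← ey t ht', ← eyt t ht']
    rfl
  · obtain ⟨A, hA⟩ := isCompact_Icc.exists_bound_of_continuousOn (hz.continuousOn hT)
    -- `A` bounds the `H²` norm of the competing solution on `[0,T]`, so at level `R'` the
    -- truncation is invisible for both solutions.
    set R' := max R (2 * √L * A) with hRd
    have hR0 : 0 ≤ R' := hR.trans (le_max_left _ _)
    have S' : h.Sol hR0 Y Y1 Y2 := S.change hR0 fun s hs D hD => by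
      have hRD : R ≤ D := by
        rcases hD with rfl | hD
        · exact le_rfl
        · rw [mem_singleton_iff.1 hD]; exact le_max_left _ _
      obtain ⟨b1, b2, -, -⟩ := hb s hs
      exact ⟨b1.mono fun x hx => hx.trans hRD, b2.mono fun x hx => hx.trans hRD⟩
    refine toV_injective ((h.weak_unique S' hT hz (fun s hs => ?_) t ht).trans (ey t ht.1).symm)
    have hA' := mul_le_mul_of_nonneg_left (hA s hs) (by positivity : 0 ≤ 2 * √L)
    constructor
    · filter_upwards [fnV_abs_le h.pos.le (toV (z s))] with x hx
      rw [fnV_toV, dxV_toV] at hx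
      have h1 := mul_le_mul_of_nonneg_left (norm_dx_le (z s)) (Real.sqrt_nonneg L)
      have h2 : 0 ≤ √L * ‖z s‖ := by positivity
      exact hx.trans ((by linarith : √L * ‖dx (z s)‖ ≤ 2 * √L * A).trans (le_max_right _ _))
    · filter_upwards [dx_abs_le h.pos (z s)] with x hx
      exact hx.trans (hA'.trans (le_max_right _ _))
  · exact memLp_top_of_diff S.contY hy measurableSet_Ioi Ioi_subset_Ici_self
      (fun t ht => (hb t (le_of_lt ht)).2.2.1) fun r hr t ht => hC r hr t (le_of_lt ht)
  · have e : ∀ t, toH10 (yt t) = ⟨(fnV (Y1 (max t 0)), dxV (Y1 (max t 0))), V.pair_mem _⟩ :=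
      fun t => Subtype.ext (by rw [← hyt t]; rfl)
    have c1 := S.contY1
    have hc : Continuous fun t => toH10 (yt t) := by
      simp only [e]
      exact Continuous.subtype_mk (by fun_prop) _
    refine memLp_top_of_bound hc.aestronglyMeasurable B ?_
    filter_upwards [ae_restrict_mem measurableSet_Ioi] with t ht
    have ht' : (0 : ℝ) ≤ t := le_of_lt ht
    rw [e, max_eq_left ht']
    have := (hb t ht').2.2.2
    exact max_le ((norm_fnV_le _).trans this) ((norm_dxV_le _).trans this)

/-- When the present state is zero, only the nonnegative memory term of `I` survives. -/
theorem I_nonneg_of_eq_zero (hμ : IsKernel μ) (hp : 0 < p) {y : ℝ → H10H2 L}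
    {t : ℝ} (h : y t = 0) : 0 ≤ I μ p y t := by
  have hz : powInt p (0 : L2 L) = 0 := by
    rw [powInt, integral_congr_ae (g := fun _ => 0), integral_zero]
    filter_upwards [Lp.coeFn_zero ℝ 2 (om L)] with x hx
    rw [hx, Pi.zero_apply, abs_zero, Real.zero_rpow hp.ne']
  have h1 : dx (y t) = 0 := by rw [h]; rfl
  have h2 : fn (y t) = 0 := by rw [h]; rfl
  have hm : 0 ≤ memory μ y t := setIntegral_nonneg measurableSet_Ioi fun s hs =>
    mul_nonneg (hμ.nonneg s (le_of_lt hs)) (sq_nonneg _)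
  rw [I, h1, h2, hz, norm_zero]
  linarith

end Love

end

theorem theorem2p7 (L : ℝ) (hL : 0 < L) (μ : ℝ → ℝ) (hμ : Love.Hyp1 μ) (p : ℝ) (hp : 2 ≤ p)
    (y₀ : ℝ → Love.H10H2 L) (y₁ : Love.H10H2 L)
    (hy₀_meas : AEStronglyMeasurable y₀ (volume.restrict (Ioi 0)))
    (hy₀ : IntegrableOn (fun s => μ s * ‖y₀ s‖ ^ 2) (Ioi 0))
    (hW : Love.InStableSet μ p (fun t => y₀ (-t)) 0)
    (hsmall : Love.poincareConst L p ^ p * Love.ell μ ^ (1 - p / 2)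
      * (2 * p / (p - 2) * Love.energy μ p (fun t => y₀ (-t)) y₁ 0) ^ ((p - 2) / 2)
      < Love.ell μ) :
    ∃ y yt ytt : ℝ → Love.H10H2 L,
      (∀ T : ℝ, 0 < T → Love.IsWeakSolution μ p y₀ y₁ T y yt ytt) ∧
      (∀ T : ℝ, 0 < T → ∀ z zt ztt : ℝ → Love.H10H2 L,
        Love.IsWeakSolution μ p y₀ y₁ T z zt ztt → ∀ t ∈ Icc 0 T, z t = y t) ∧
      MemLp y ∞ (volume.restrict (Ioi 0)) ∧
      MemLp (fun t => Love.toH10 (yt t)) ∞ (volume.restrict (Ioi 0)) := by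
  refine Love.Data.exists_solution ⟨hL, hp, hμ.isKernel, hμ.one_sub_integral_pos, hy₀_meas, hy₀, ?_,
    hsmall⟩
  -- Both ways of being in the stable set give `I ≥ 0` at time zero; the barrier itself comes from
  -- the smallness condition.
  rcases hW with hI | h0
  · exact hI.1.le
  · exact Love.I_nonneg_of_eq_zero hμ.isKernel (by linarith) h0
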